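/- For a positive definite quadratic space $(V,Q)$ over $\mathbb{Q}$ and a $\mathbb{Z}$-lattice $L$ on $V$, let $\mathrm{gen}(L)$ be the genus of $L$ (all $\mathbb{Z}$-lattices $M$ on $V$ such that $M_p$ and $L_p$ are isometric under $O(V_p)$ for every prime $p$), let the class of a lattice be its orbit under $O(V)$, and let $O(M)=\{\sigma\in O(V):\sigma(M)=M\}$. For an integer $n\ge 1$ let $K(n)$ be the ternary lattice with Gram matrix $(B(x_i,x_j))$ equal to $$\begin{pmatrix}2&0&-1\\0&2&-1\\-1&-1&6\cdot 7^{2n}+1\end{pmatrix}, \qquad Q(x)=B(x,x).$$ Then the set of isometry classes in $\mathrm{gen}(K(n))$ is finite, and, writing $g_m(n)$ for the number of classes in $\mathrm{gen}(K(n))$ of lattices whose isometry group has order $m$: 1. $g_{16}(n)=1$, and the only class of lattices in $\mathrm{gen}(K(n))$ with isometry group of order $16$ is that of $K(n)$; 2. $g_8(n)=0$; 3. $g_4(n)=4\cdot 7^{n-1}-1$; 4. $g_2(n)=3\cdot 7^{2(n-1)}-2\cdot 7^{n-1}-\frac38\left(7^{2(n-1)}-1\right)$; 5. the class number of $K(n)$,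 that is, the number of isometry classes in $\mathrm{gen}(K(n))$, is $$3\cdot 7^{2(n-1)}+2\cdot 7^{n-1}-\frac38\left(7^{2(n-1)}-1\right).$$ -/

import Mathlib

open scoped TensorProduct

noncomputable section

namespace QuadLattice

section General

variable {F V : Type*} [Field F] [AddCommGroup V] [Module F V]

/-- The orthogonal group `O(V)` of the quadratic space `(V, Q)` over the field `F`. -/
def orthogonalGroup (Q : QuadraticForm F V) : Subgroup (V ≃ₗ[F] V) where
  carrier := {σ | ∀ x, Q (σ x) = Q x}
  one_mem' := fun _ => rfl
  mul_mem' := by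
    intro σ τ hσ hτ x
    rw [LinearEquiv.mul_apply, hσ, hτ]
  inv_mem' := by
    intro σ hσ x
    have h := hσ (σ⁻¹ x)
    rw [← LinearEquiv.mul_apply, mul_inv_cancel, LinearEquiv.coe_one, id] at h
    exact h.symm

variable {R : Type*} [CommRing R] [Algebra R F] [Module R V] [IsScalarTower R F V]

/-- The image `σ(L)` of an `R`-submodule `L` of `V` under an `F`-linear automorphism of `V`. -/
def image (σ : V ≃ₗ[F] V) (L : Submodule R V) : Submodule R V :=
  L.map (σ.toLinearMap.restrictScalars R)

/-- Two `R`-submodules `L`, `M` of `(V, Q)` are isometric (in the same class) if `σ(L) = M` for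
some `σ ∈ O(V)`. -/
def Isometric (Q : QuadraticForm F V) (L M : Submodule R V) : Prop :=
  ∃ σ ∈ orthogonalGroup Q, image σ L = M

/-- The isometry group `O(L) = {σ ∈ O(V) : σ(L) = L}`. -/
def isometryGroup (Q : QuadraticForm F V) (L : Submodule R V) : Subgroup (V ≃ₗ[F] V) where
  carrier := {σ | σ ∈ orthogonalGroup Q ∧ image σ L = L}
  one_mem' := ⟨one_mem _, by ext x; simp [image]⟩
  mul_mem' := by
    rintro σ τ ⟨hσ, hσL⟩ ⟨hτ, hτL⟩
    refine ⟨mul_mem hσ hτ, ?_⟩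
    have h : image (σ * τ) L = image σ (image τ L) := by
      ext x; simp [image]
    rw [h, hτL, hσL]
  inv_mem' := by
    rintro σ ⟨hσ, hσL⟩
    refine ⟨inv_mem hσ, ?_⟩
    have h : image σ⁻¹ (image σ L) = L := by
      ext x
      simp [image]
    rw [hσL] at h
    exact h

end General

section Genus

variable {V : Type*} [AddCommGroup V] [Module ℚ V]

/-- The completion `L_p` of a `ℤ`-lattice `L` on `V`: the `ℤ_p`-submodule of
`V_p = ℚ_p ⊗ V` generated by `L`. -/
def localization (p : ℕ) [Fact p.Prime] (L : Submodule ℤ V) : Submodule ℤ_[p] (ℚ_[p] ⊗[ℚ] V) :=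
  Submodule.span ℤ_[p] ((fun v : V => (1 : ℚ_[p]) ⊗ₜ[ℚ] v) '' (L : Set V))

/-- The genus of `L`: all `ℤ`-lattices `M` on the quadratic space `(V, Q)` such that, for every
prime `p`, `L_p` and `M_p` are isometric under `O(V_p)`. -/
def genus (Q : QuadraticForm ℚ V) (L : Submodule ℤ V) : Set (Submodule ℤ V) :=
  {M | M.IsLattice ℚ ∧ ∀ (p : ℕ) [Fact p.Prime],
    Isometric (Q.baseChange ℚ_[p]) (localization p L) (localization p M)}

/-- The isometry class of the lattice `L`, as a set of lattices on `V`. -/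
def isometryClass (Q : QuadraticForm ℚ V) (L : Submodule ℤ V) : Set (Submodule ℤ V) :=
  {M | Isometric Q L M}

/-- The set of isometry classes in the genus of `L`. -/
def genusClasses (Q : QuadraticForm ℚ V) (L : Submodule ℤ V) : Set (Set (Submodule ℤ V)) :=
  isometryClass Q '' genus Q L

/-- The set of isometry classes in the genus of `L` of those lattices whose isometry group has
order `m`. -/
def genusClassesOfOrder (Q : QuadraticForm ℚ V) (L : Submodule ℤ V) (m : ℕ) :
    Set (Set (Submodule ℤ V)) :=
  isometryClass Q '' {M ∈ genus Q L | Nat.card (isometryGroup Q M) = m}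

/-- The class number of `L`: the number of isometry classes in the genus of `L`. -/
def classNumber (Q : QuadraticForm ℚ V) (L : Submodule ℤ V) : ℕ :=
  (genusClasses Q L).ncard

end Genus

/-- The Gram matrix of `K₄(a, b)`. -/
def K4Gram (a b : ℤ) : Matrix (Fin 3) (Fin 3) ℤ :=
  !![2 * a, 0, -a; 0, 2 * a, -a; -a, -a, b]

/-- The quadratic form `x ↦ xᵀ A x` on `ℚ³` of a ternary Gram matrix `A`. -/
def gramForm (A : Matrix (Fin 3) (Fin 3) ℤ) : QuadraticForm ℚ (Fin 3 → ℚ) :=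
  (A.map (Int.cast : ℤ → ℚ)).toQuadraticForm'

/-- The lattice `ℤ³` in `ℚ³`. -/
def stdLattice : Submodule ℤ (Fin 3 → ℚ) :=
  Submodule.span ℤ (Set.range (Pi.basisFun ℚ (Fin 3)))

/-- The quadratic form of the quadratic space on which `K(n) = K₄(1, 6·7²ⁿ + 1)` lives; the
lattice `K(n)` itself is `stdLattice` in this space. -/
def KForm (n : ℕ) : QuadraticForm ℚ (Fin 3 → ℚ) :=
  gramForm (K4Gram 1 (6 * 7 ^ (2 * n) + 1))

end QuadLattice

end

noncomputable section

namespace QuadLattice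

/-! In the orthogonal coordinates `coords`, the form becomes Q = u² + v² + 6z², and K(n) becomes the
sublattice of E = {u + v + z even} cut out by 7ⁿ ∣ z, that is, by orthogonality to (0,0,1) modulo
7ⁿ. Replacing (0,0,1) by another vector w modulo 7ⁿ gives `perpLattice n w`, which for admissible w
depends only on the line of w. The theorem rests on a dictionary: classes in the genus correspond to
orbits of O(E) on the lines of vectors w whose norm is a nonresidue modulo 7 (as 6 is), and the
isometry group of the lattice is the stabilizer of the line.

Every lattice M of the genus has this shape (`exists_isometric_perpLattice`). The local isometries
yield a list of global facts, `GenusProperties`. Among them are vectors that pair with M into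
multiples of 2 and of 49ⁿ; dividing a combination of them by 2·7ⁿ gives a vector w for which M + ℤw
is integral of determinant 6. Reduction theory, with the facts at 2 and 3, leaves only u² + v² + 6z²
for this overlattice, and M is then the set of its vectors that have even coordinate sum and are
orthogonal to w modulo 7ⁿ.

Conversely, every such lattice is in the genus (`locallyIsometric_perpLattice`): away from 7 it
agrees locally with E, and at 7, after rescaling w by Hensel's lemma, a reflection carries ±(0,0,1)
to w.

The dictionary is rigid (`mem_isometryGroup_evenLattice`): E is recovered from the sublattice, so
isometries between such lattices lie in O(E), the group of 16 signed permutations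
(`exists_signEquiv`). The stabilizer of an admissible line has order 16 on the z-axis, 4 elsewhere
on the five symmetry planes, and 2 otherwise. Order 8 does not occur: off the axis, two symmetry
planes meet only where the norms are squares modulo 7, and a signed permutation can scale w only by
±1 because -1 is a nonsquare modulo 7.

Applying orbit-stabilizer to the unit group and to O(E) gives, for vectors with stabilizer order m,
(number of vectors)·m = 96·7ⁿ⁻¹·g_m(n). With q = 7ⁿ⁻¹, point counts modulo 7 give 126q³ admissible
vectors in all, of which 6q have order 16 and 96q² - 24q have order 4. The formulas follow. -/

/-- The quadratic form `u² + v² + 6z²`. -/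
def diagQ {R : Type*} [CommRing R] (x : Fin 3 → R) : R := x 0 ^ 2 + x 1 ^ 2 + 6 * x 2 ^ 2

/-- The bilinear form of `diagQ`. -/
def diagB {R : Type*} [CommRing R] (x y : Fin 3 → R) : R :=
  x 0 * y 0 + x 1 * y 1 + 6 * (x 2 * y 2)

/-! ### The diagonal form and orthogonal coordinates for K(n). -/

section diag

variable {R : Type*} [CommRing R]

theorem diagB_self (x : Fin 3 → R) : diagB x x = diagQ x := by
  simp only [diagB, diagQ]; ring

theorem diagB_comm (x y : Fin 3 → R) : diagB x y = diagB y x := by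
  simp only [diagB]; ring

theorem diagB_add_left (x y z : Fin 3 → R) : diagB (x + y) z = diagB x z + diagB y z := by
  simp only [diagB, Pi.add_apply]; ring

theorem diagB_add_right (x y z : Fin 3 → R) : diagB x (y + z) = diagB x y + diagB x z := by
  simp only [diagB, Pi.add_apply]; ring

theorem diagB_sub_left (x y z : Fin 3 → R) : diagB (x - y) z = diagB x z - diagB y z := by
  simp only [diagB, Pi.sub_apply]; ring

theorem diagB_sub_right (x y z : Fin 3 → R) : diagB x (y - z) = diagB x y - diagB x z := by
  simp only [diagB, Pi.sub_apply]; ring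

theorem diagB_smul_left (c : R) (x y : Fin 3 → R) : diagB (c • x) y = c * diagB x y := by
  simp only [diagB, Pi.smul_apply, smul_eq_mul]; ring

theorem diagB_smul_right (c : R) (x y : Fin 3 → R) : diagB x (c • y) = c * diagB x y := by
  simp only [diagB, Pi.smul_apply, smul_eq_mul]; ring

theorem diagB_zsmul_left (c : ℤ) (x y : Fin 3 → R) : diagB (c • x) y = c * diagB x y := by
  simp only [diagB, Pi.smul_apply, zsmul_eq_mul]; ring

theorem diagB_zsmul_right (c : ℤ) (x y : Fin 3 → R) : diagB x (c • y) = c * diagB x y := by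
  simp only [diagB, Pi.smul_apply, zsmul_eq_mul]; ring

theorem diagQ_add (x y : Fin 3 → R) : diagQ (x + y) = diagQ x + diagQ y + 2 * diagB x y := by
  simp only [diagB, diagQ, Pi.add_apply]; ring

theorem diagQ_smul (c : R) (x : Fin 3 → R) : diagQ (c • x) = c ^ 2 * diagQ x := by
  simp only [diagQ, Pi.smul_apply, smul_eq_mul]; ring

theorem diagQ_zsmul (c : ℤ) (x : Fin 3 → R) : diagQ (c • x) = (c : R) ^ 2 * diagQ x := by
  simp only [diagQ, Pi.smul_apply, zsmul_eq_mul]; ring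

/-- An additive map that preserves `diagQ` preserves `diagB`. -/
theorem diagB_map_of_diagQ {S : Type*} [Field S] [CharZero S] {F : Type*}
    [FunLike F (Fin 3 → S) (Fin 3 → S)]
    [AddMonoidHomClass F (Fin 3 → S) (Fin 3 → S)] {σ : F} (h : ∀ x, diagQ (σ x) = diagQ x)
    (x y : Fin 3 → S) : diagB (σ x) (σ y) = diagB x y := by
  have h1 := h (x + y)
  rw [map_add, diagQ_add, diagQ_add, h, h] at h1
  have h2 : (2 : S) ≠ 0 := two_ne_zero
  exact mul_left_cancel₀ h2 (add_left_cancel h1)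

end diag

/-- The form `diagQ` as a quadratic form. -/
def diagForm (R : Type*) [CommRing R] : QuadraticForm R (Fin 3 → R) :=
  QuadraticMap.weightedSumSquares R ![(1 : R), 1, 6]

theorem diagForm_apply {R : Type*} [CommRing R] (x : Fin 3 → R) : diagForm R x = diagQ x := by
  simp [diagForm, QuadraticMap.weightedSumSquares_apply, Fin.sum_univ_three, diagQ, pow_two]

/-- Orthogonal coordinates on the space of `K(n)`. -/
def coords (n : ℕ) : (Fin 3 → ℚ) ≃ₗ[ℚ] (Fin 3 → ℚ) where
  toFun a := ![a 0 + a 1 - a 2, a 0 - a 1, 7 ^ n * a 2]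
  invFun x := ![(x 0 + x 1 + x 2 / 7 ^ n) / 2, (x 0 - x 1 + x 2 / 7 ^ n) / 2, x 2 / 7 ^ n]
  map_add' a b := by
    ext i; fin_cases i <;> simp <;> ring
  map_smul' c a := by
    ext i; fin_cases i <;> simp <;> ring
  left_inv a := by
    have h : (7 : ℚ) ^ n ≠ 0 := by positivity
    ext i; fin_cases i <;> simp <;> field_simp <;> ring
  right_inv x := by
    have h : (7 : ℚ) ^ n ≠ 0 := by positivity
    ext i; fin_cases i <;> simp <;> field_simp <;> ring

theorem coords_apply (n : ℕ) (a : Fin 3 → ℚ) :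
    coords n a = ![a 0 + a 1 - a 2, a 0 - a 1, 7 ^ n * a 2] := rfl

theorem KForm_eq (n : ℕ) (x : Fin 3 → ℚ) : KForm n x = diagQ (coords n x) := by
  simp [KForm, gramForm, K4Gram, Matrix.toQuadraticForm', Matrix.toLinearMap₂'_apply', diagQ,
    coords_apply, Matrix.mulVec, dotProduct, Fin.sum_univ_three]
  ring

theorem KForm_eq_comp (n : ℕ) : KForm n = (diagForm ℚ).comp (coords n).toLinearMap := by
  ext x
  simp [KForm_eq, diagForm_apply]

/-! ### Transport of lattices and isometries along linear automorphisms. -/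

section image

variable {F V V' R : Type*} [Field F] [AddCommGroup V] [Module F V] [CommRing R] [Algebra R F]
  [Module R V] [IsScalarTower R F V]

theorem mem_image {σ : V ≃ₗ[F] V} {L : Submodule R V} {x : V} :
    x ∈ image σ L ↔ ∃ y ∈ L, σ y = x := by
  simp [image]

theorem image_image (σ τ : V ≃ₗ[F] V) (L : Submodule R V) :
    image σ (image τ L) = image (σ * τ) L := by
  ext x; simp [image]

theorem image_one (L : Submodule R V) : image (1 : V ≃ₗ[F] V) L = L := by
  ext x; simp [image]

theorem image_injective (σ : V ≃ₗ[F] V) :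
    Function.Injective (image σ : Submodule R V → Submodule R V) := by
  intro L M h
  have := congrArg (image σ⁻¹) h
  simpa [image_image, image_one] using this

theorem mem_image_iff {σ : V ≃ₗ[F] V} {L : Submodule R V} {x : V} :
    x ∈ image σ L ↔ σ.symm x ∈ L := by
  rw [mem_image]
  constructor
  · rintro ⟨y, hy, rfl⟩; simpa
  · intro h; exact ⟨_, h, by simp⟩

theorem apply_mem_image {σ : V ≃ₗ[F] V} {L : Submodule R V} {x : V} (h : x ∈ L) :
    σ x ∈ image σ L := mem_image.2 ⟨x, h, rfl⟩

theorem mem_orthogonalGroup {Q : QuadraticForm F V} {σ : V ≃ₗ[F] V} :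
    σ ∈ orthogonalGroup Q ↔ ∀ x, Q (σ x) = Q x := Iff.rfl

theorem mem_isometryGroup {Q : QuadraticForm F V} {L : Submodule R V} {σ : V ≃ₗ[F] V} :
    σ ∈ isometryGroup Q L ↔ σ ∈ orthogonalGroup Q ∧ image σ L = L := Iff.rfl

theorem Isometric.refl (Q : QuadraticForm F V) (L : Submodule R V) : Isometric Q L L :=
  ⟨1, one_mem _, image_one L⟩

theorem Isometric.symm {Q : QuadraticForm F V} {L M : Submodule R V} (h : Isometric Q L M) :
    Isometric Q M L := by
  obtain ⟨σ, hσ, rfl⟩ := h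
  exact ⟨σ⁻¹, inv_mem hσ, by rw [image_image, inv_mul_cancel, image_one]⟩

theorem Isometric.trans {Q : QuadraticForm F V} {L M N : Submodule R V} (h : Isometric Q L M)
    (h' : Isometric Q M N) : Isometric Q L N := by
  obtain ⟨σ, hσ, rfl⟩ := h
  obtain ⟨τ, hτ, rfl⟩ := h'
  exact ⟨τ * σ, mul_mem hτ hσ, by rw [image_image]⟩

/-- Conjugation by `φ` carries isometries of `Q ∘ φ` to isometries of `Q`. -/
theorem conj_mem_orthogonalGroup {Q : QuadraticForm F V} (φ : V ≃ₗ[F] V) {σ : V ≃ₗ[F] V} :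
    φ * σ * φ⁻¹ ∈ orthogonalGroup Q ↔ σ ∈ orthogonalGroup (Q.comp φ.toLinearMap) := by
  rw [mem_orthogonalGroup, mem_orthogonalGroup]
  constructor
  · intro h x
    have := h (φ x)
    simpa [LinearEquiv.mul_apply, ← LinearEquiv.mul_apply φ⁻¹ φ] using this
  · intro h x
    have := h (φ⁻¹ x)
    simpa [LinearEquiv.mul_apply, ← LinearEquiv.mul_apply φ φ⁻¹] using this

theorem isometric_comp_iff {Q : QuadraticForm F V} (φ : V ≃ₗ[F] V) {L M : Submodule R V} :
    Isometric (Q.comp φ.toLinearMap) L M ↔ Isometric Q (image φ L) (image φ M) := by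
  constructor
  · rintro ⟨σ, hσ, rfl⟩
    refine ⟨φ * σ * φ⁻¹, (conj_mem_orthogonalGroup φ).2 hσ, ?_⟩
    simp [image_image, mul_assoc]
  · rintro ⟨σ, hσ, h⟩
    refine ⟨φ⁻¹ * σ * φ, ?_, ?_⟩
    · rw [← conj_mem_orthogonalGroup φ]
      simpa [mul_assoc] using hσ
    · apply image_injective φ
      rw [← h]
      simp [image_image, ← mul_assoc]

theorem card_isometryGroup_comp {Q : QuadraticForm F V} (φ : V ≃ₗ[F] V) (L : Submodule R V) :
    Nat.card (isometryGroup (Q.comp φ.toLinearMap) L) =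
      Nat.card (isometryGroup Q (image φ L)) := by
  refine Nat.card_congr ((MulAut.conj φ).toEquiv.subtypeEquiv fun σ => ?_)
  change _ ↔ φ * σ * φ⁻¹ ∈ isometryGroup Q (image φ L)
  rw [mem_isometryGroup, mem_isometryGroup, conj_mem_orthogonalGroup, image_image]
  have h : φ * σ * φ⁻¹ * φ = φ * σ := by simp
  rw [h, ← image_image, (image_injective φ).eq_iff]

end image

/-! ### Localizations in p-adic coordinates. -/

section localization

variable (p : ℕ) [Fact p.Prime]

/-- The coordinatewise embedding `ℚ³ → ℚ_p³`. -/
def castVec (x : Fin 3 → ℚ) : Fin 3 → ℚ_[p] := fun i => (x i : ℚ_[p])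

/-- The `ℤ_p`-submodule of `ℚ_p³` generated by `L`. -/
def localLattice (L : Submodule ℤ (Fin 3 → ℚ)) : Submodule ℤ_[p] (Fin 3 → ℚ_[p]) :=
  Submodule.span ℤ_[p] (castVec p '' (L : Set (Fin 3 → ℚ)))

/-- `L` and `M` are isometric at `p` with respect to `diagQ`. -/
def LocallyIsometric (L M : Submodule ℤ (Fin 3 → ℚ)) : Prop :=
  ∃ σ : (Fin 3 → ℚ_[p]) ≃ₗ[ℚ_[p]] (Fin 3 → ℚ_[p]), (∀ x, diagQ (σ x) = diagQ x) ∧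
    image σ (localLattice p L) = localLattice p M

/-- The coordinates on `ℚ_p ⊗ ℚ³` defined by those on `ℚ³`. -/
def localCoords (φ : (Fin 3 → ℚ) ≃ₗ[ℚ] (Fin 3 → ℚ)) :
    ℚ_[p] ⊗[ℚ] (Fin 3 → ℚ) ≃ₗ[ℚ_[p]] (Fin 3 → ℚ_[p]) :=
  (((Pi.basisFun ℚ (Fin 3)).map φ.symm).baseChange ℚ_[p]).equivFun

theorem localCoords_tmul (φ : (Fin 3 → ℚ) ≃ₗ[ℚ] (Fin 3 → ℚ)) (x : Fin 3 → ℚ) :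
    localCoords p φ (1 ⊗ₜ x) = castVec p (φ x) := by
  ext i
  simp [localCoords, Module.Basis.equivFun_apply, Module.Basis.baseChange_repr_tmul, castVec,
    Rat.smul_def]

theorem baseChange_eq_diagQ (φ : (Fin 3 → ℚ) ≃ₗ[ℚ] (Fin 3 → ℚ)) (Q : QuadraticForm ℚ (Fin 3 → ℚ))
    (hQ : ∀ x, Q x = diagQ (φ x)) (x : ℚ_[p] ⊗[ℚ] (Fin 3 → ℚ)) :
    Q.baseChange ℚ_[p] x = diagQ (localCoords p φ x) := by
  have h : Q.baseChange ℚ_[p] = (diagForm ℚ_[p]).comp (localCoords p φ).toLinearMap := by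
    apply _root_.baseChange_ext
    intro m
    rw [QuadraticForm.baseChange_tmul, QuadraticMap.comp_apply, diagForm_apply,
      LinearEquiv.coe_coe, localCoords_tmul, hQ, Rat.smul_def]
    simp [diagQ, castVec]
  rw [h, QuadraticMap.comp_apply, diagForm_apply, LinearEquiv.coe_coe]

theorem map_localization (φ : (Fin 3 → ℚ) ≃ₗ[ℚ] (Fin 3 → ℚ)) (L : Submodule ℤ (Fin 3 → ℚ)) :
    (localization p L).map ((localCoords p φ).toLinearMap.restrictScalars ℤ_[p]) =
      localLattice p (image φ L) := by
  rw [localization, Submodule.map_span, localLattice, ← Set.image_comp]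
  congr 1
  ext y
  constructor
  · rintro ⟨x, hx, rfl⟩
    exact ⟨φ x, apply_mem_image hx, by simp [localCoords_tmul]⟩
  · rintro ⟨_, hφ, rfl⟩
    obtain ⟨x, hx, rfl⟩ := mem_image.1 hφ
    exact ⟨x, hx, by simp [localCoords_tmul]⟩

/-- Replaces the tensor product in the definition of the genus by coordinates in ℚ_p³, where Q is
diagonal; all later local arguments take place there. -/
theorem isometric_localization_iff (φ : (Fin 3 → ℚ) ≃ₗ[ℚ] (Fin 3 → ℚ))
    (Q : QuadraticForm ℚ (Fin 3 → ℚ)) (hQ : ∀ x, Q x = diagQ (φ x))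
    (L M : Submodule ℤ (Fin 3 → ℚ)) :
    Isometric (Q.baseChange ℚ_[p]) (localization p L) (localization p M) ↔
      LocallyIsometric p (image φ L) (image φ M) := by
  have key := baseChange_eq_diagQ p φ Q hQ
  rw [LocallyIsometric, ← map_localization, ← map_localization]
  constructor
  · rintro ⟨σ, hσ, h⟩
    refine ⟨(localCoords p φ).symm ≪≫ₗ σ ≪≫ₗ localCoords p φ, fun x => ?_, ?_⟩
    · have := hσ ((localCoords p φ).symm x)
      rw [key, key] at this
      simpa using this
    · rw [← h]
      ext x
      simp [image]
  · rintro ⟨σ, hσ, h⟩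
    refine ⟨localCoords p φ ≪≫ₗ σ ≪≫ₗ (localCoords p φ).symm, fun x => ?_, ?_⟩
    · rw [key, key]
      simp [hσ]
    · apply Submodule.map_injective_of_injective
        (f := (localCoords p φ).toLinearMap.restrictScalars ℤ_[p]) (localCoords p φ).injective
      rw [← h]
      ext x
      simp [image]

end localization

theorem isLattice_image {V : Type*} [AddCommGroup V] [Module ℚ V] (φ : V ≃ₗ[ℚ] V)
    {M : Submodule ℤ V} (h : M.IsLattice ℚ) : (image φ M).IsLattice ℚ := by
  refine ⟨h.fg.map _, ?_⟩
  have h2 : ((image φ M : Submodule ℤ V) : Set V) = φ.toLinearMap '' (M : Set V) := rfl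
  rw [h2, ← Submodule.map_span, h.span_eq_top, Submodule.map_top, LinearEquiv.range]

theorem isLattice_image_iff {V : Type*} [AddCommGroup V] [Module ℚ V] (φ : V ≃ₗ[ℚ] V)
    {M : Submodule ℤ V} : (image φ M).IsLattice ℚ ↔ M.IsLattice ℚ := by
  refine ⟨fun h => ?_, isLattice_image φ⟩
  simpa [image_image, image_one] using isLattice_image φ⁻¹ h

theorem mem_genus_iff {n : ℕ} {M : Submodule ℤ (Fin 3 → ℚ)} :
    M ∈ genus (KForm n) stdLattice ↔ (image (coords n) M).IsLattice ℚ ∧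
      ∀ (p : ℕ) [Fact p.Prime],
        LocallyIsometric p (image (coords n) stdLattice) (image (coords n) M) := by
  rw [isLattice_image_iff]
  refine and_congr_right fun _ => forall_congr' fun p => forall_congr' fun _ => ?_
  exact isometric_localization_iff p (coords n) (KForm n) (KForm_eq n) _ _

theorem isometric_KForm_iff {n : ℕ} {L M : Submodule ℤ (Fin 3 → ℚ)} :
    Isometric (KForm n) L M ↔ Isometric (diagForm ℚ) (image (coords n) L) (image (coords n) M) := by
  rw [KForm_eq_comp, isometric_comp_iff]

theorem card_isometryGroup_KForm (n : ℕ) (L : Submodule ℤ (Fin 3 → ℚ)) :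
    Nat.card (isometryGroup (KForm n) L) =
      Nat.card (isometryGroup (diagForm ℚ) (image (coords n) L)) := by
  rw [KForm_eq_comp, card_isometryGroup_comp]

/-! ### Determinants, and K(n) as a congruence sublattice. -/

/-- The determinant of three vectors. -/
def det3 {R : Type*} [CommRing R] (x y z : Fin 3 → R) : R :=
  x 0 * (y 1 * z 2 - y 2 * z 1) - x 1 * (y 0 * z 2 - y 2 * z 0) + x 2 * (y 0 * z 1 - y 1 * z 0)

/-- The Gram determinant of three vectors with respect to `diagB`. -/
def gram3 {R : Type*} [CommRing R] (x y z : Fin 3 → R) : R :=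
  diagB x x * (diagB y y * diagB z z - diagB y z ^ 2)
    - diagB x y * (diagB x y * diagB z z - diagB y z * diagB x z)
    + diagB x z * (diagB x y * diagB y z - diagB y y * diagB x z)

theorem gram3_eq {R : Type*} [CommRing R] (x y z : Fin 3 → R) :
    gram3 x y z = 6 * det3 x y z ^ 2 := by
  simp only [gram3, diagB, det3]; ring

/-- The inclusion `ℤ³ → ℚ³`. -/
def intVec (a : Fin 3 → ℤ) : Fin 3 → ℚ := fun i => (a i : ℚ)

theorem intVec_injective : Function.Injective intVec := fun a b h => by
  ext i
  simpa [intVec] using congrFun h i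

theorem intVec_add (a b : Fin 3 → ℤ) : intVec (a + b) = intVec a + intVec b := by
  ext i; simp [intVec]

theorem intVec_smul (c : ℤ) (a : Fin 3 → ℤ) : intVec (c • a) = c • intVec a := by
  ext i; simp [intVec]

theorem diagB_intVec (a b : Fin 3 → ℤ) : diagB (intVec a) (intVec b) = (diagB a b : ℤ) := by
  simp [diagB, intVec]

theorem diagQ_intVec (a : Fin 3 → ℤ) : diagQ (intVec a) = (diagQ a : ℤ) := by
  simp [diagQ, intVec]

/-- Reduction modulo `m` of an integral vector. -/
def modVec (m : ℕ) (a : Fin 3 → ℤ) : Fin 3 → ZMod m := fun i => (a i : ZMod m)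

theorem diagB_modVec (m : ℕ) (a b : Fin 3 → ℤ) :
    diagB (modVec m a) (modVec m b) = ((diagB a b : ℤ) : ZMod m) := by
  simp [diagB, modVec]

theorem modVec_add (m : ℕ) (a b : Fin 3 → ℤ) : modVec m (a + b) = modVec m a + modVec m b := by
  ext i; simp [modVec]

theorem modVec_smul (m : ℕ) (c : ℤ) (a : Fin 3 → ℤ) : modVec m (c • a) = c • modVec m a := by
  ext i; simp [modVec]

/-- The lattice `{(u, v, z) ∈ ℤ³ : u + v + z even}`. -/
def evenLattice : Submodule ℤ (Fin 3 → ℚ) where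
  carrier := {x | ∃ a : Fin 3 → ℤ, Even (a 0 + a 1 + a 2) ∧ intVec a = x}
  zero_mem' := ⟨0, by simp, by ext; simp [intVec]⟩
  add_mem' := by
    rintro _ _ ⟨a, ha, rfl⟩ ⟨b, hb, rfl⟩
    refine ⟨a + b, ?_, intVec_add a b⟩
    obtain ⟨s, hs⟩ := ha
    obtain ⟨t, ht⟩ := hb
    exact ⟨s + t, by simp only [Pi.add_apply]; linarith⟩
  smul_mem' := by
    rintro c _ ⟨a, ha, rfl⟩
    refine ⟨c • a, ?_, intVec_smul c a⟩
    simpa only [Pi.smul_apply, smul_eq_mul, mul_add] using ha.mul_left c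

/-- The sublattice of `evenLattice` of the vectors orthogonal to `w` modulo `7ⁿ`. -/
def perpLattice (n : ℕ) (w : Fin 3 → ZMod (7 ^ n)) : Submodule ℤ (Fin 3 → ℚ) where
  carrier := {x | ∃ a : Fin 3 → ℤ, Even (a 0 + a 1 + a 2) ∧ diagB (modVec (7 ^ n) a) w = 0 ∧
    intVec a = x}
  zero_mem' := ⟨0, by simp, by simp [diagB, modVec], by ext; simp [intVec]⟩
  add_mem' := by
    rintro _ _ ⟨a, ha, ha', rfl⟩ ⟨b, hb, hb', rfl⟩
    refine ⟨a + b, ?_, ?_, intVec_add a b⟩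
    · obtain ⟨s, hs⟩ := ha
      obtain ⟨t, ht⟩ := hb
      exact ⟨s + t, by simp only [Pi.add_apply]; linarith⟩
    · rw [modVec_add, diagB_add_left, ha', hb', add_zero]
  smul_mem' := by
    rintro c _ ⟨a, ha, ha', rfl⟩
    refine ⟨c • a, ?_, ?_, intVec_smul c a⟩
    · simpa only [Pi.smul_apply, smul_eq_mul, mul_add] using ha.mul_left c
    · rw [modVec_smul, diagB_zsmul_left, ha', mul_zero]

theorem mem_evenLattice {x : Fin 3 → ℚ} :
    x ∈ evenLattice ↔ ∃ a : Fin 3 → ℤ, Even (a 0 + a 1 + a 2) ∧ intVec a = x := Iff.rfl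

theorem mem_perpLattice {n : ℕ} {w : Fin 3 → ZMod (7 ^ n)} {x : Fin 3 → ℚ} :
    x ∈ perpLattice n w ↔ ∃ a : Fin 3 → ℤ, Even (a 0 + a 1 + a 2) ∧
      diagB (modVec (7 ^ n) a) w = 0 ∧ intVec a = x := Iff.rfl

theorem intVec_mem_evenLattice {a : Fin 3 → ℤ} :
    intVec a ∈ evenLattice ↔ Even (a 0 + a 1 + a 2) := by
  rw [mem_evenLattice]
  exact ⟨fun ⟨b, hb, h⟩ => intVec_injective h ▸ hb, fun h => ⟨a, h, rfl⟩⟩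

theorem intVec_mem_perpLattice {n : ℕ} {w : Fin 3 → ZMod (7 ^ n)} {a : Fin 3 → ℤ} :
    intVec a ∈ perpLattice n w ↔ Even (a 0 + a 1 + a 2) ∧ diagB (modVec (7 ^ n) a) w = 0 := by
  rw [mem_perpLattice]
  exact ⟨fun ⟨b, hb, hb', h⟩ => intVec_injective h ▸ ⟨hb, hb'⟩, fun h => ⟨a, h.1, h.2, rfl⟩⟩

theorem perpLattice_le (n : ℕ) (w : Fin 3 → ZMod (7 ^ n)) : perpLattice n w ≤ evenLattice := by
  rintro _ ⟨a, ha, -, rfl⟩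
  exact ⟨a, ha, rfl⟩

theorem isUnit_six (n : ℕ) : IsUnit (6 : ZMod (7 ^ n)) := by
  have : IsUnit ((6 : ℕ) : ZMod (7 ^ n)) := by
    rw [ZMod.isUnit_iff_coprime]
    exact Nat.Coprime.pow_right n (by norm_num)
  simpa using this

/-- The lattice `K(n)` in orthogonal coordinates. -/
def stdPerp (n : ℕ) : Submodule ℤ (Fin 3 → ℚ) := perpLattice n ![0, 0, 1]

theorem intVec_mem_stdPerp {n : ℕ} {a : Fin 3 → ℤ} :
    intVec a ∈ stdPerp n ↔ Even (a 0 + a 1 + a 2) ∧ (7 : ℤ) ^ n ∣ a 2 := by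
  rw [stdPerp, intVec_mem_perpLattice]
  refine and_congr_right fun _ => ?_
  have h1 : diagB (modVec (7 ^ n) a) ![0, 0, 1] = 6 * (a 2 : ZMod (7 ^ n)) := by
    simp [diagB, modVec]
  rw [h1, (isUnit_six n).mul_right_eq_zero, ZMod.intCast_zmod_eq_zero_iff_dvd]
  simp

theorem mem_stdLattice {x : Fin 3 → ℚ} : x ∈ stdLattice ↔ ∃ a, intVec a = x := by
  rw [stdLattice, Module.Basis.mem_span_iff_repr_mem]
  simp only [Pi.basisFun_repr, Set.mem_range]
  constructor
  · intro h
    choose a ha using h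
    exact ⟨a, funext ha⟩
  · rintro ⟨a, rfl⟩ i
    exact ⟨a i, rfl⟩

theorem image_coords_stdLattice (n : ℕ) : image (coords n) stdLattice = stdPerp n := by
  ext x
  constructor
  · intro h
    obtain ⟨y, hy, rfl⟩ := mem_image.1 h
    obtain ⟨a, rfl⟩ := mem_stdLattice.1 hy
    have h1 : coords n (intVec a) = intVec ![a 0 + a 1 - a 2, a 0 - a 1, 7 ^ n * a 2] := by
      ext i; fin_cases i <;> simp [coords_apply, intVec]
    rw [h1, intVec_mem_stdPerp]
    refine ⟨?_, by simp⟩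
    have h7 : Odd ((7 : ℤ) ^ n) := Odd.pow (by decide)
    obtain ⟨k, hk⟩ := h7
    refine ⟨a 0 + k * a 2, ?_⟩
    simp [hk]
    ring
  · intro h
    obtain ⟨a, -, -, rfl⟩ := mem_perpLattice.1 h
    obtain ⟨⟨s, hs⟩, c, hc⟩ := intVec_mem_stdPerp.1 h
    have h7 : Odd ((7 : ℤ) ^ n) := Odd.pow (by decide)
    obtain ⟨k, hk⟩ := h7
    rw [hk] at hc
    -- The witness inverts `coords`: with 7ⁿ = 2k + 1 and third coordinate 7ⁿc, the half-integers in
    -- the inverse formula become integers because the coordinate sum is 2s.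
    refine mem_image.2 ⟨intVec ![s - k * c, s - k * c - a 1, c], mem_stdLattice.2 ⟨_, rfl⟩, ?_⟩
    have hk' : (7 : ℚ) ^ n = 2 * k + 1 := by exact_mod_cast hk
    have hc' : (a 2 : ℚ) = (2 * k + 1) * c := by exact_mod_cast hc
    have hs' : (a 0 + a 1 + a 2 : ℚ) = s + s := by exact_mod_cast hs
    ext i
    fin_cases i
    · simp [coords_apply, intVec]; linear_combination -hs' + hc'
    · simp [coords_apply, intVec]
    · simp [coords_apply, intVec, hk', hc']

theorem stdLattice_isLattice : stdLattice.IsLattice ℚ := by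
  refine ⟨Submodule.fg_span (Set.finite_range _), ?_⟩
  rw [stdLattice, Submodule.span_span_of_tower, Module.Basis.span_eq]

/-! ### The p-adic points of K(n) and approximation by global vectors. -/

section local_coords

variable {p : ℕ} [Fact p.Prime]

/-- The inclusion `ℤ_p³ → ℚ_p³`. -/
def coeVec (a : Fin 3 → ℤ_[p]) : Fin 3 → ℚ_[p] := fun i => (a i : ℚ_[p])

theorem padicInt_smul (c : ℤ_[p]) (x : ℚ_[p]) : c • x = (c : ℚ_[p]) * x := rfl

theorem padicInt_smul_vec (c : ℤ_[p]) (x : Fin 3 → ℚ_[p]) : c • x = (c : ℚ_[p]) • x := rfl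

theorem diagB_coeVec (a b : Fin 3 → ℤ_[p]) :
    diagB (coeVec a) (coeVec b) = (diagB a b : ℤ_[p]) := by
  simp only [diagB, coeVec, PadicInt.coe_add, PadicInt.coe_mul]; rfl

theorem diagQ_coeVec (a : Fin 3 → ℤ_[p]) : diagQ (coeVec a) = (diagQ a : ℤ_[p]) := by
  simp only [diagQ, coeVec, PadicInt.coe_add, PadicInt.coe_mul, PadicInt.coe_pow]; rfl

theorem diagB_castVec (x y : Fin 3 → ℚ) :
    diagB (castVec p x) (castVec p y) = (diagB x y : ℚ) := by
  simp [diagB, castVec]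

theorem coeVec_injective : Function.Injective (coeVec (p := p)) := fun a b h => by
  ext i
  exact PadicInt.ext (congrFun h i)

theorem coeVec_add (a b : Fin 3 → ℤ_[p]) : coeVec (a + b) = coeVec a + coeVec b := by
  ext i; simp [coeVec]

theorem coeVec_smul (c : ℤ_[p]) (a : Fin 3 → ℤ_[p]) : coeVec (c • a) = c • coeVec a := by
  ext i; simp [coeVec, padicInt_smul]

theorem castVec_add (x y : Fin 3 → ℚ) : castVec p (x + y) = castVec p x + castVec p y := by
  ext i; simp [castVec]

theorem castVec_zsmul (c : ℤ) (x : Fin 3 → ℚ) :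
    castVec p (c • x) = (c : ℤ_[p]) • castVec p x := by
  ext i; simp [castVec, padicInt_smul]

theorem castVec_intVec (a : Fin 3 → ℤ) :
    castVec p (intVec a) = coeVec (fun i => (a i : ℤ_[p])) := by
  ext i; simp [castVec, coeVec, intVec]

theorem castVec_mem_localLattice {M : Submodule ℤ (Fin 3 → ℚ)} {x : Fin 3 → ℚ} (hx : x ∈ M) :
    castVec p x ∈ localLattice p M := Submodule.subset_span ⟨x, hx, rfl⟩

/-- Elements of `M_p` are approximated by elements of `M`. -/
theorem exists_approx {M : Submodule ℤ (Fin 3 → ℚ)} (k : ℕ) {y : Fin 3 → ℚ_[p]}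
    (hy : y ∈ localLattice p M) : ∃ m ∈ M, ∃ y' ∈ localLattice p M,
      y = castVec p m + ((p : ℤ_[p]) ^ k) • y' := by
  induction hy using Submodule.span_induction with
  | mem y h =>
    obtain ⟨x, hx, rfl⟩ := h
    exact ⟨x, hx, 0, zero_mem _, by simp⟩
  | zero => exact ⟨0, zero_mem _, 0, zero_mem _, by ext; simp [castVec]⟩
  | add y z _ _ hy hz =>
    obtain ⟨m, hm, y', hy', rfl⟩ := hy
    obtain ⟨l, hl, z', hz', rfl⟩ := hz
    refine ⟨m + l, add_mem hm hl, y' + z', add_mem hy' hz', ?_⟩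
    rw [castVec_add]
    module
  | smul c y _ hy =>
    obtain ⟨m, hm, y', hy', rfl⟩ := hy
    -- The scalar is truncated to an integer modulo pᵏ; the remainder is absorbed into the error
    -- term.
    obtain ⟨d, hd⟩ := Ideal.mem_span_singleton'.1 (PadicInt.appr_spec k c)
    refine ⟨(c.appr k : ℤ) • m, zsmul_mem hm _, d • castVec p m + c • y',
      add_mem (Submodule.smul_mem _ _ (castVec_mem_localLattice hm)) (Submodule.smul_mem _ _ hy'),
      ?_⟩
    have hc : c = ((c.appr k : ℤ) : ℤ_[p]) + d * (p : ℤ_[p]) ^ k := by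
      rw [hd]; push_cast; ring
    rw [castVec_zsmul]
    conv_lhs => rw [smul_add, hc, add_smul]
    conv_rhs => rw [smul_add, smul_smul, smul_smul]
    rw [← hc, smul_smul, mul_comm d, mul_comm c]
    module

/-- The conditions that define `K(n)` inside `ℤ_p³`. -/
def IsLocalStd (n : ℕ) (a : Fin 3 → ℤ_[p]) : Prop :=
  (2 : ℤ_[p]) ∣ a 0 + a 1 + a 2 ∧ (7 : ℤ_[p]) ^ n ∣ a 2

theorem exists_coeVec_eq_of_mem {n : ℕ} {x : Fin 3 → ℚ_[p]}
    (hx : x ∈ localLattice p (stdPerp n)) : ∃ a, IsLocalStd n a ∧ coeVec a = x := by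
  induction hx using Submodule.span_induction with
  | mem y h =>
    obtain ⟨x, hx, rfl⟩ := h
    obtain ⟨a, -, -, rfl⟩ := mem_perpLattice.1 hx
    obtain ⟨⟨s, hs⟩, c, hc⟩ := intVec_mem_stdPerp.1 hx
    refine ⟨_, ⟨⟨(s : ℤ_[p]), ?_⟩, ⟨(c : ℤ_[p]), ?_⟩⟩, (castVec_intVec a).symm⟩
    · rw [two_mul]; exact_mod_cast hs
    · exact_mod_cast hc
  | zero => exact ⟨0, by simp [IsLocalStd], by ext; simp [coeVec]⟩
  | add y z _ _ hy hz =>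
    obtain ⟨a, ⟨h1, h2⟩, rfl⟩ := hy
    obtain ⟨b, ⟨h3, h4⟩, rfl⟩ := hz
    refine ⟨a + b, ⟨?_, dvd_add h2 h4⟩, coeVec_add a b⟩
    have := dvd_add h1 h3
    simp only [Pi.add_apply]
    convert this using 1
    abel
  | smul c y _ hy =>
    obtain ⟨a, ⟨h1, h2⟩, rfl⟩ := hy
    refine ⟨c • a, ⟨?_, dvd_mul_of_dvd_right h2 c⟩, coeVec_smul c a⟩
    simpa only [Pi.smul_apply, smul_eq_mul, mul_add] using dvd_mul_of_dvd_right h1 c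

end local_coords

/-- A rational number that is a `p`-adic integer for every `p` is an integer. -/
theorem exists_int_of_forall_padicInt {r : ℚ}
    (h : ∀ (p : ℕ) [Fact p.Prime], ∃ a : ℤ_[p], (r : ℚ_[p]) = a) : ∃ k : ℤ, r = k := by
  by_contra hr
  have hden : r.den ≠ 1 := fun h1 => hr ⟨r.num, (Rat.den_eq_one_iff r).1 h1 |>.symm⟩
  obtain ⟨p, hp, hpd⟩ := Nat.exists_prime_and_dvd hden
  have : Fact p.Prime := ⟨hp⟩
  obtain ⟨a, ha⟩ := h p
  have h1 : (r.num : ℚ_[p]) = a * (r.den : ℚ_[p]) := by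
    rw [← ha]
    exact_mod_cast (Rat.mul_den_eq_num r).symm
  have h2 : ‖(r.num : ℚ_[p])‖ < 1 := by
    rw [h1, norm_mul]
    have h3 : ‖(r.den : ℚ_[p])‖ < 1 := Padic.norm_natCast_lt_one_iff.2 hpd
    calc ‖(a : ℚ_[p])‖ * ‖(r.den : ℚ_[p])‖ ≤ 1 * ‖(r.den : ℚ_[p])‖ :=
          mul_le_mul_of_nonneg_right a.norm_le_one (norm_nonneg _)
      _ < 1 := by rwa [one_mul]
  have h4 := Int.natCast_dvd.1 (Padic.norm_intCast_lt_one_iff.1 h2)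
  exact hp.one_lt.ne' (Nat.dvd_one.1 (r.reduced ▸ Nat.dvd_gcd h4 hpd))

/-! ### Global invariants deduced from the local isometries. -/

/-- The arithmetic properties shared by all lattices in the genus of `K(n)`. -/
structure GenusProperties (n : ℕ) (M : Submodule ℤ (Fin 3 → ℚ)) : Prop where
  integral : ∀ x ∈ M, ∀ y ∈ M, ∃ k : ℤ, diagB x y = k
  three : ∀ x ∈ M, ∀ k : ℤ, diagQ x = 3 * k → ∀ y ∈ M, ∃ l : ℤ, diagB x y = 3 * l
  odd : ∃ x ∈ M, ∃ k : ℤ, diagQ x = 2 * k + 1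
  four : ∀ x ∈ M, ∀ k : ℤ, diagQ x ≠ 4 * k + 1
  basis : ∃ x y z : Fin 3 → ℚ, M = Submodule.span ℤ {x, y, z} ∧ det3 x y z ^ 2 = 4 * 49 ^ n
  two_vec : ∃ e ∈ M, (∀ y ∈ M, ∃ k : ℤ, diagB e y = 2 * k) ∧ (∃ k : ℤ, diagQ e = 4 * k) ∧
    ∀ y ∈ M, e ≠ (2 : ℤ) • y
  seven_vec : ∃ e ∈ M, (∀ y ∈ M, ∃ k : ℤ, diagB e y = 49 ^ n * k) ∧
    (∃ k : ℤ, diagQ e = 49 ^ n * (24 + 7 * k)) ∧ ∀ y ∈ M, e ≠ (7 : ℤ) • y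

section genus_properties

variable {n : ℕ} {M : Submodule ℤ (Fin 3 → ℚ)}

theorem exists_coords {p : ℕ} [Fact p.Prime] {σ : (Fin 3 → ℚ_[p]) ≃ₗ[ℚ_[p]] (Fin 3 → ℚ_[p])}
    (hM : image σ (localLattice p (stdPerp n)) = localLattice p M) {x : Fin 3 → ℚ_[p]}
    (hx : x ∈ localLattice p M) : ∃ a, IsLocalStd n a ∧ σ (coeVec a) = x := by
  rw [← hM] at hx
  obtain ⟨y, hy, rfl⟩ := mem_image.1 hx
  obtain ⟨a, ha, rfl⟩ := exists_coeVec_eq_of_mem hy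
  exact ⟨a, ha, rfl⟩

/-- The values of `diagB` on `M` in terms of `p`-adic coordinates with respect to `K(n)`. -/
theorem coe_diagB_eq {p : ℕ} [Fact p.Prime] {σ : (Fin 3 → ℚ_[p]) ≃ₗ[ℚ_[p]] (Fin 3 → ℚ_[p])}
    (hσ : ∀ x, diagQ (σ x) = diagQ x) {x y : Fin 3 → ℚ} {a b : Fin 3 → ℤ_[p]}
    (ha : σ (coeVec a) = castVec p x) (hb : σ (coeVec b) = castVec p y) :
    ((diagB x y : ℚ) : ℚ_[p]) = (diagB a b : ℤ_[p]) := by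
  rw [← diagB_castVec, ← ha, ← hb, diagB_map_of_diagQ hσ, diagB_coeVec]

theorem intCast_eq_diagB {p : ℕ} [Fact p.Prime]
    {σ : (Fin 3 → ℚ_[p]) ≃ₗ[ℚ_[p]] (Fin 3 → ℚ_[p])}
    (hσ : ∀ x, diagQ (σ x) = diagQ x) {x y : Fin 3 → ℚ} {a b : Fin 3 → ℤ_[p]}
    (ha : σ (coeVec a) = castVec p x) (hb : σ (coeVec b) = castVec p y) {k : ℤ}
    (hk : diagB x y = k) : (k : ℤ_[p]) = diagB a b := by
  have h := coe_diagB_eq hσ ha hb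
  rw [hk] at h
  apply PadicInt.ext
  rw [← h]
  simp

theorem integral_of_genus (h : ∀ (p : ℕ) [Fact p.Prime], LocallyIsometric p (stdPerp n) M) :
    ∀ x ∈ M, ∀ y ∈ M, ∃ k : ℤ, diagB x y = k := by
  intro x hx y hy
  apply exists_int_of_forall_padicInt
  intro p _
  obtain ⟨σ, hσ, hM⟩ := h p
  obtain ⟨a, -, ha⟩ := exists_coords hM (castVec_mem_localLattice hx)
  obtain ⟨b, -, hb⟩ := exists_coords hM (castVec_mem_localLattice hy)
  exact ⟨_, coe_diagB_eq hσ ha hb⟩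

theorem dvd_of_padicInt_dvd {p : ℕ} [Fact p.Prime] {j : ℕ} {k : ℤ}
    (h : (p : ℤ_[p]) ^ j ∣ k) : (p : ℤ) ^ j ∣ k := by
  have h1 := (PadicInt.norm_le_pow_iff_mem_span_pow (k : ℤ_[p]) j).2
    (Ideal.mem_span_singleton.2 h)
  exact_mod_cast PadicInt.norm_int_le_pow_iff_dvd.1 h1

/-- Modulo 3 the form is u² + v², which is anisotropic, so a vector of norm divisible by 3 lies in
the radical. This is what later excludes the form diag(1,2,3). -/
theorem three_of_genus (h : ∀ (p : ℕ) [Fact p.Prime], LocallyIsometric p (stdPerp n) M) :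
    ∀ x ∈ M, ∀ k : ℤ, diagQ x = 3 * k → ∀ y ∈ M, ∃ l : ℤ, diagB x y = 3 * l := by
  intro x hx k hk y hy
  obtain ⟨l, hl⟩ := integral_of_genus h x hx y hy
  obtain ⟨σ, hσ, hM⟩ := h 3
  obtain ⟨a, -, ha⟩ := exists_coords hM (castVec_mem_localLattice hx)
  obtain ⟨b, -, hb⟩ := exists_coords hM (castVec_mem_localLattice hy)
  have hk' : diagB x x = ((3 * k : ℤ) : ℚ) := by rw [diagB_self, hk]; push_cast; rfl
  have h1 := congrArg PadicInt.toZMod (intCast_eq_diagB hσ ha ha hk')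
  have h2 := congrArg PadicInt.toZMod (intCast_eq_diagB hσ ha hb hl)
  simp only [diagB, map_add, map_mul, map_intCast, map_ofNat] at h1 h2
  have h3 : ((3 * k : ℤ) : ZMod 3) = 0 := by
    rw [ZMod.intCast_zmod_eq_zero_iff_dvd]; exact Dvd.intro _ rfl
  rw [h3] at h1
  have key : ∀ u v z u' v' z' : ZMod 3, 0 = u * u + v * v + 6 * (z * z) →
      u * u' + v * v' + 6 * (z * z') = 0 := by decide
  rw [key _ _ _ _ _ _ h1, ZMod.intCast_zmod_eq_zero_iff_dvd] at h2
  obtain ⟨m, hm⟩ := h2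
  exact ⟨m, by rw [hl, hm]; push_cast; rfl⟩

/-- On vectors with u + v + z even, an odd norm forces u + v and z to be odd, so the norm is 1 + 6 ≡
3 modulo 4. -/
theorem four_of_genus (h : ∀ (p : ℕ) [Fact p.Prime], LocallyIsometric p (stdPerp n) M) :
    ∀ x ∈ M, ∀ k : ℤ, diagQ x ≠ 4 * k + 1 := by
  intro x hx k hk
  obtain ⟨σ, hσ, hM⟩ := h 2
  obtain ⟨a, ⟨⟨s, hs⟩, -⟩, ha⟩ := exists_coords hM (castVec_mem_localLattice hx)
  have hk' : diagB x x = ((4 * k + 1 : ℤ) : ℚ) := by rw [diagB_self, hk]; push_cast; rfl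
  have h1 := congrArg (PadicInt.toZModPow 2) (intCast_eq_diagB hσ ha ha hk')
  have h2 := congrArg (PadicInt.toZModPow 2) hs
  simp only [diagB, map_add, map_mul, map_intCast, map_ofNat] at h1 h2
  have h3 : ((4 * k + 1 : ℤ) : ZMod (2 ^ 2)) = 1 := by
    have : ((4 : ℤ) : ZMod (2 ^ 2)) = 0 := by decide
    rw [Int.cast_add, Int.cast_mul, this]; simp
  rw [h3] at h1
  have key : ∀ u v z t : ZMod (2 ^ 2), 1 = u * u + v * v + 6 * (z * z) → u + v + z ≠ 2 * t := by
    decide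
  exact key _ _ _ _ h1 h2

/-- An integral vector of `K(n)` corresponds at `p` to a vector of `M`, up to an error divisible
by a high power of `p`. -/
theorem exists_mem_approx {p : ℕ} [Fact p.Prime]
    {σ : (Fin 3 → ℚ_[p]) ≃ₗ[ℚ_[p]] (Fin 3 → ℚ_[p])}
    (hM : image σ (localLattice p (stdPerp n)) = localLattice p M) {c : Fin 3 → ℤ}
    (hc : intVec c ∈ stdPerp n) (k : ℕ) : ∃ m ∈ M, ∃ a : Fin 3 → ℤ_[p], IsLocalStd n a ∧
      σ (coeVec (fun i => (c i : ℤ_[p]) - p ^ k * a i)) = castVec p m := by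
  have h1 := apply_mem_image (σ := σ) (castVec_mem_localLattice (p := p) hc)
  rw [hM] at h1
  obtain ⟨m, hm, y, hy, hmy⟩ := exists_approx k h1
  obtain ⟨a, ha, rfl⟩ := exists_coords hM hy
  refine ⟨m, hm, a, ha, ?_⟩
  have h2 : (fun i => (c i : ℤ_[p]) - p ^ k * a i) =
      (fun i => (c i : ℤ_[p])) + (-(p : ℤ_[p]) ^ k) • a := by
    ext i; simp [sub_eq_add_neg]
  rw [castVec_intVec] at hmy
  rw [h2, coeVec_add, coeVec_smul, map_add, padicInt_smul_vec, map_smul, hmy, padicInt_smul_vec]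
  push_cast
  module

theorem odd_of_genus (h : ∀ (p : ℕ) [Fact p.Prime], LocallyIsometric p (stdPerp n) M) :
    ∃ x ∈ M, ∃ k : ℤ, diagQ x = 2 * k + 1 := by
  obtain ⟨σ, hσ, hM⟩ := h 2
  have h0 : intVec ![1, 0, 7 ^ n] ∈ stdPerp n := by
    rw [intVec_mem_stdPerp]
    refine ⟨?_, by simp⟩
    have h7 : Odd ((7 : ℤ) ^ n) := Odd.pow (by decide)
    simpa using odd_one.add_odd h7
  obtain ⟨m, hm, a, ha, h2⟩ := exists_mem_approx hM h0 1
  refine ⟨m, hm, ?_⟩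
  obtain ⟨k, hk⟩ := integral_of_genus h m hm m hm
  have h3 := congrArg (PadicInt.toZModPow 1) (intCast_eq_diagB hσ h2 h2 hk)
  simp only [diagB, map_add, map_mul, map_intCast, map_ofNat, map_sub, map_pow, map_natCast] at h3
  have h4 : ((2 : ℕ) : ZMod (2 ^ 1)) = 0 := by decide
  have h6 : (6 : ZMod (2 ^ 1)) = 0 := by decide
  have h7 : (k : ZMod (2 ^ 1)) = ((1 : ℤ) : ZMod (2 ^ 1)) := by
    rw [h3, h4, h6]; simp
  have h8 := (ZMod.intCast_eq_intCast_iff_dvd_sub _ _ _).1 h7.symm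
  obtain ⟨l, hl⟩ := h8
  refine ⟨l, ?_⟩
  rw [← diagB_self, hk, show k = 2 * l + 1 by push_cast at hl; linarith]
  push_cast; rfl

/-- This vector pairs with K(n) into 12·49ⁿℤ and has norm 24·49ⁿ. Its approximations at 2 and at 7
supply the special vectors of `GenusProperties`. -/
theorem intVec_mem_stdPerp_radical (n : ℕ) : intVec ![0, 0, 2 * 7 ^ n] ∈ stdPerp n := by
  rw [intVec_mem_stdPerp]
  exact ⟨by simp, by simp⟩

theorem two_vec_of_genus (h : ∀ (p : ℕ) [Fact p.Prime], LocallyIsometric p (stdPerp n) M) :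
    ∃ e ∈ M, (∀ y ∈ M, ∃ k : ℤ, diagB e y = 2 * k) ∧ (∃ k : ℤ, diagQ e = 4 * k) ∧
      ∀ y ∈ M, e ≠ (2 : ℤ) • y := by
  obtain ⟨σ, hσ, hM⟩ := h 2
  -- Precision 4 suffices to read the norm modulo 4 and the pairings modulo 2.
  obtain ⟨e, he, a, ⟨⟨s, hs⟩, -⟩, ha⟩ := exists_mem_approx hM (intVec_mem_stdPerp_radical n) 2
  refine ⟨e, he, fun y hy => ?_, ?_, fun y hy hey => ?_⟩
  · obtain ⟨b, -, hb⟩ := exists_coords hM (castVec_mem_localLattice hy)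
    obtain ⟨k, hk⟩ := integral_of_genus h e he y hy
    have h1 := intCast_eq_diagB hσ ha hb hk
    have h2 : ((2 : ℕ) : ℤ_[2]) ^ 1 ∣ k := by
      rw [h1]
      refine ⟨-2 * a 0 * b 0 - 2 * a 1 * b 1 + 3 * (2 * 7 ^ n - 4 * a 2) * b 2, ?_⟩
      simp [diagB]
      ring
    obtain ⟨l, hl⟩ := dvd_of_padicInt_dvd h2
    exact ⟨l, by rw [hk, hl]; push_cast; ring⟩
  · obtain ⟨k, hk⟩ := integral_of_genus h e he e he
    have h1 := intCast_eq_diagB hσ ha ha hk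
    have h2 : ((2 : ℕ) : ℤ_[2]) ^ 2 ∣ k := by
      rw [h1]
      refine ⟨4 * a 0 ^ 2 + 4 * a 1 ^ 2 + 6 * (7 ^ n - 2 * a 2) ^ 2, ?_⟩
      simp [diagB]
      ring
    obtain ⟨l, hl⟩ := dvd_of_padicInt_dvd h2
    exact ⟨l, by rw [← diagB_self, hk, hl]; push_cast; ring⟩
  · obtain ⟨b, ⟨⟨t, ht⟩, -⟩, hb⟩ := exists_coords hM (castVec_mem_localLattice hy)
    rw [hey, castVec_zsmul, ← hb, padicInt_smul_vec, ← map_smul, ← padicInt_smul_vec,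
      ← coeVec_smul] at ha
    have h1 := coeVec_injective (σ.injective ha)
    have h20 : (2 : ℤ_[2]) ≠ 0 := two_ne_zero
    have e0 := congrFun h1 0
    have e1 := congrFun h1 1
    have e2 := congrFun h1 2
    simp at e0 e1 e2
    have f0 : b 0 = -2 * a 0 := mul_left_cancel₀ h20 (by linear_combination -e0)
    have f1 : b 1 = -2 * a 1 := mul_left_cancel₀ h20 (by linear_combination -e1)
    have f2 : b 2 = 7 ^ n - 2 * a 2 := mul_left_cancel₀ h20 (by linear_combination -e2)
    -- If e were twice a vector, that half would be (0,0,7ⁿ) modulo 2, whose coordinate sum is odd.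
    have h3 : (7 : ℤ_[2]) ^ n = 2 * (t + a 0 + a 1 + a 2) := by
      linear_combination -f2 - f1 - f0 + ht
    have h4 := congrArg (PadicInt.toZModPow 1) h3
    simp only [map_pow, map_ofNat, map_mul] at h4
    have h5 : (7 : ZMod (2 ^ 1)) = 1 := by decide
    have h6 : (2 : ZMod (2 ^ 1)) = 0 := by decide
    rw [h5, h6, one_pow, zero_mul] at h4
    exact absurd h4 (by decide)

instance fact_prime_seven : Fact (Nat.Prime 7) := ⟨by norm_num⟩

theorem seven_vec_of_genus (h : ∀ (p : ℕ) [Fact p.Prime], LocallyIsometric p (stdPerp n) M) :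
    ∃ e ∈ M, (∀ y ∈ M, ∃ k : ℤ, diagB e y = 49 ^ n * k) ∧
      (∃ k : ℤ, diagQ e = 49 ^ n * (24 + 7 * k)) ∧ ∀ y ∈ M, e ≠ (7 : ℤ) • y := by
  have h49 : ∀ {R : Type} [CommRing R], (49 : R) ^ n = 7 ^ n * 7 ^ n := fun {R} _ => by
    rw [← mul_pow]; norm_num
  obtain ⟨σ, hσ, hM⟩ := h 7
  obtain ⟨e, he, a, -, ha⟩ :=
    -- One more power of 7 than in 49ⁿ, so that the norm divided by 49ⁿ is still known modulo 7.
    exists_mem_approx hM (intVec_mem_stdPerp_radical n) (2 * n + 1)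
  refine ⟨e, he, fun y hy => ?_, ?_, fun y hy hey => ?_⟩
  · obtain ⟨b, ⟨-, ⟨t, ht⟩⟩, hb⟩ := exists_coords hM (castVec_mem_localLattice hy)
    obtain ⟨k, hk⟩ := integral_of_genus h e he y hy
    have h1 := intCast_eq_diagB hσ ha hb hk
    have h2 : ((7 : ℕ) : ℤ_[7]) ^ (2 * n) ∣ k := by
      rw [h1]
      refine ⟨-7 * a 0 * b 0 - 7 * a 1 * b 1 + 12 * t - 42 * a 2 * b 2, ?_⟩
      simp [diagB, ht]
      ring
    obtain ⟨l, hl⟩ := dvd_of_padicInt_dvd h2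
    refine ⟨l, ?_⟩
    rw [hk, hl, pow_mul]; norm_num
  · obtain ⟨k, hk⟩ := integral_of_genus h e he e he
    have h1 := intCast_eq_diagB hσ ha ha hk
    have h2 : ((7 : ℕ) : ℤ_[7]) ^ (2 * n + 1) ∣ ((k - 49 ^ n * 24 : ℤ) : ℤ_[7]) := by
      push_cast
      rw [h1]
      refine ⟨7 ^ (2 * n + 1) * (a 0 ^ 2 + a 1 ^ 2 + 6 * a 2 ^ 2) - 24 * 7 ^ n * a 2, ?_⟩
      simp [diagB, h49]
      ring
    obtain ⟨l, hl⟩ := dvd_of_padicInt_dvd h2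
    refine ⟨l, ?_⟩
    have h3 : k = 49 ^ n * (24 + 7 * l) := by
      rw [pow_succ, pow_mul] at hl
      norm_num at hl
      linear_combination hl
    rw [← diagB_self, hk, h3]
    push_cast; ring
  · obtain ⟨b, ⟨-, ⟨t, ht⟩⟩, hb⟩ := exists_coords hM (castVec_mem_localLattice hy)
    rw [hey, castVec_zsmul, ← hb, padicInt_smul_vec, ← map_smul, ← padicInt_smul_vec,
      ← coeVec_smul] at ha
    have h1 := coeVec_injective (σ.injective ha)
    have h70 : (7 : ℤ_[7]) ^ n ≠ 0 := pow_ne_zero _ (by norm_num)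
    have e2 := congrFun h1 2
    simp [ht] at e2
    have f2 : (2 : ℤ_[7]) = 7 * (t + 7 ^ n * a 2) := mul_left_cancel₀ h70 (by
      linear_combination e2)
    have h4 := congrArg (PadicInt.toZModPow 1) f2
    simp only [map_ofNat, map_mul] at h4
    have h6 : (7 : ZMod (7 ^ 1)) = 0 := by decide
    rw [h6, zero_mul] at h4
    exact absurd h4 (by decide)

theorem det3_linear {R : Type*} [CommRing R] (u v w : Fin 3 → R) (c : Fin 3 → Fin 3 → R) :
    det3 (c 0 0 • u + c 0 1 • v + c 0 2 • w) (c 1 0 • u + c 1 1 • v + c 1 2 • w)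
      (c 2 0 • u + c 2 1 • v + c 2 2 • w) = det3 (c 0) (c 1) (c 2) * det3 u v w := by
  simp only [det3, Pi.add_apply, Pi.smul_apply, smul_eq_mul]; ring

theorem det3_localStd {p : ℕ} [Fact p.Prime] {a b c : Fin 3 → ℤ_[p]} (ha : IsLocalStd n a)
    (hb : IsLocalStd n b) (hc : IsLocalStd n c) : ∃ t, det3 a b c = 2 * 7 ^ n * t := by
  obtain ⟨⟨s, hs⟩, k, hk⟩ := ha
  obtain ⟨⟨s', hs'⟩, k', hk'⟩ := hb
  obtain ⟨⟨s'', hs''⟩, k'', hk''⟩ := hc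
  refine ⟨det3 ![s, a 1, k] ![s', b 1, k'] ![s'', c 1, k''], ?_⟩
  have e : a 0 = 2 * s - a 1 - 7 ^ n * k := by linear_combination hs - hk
  have e' : b 0 = 2 * s' - b 1 - 7 ^ n * k' := by linear_combination hs' - hk'
  have e'' : c 0 = 2 * s'' - c 1 - 7 ^ n * k'' := by linear_combination hs'' - hk''
  simp [det3, e, e', e'', hk, hk', hk'']
  ring

theorem gram3_map {S : Type*} [Field S] [CharZero S] {σ : (Fin 3 → S) ≃ₗ[S] (Fin 3 → S)}
    (h : ∀ x, diagQ (σ x) = diagQ x) (x y z : Fin 3 → S) :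
    gram3 (σ x) (σ y) (σ z) = gram3 x y z := by
  simp only [gram3, diagB_map_of_diagQ h]

theorem det3_map_sq {S : Type*} [Field S] [CharZero S] {σ : (Fin 3 → S) ≃ₗ[S] (Fin 3 → S)}
    (h : ∀ x, diagQ (σ x) = diagQ x) (x y z : Fin 3 → S) :
    det3 (σ x) (σ y) (σ z) ^ 2 = det3 x y z ^ 2 := by
  have h6 : (6 : S) ≠ 0 := by norm_num
  apply mul_left_cancel₀ h6
  rw [← gram3_eq, ← gram3_eq, gram3_map h]

theorem localLattice_span_triple {p : ℕ} [Fact p.Prime] {u v w : Fin 3 → ℚ}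
    {x : Fin 3 → ℚ_[p]} (hx : x ∈ localLattice p (Submodule.span ℤ {u, v, w})) :
    ∃ c : Fin 3 → ℤ_[p], x = (c 0 : ℚ_[p]) • castVec p u + (c 1 : ℚ_[p]) • castVec p v
      + (c 2 : ℚ_[p]) • castVec p w := by
  have hle : localLattice p (Submodule.span ℤ {u, v, w}) ≤
      Submodule.span ℤ_[p] {castVec p u, castVec p v, castVec p w} := by
    rw [localLattice, Submodule.span_le]
    rintro _ ⟨y, hy, rfl⟩
    obtain ⟨i, j, k, rfl⟩ := Submodule.mem_span_triple.1 hy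
    rw [castVec_add, castVec_add, castVec_zsmul, castVec_zsmul, castVec_zsmul]
    exact Submodule.mem_span_triple.2 ⟨_, _, _, rfl⟩
  obtain ⟨i, j, k, rfl⟩ := Submodule.mem_span_triple.1 (hle hx)
  exact ⟨![i, j, k], rfl⟩

/-- Expressing bases of M_p and K(n)_p in each other shows that det²/(4·49ⁿ) and its inverse are
p-adic integers for every p. They are therefore integers with product 1, and positivity leaves 1. -/
theorem basis_of_genus (hL : M.IsLattice ℚ)
    (h : ∀ (p : ℕ) [Fact p.Prime], LocallyIsometric p (stdPerp n) M) :
    ∃ x y z : Fin 3 → ℚ, M = Submodule.span ℤ {x, y, z} ∧ det3 x y z ^ 2 = 4 * 49 ^ n := by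
  have hfree : Module.Free ℤ M := Submodule.IsLattice.free ℚ M
  have hfin : Module.Finite ℤ M := Submodule.IsLattice.finite ℚ M
  have hrank : Module.finrank ℤ M = 3 := by
    rw [Submodule.IsLattice.finrank_of_pi (K := ℚ)]; simp
  let b := Module.finBasisOfFinrankEq ℤ M hrank
  obtain ⟨u, v, w, hspan⟩ : ∃ u v w : Fin 3 → ℚ, M = Submodule.span ℤ {u, v, w} := by
    refine ⟨b 0, b 1, b 2, ?_⟩
    have h1 := congrArg (Submodule.map M.subtype) b.span_eq
    rw [Submodule.map_span, Submodule.map_top, Submodule.range_subtype, ← Set.range_comp] at h1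
    refine h1.symm.trans (congrArg _ ?_)
    ext x
    simp [Fin.exists_fin_succ, eq_comm]
  refine ⟨u, v, w, hspan, ?_⟩
  have hu : u ∈ M := hspan ▸ Submodule.subset_span (by simp)
  have hv : v ∈ M := hspan ▸ Submodule.subset_span (by simp)
  have hw : w ∈ M := hspan ▸ Submodule.subset_span (by simp)
  have h49 : ∀ {R : Type} [CommRing R], (4 : R) * 49 ^ n = (2 * 7 ^ n) ^ 2 := fun {R} _ => by
    rw [mul_pow, ← pow_mul, mul_comm n, pow_mul]; norm_num
  have hne : (4 * 49 ^ n : ℚ) ≠ 0 := by positivity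
  have hcast : ∀ (p : ℕ) [Fact p.Prime], det3 (castVec p u) (castVec p v) (castVec p w) =
      (det3 u v w : ℚ) := fun p _ => by simp [det3, castVec]
  have hcoe : ∀ {p : ℕ} [Fact p.Prime] (a b c : Fin 3 → ℤ_[p]),
      det3 (coeVec a) (coeVec b) (coeVec c) = (det3 a b c : ℤ_[p]) := fun a b c => by
    simp [det3, coeVec]
  have hint : ∃ k : ℤ, det3 u v w ^ 2 / (4 * 49 ^ n) = k := by
    apply exists_int_of_forall_padicInt
    intro p _
    obtain ⟨σ, hσ, hM⟩ := h p
    obtain ⟨a, ha, hau⟩ := exists_coords hM (castVec_mem_localLattice hu)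
    obtain ⟨a', ha', hav⟩ := exists_coords hM (castVec_mem_localLattice hv)
    obtain ⟨a'', ha'', haw⟩ := exists_coords hM (castVec_mem_localLattice hw)
    obtain ⟨t, ht⟩ := det3_localStd ha ha' ha''
    refine ⟨t ^ 2, ?_⟩
    have hne' : (4 * 49 ^ n : ℚ_[p]) ≠ 0 := by exact_mod_cast hne
    have h1 : ((det3 u v w : ℚ) : ℚ_[p]) ^ 2 = 4 * 49 ^ n * t ^ 2 := by
      rw [← hcast, ← hau, ← hav, ← haw, det3_map_sq hσ, hcoe, ht, h49]
      push_cast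
      simp only [mul_pow]
      rfl
    push_cast
    rw [h1]
    field_simp
  have hloc : ∀ (p : ℕ) [Fact p.Prime], ∃ t : ℤ_[p],
      (4 * 49 ^ n : ℚ_[p]) = t * ((det3 u v w : ℚ) : ℚ_[p]) ^ 2 := by
    intro p _
    obtain ⟨σ, hσ, hM⟩ := h p
    have hK : ∀ {c : Fin 3 → ℤ}, intVec c ∈ stdPerp n → ∃ d : Fin 3 → ℤ_[p],
        σ (castVec p (intVec c)) = (d 0 : ℚ_[p]) • castVec p u + (d 1 : ℚ_[p]) • castVec p v
          + (d 2 : ℚ_[p]) • castVec p w := by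
      intro c hc
      have h1 := apply_mem_image (σ := σ) (castVec_mem_localLattice (p := p) hc)
      rw [hM, hspan] at h1
      exact localLattice_span_triple h1
    -- The vectors (0,0,2·7ⁿ), (1,1,0), (0,1,7ⁿ) lie in K(n) and have determinant 2·7ⁿ.
    obtain ⟨d, hd⟩ := hK (intVec_mem_stdPerp_radical n)
    obtain ⟨d', hd'⟩ := hK (c := ![1, 1, 0]) (by rw [intVec_mem_stdPerp]; simp)
    obtain ⟨d'', hd''⟩ := hK (c := ![0, 1, 7 ^ n]) (by
      rw [intVec_mem_stdPerp]
      refine ⟨?_, by simp⟩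
      have h7 : Odd ((7 : ℤ) ^ n) := Odd.pow (by decide)
      simpa using odd_one.add_odd h7)
    have h2 := det3_map_sq hσ (castVec p (intVec ![0, 0, 2 * 7 ^ n]))
      (castVec p (intVec ![1, 1, 0])) (castVec p (intVec ![0, 1, 7 ^ n]))
    rw [hd, hd', hd''] at h2
    have h3 := det3_linear (castVec p u) (castVec p v) (castVec p w)
      ![coeVec d, coeVec d', coeVec d'']
    simp only [Matrix.cons_val_zero, Matrix.cons_val_one, Matrix.cons_val, coeVec] at h3
    rw [h3, hcast] at h2
    have h4 : det3 (castVec p (intVec ![0, 0, 2 * 7 ^ n])) (castVec p (intVec ![1, 1, 0]))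
        (castVec p (intVec ![0, 1, 7 ^ n])) = 2 * 7 ^ n := by
      simp [det3, castVec, intVec]
    rw [h4, ← h49] at h2
    refine ⟨det3 d d' d'' ^ 2, ?_⟩
    rw [← h2, mul_pow, PadicInt.coe_pow, ← hcoe]
  have hD : det3 u v w ≠ 0 := by
    intro h0
    obtain ⟨t, ht⟩ := hloc 2
    rw [h0] at ht
    simp at ht
  have hint' : ∃ k : ℤ, (4 * 49 ^ n) / det3 u v w ^ 2 = k := by
    apply exists_int_of_forall_padicInt
    intro p _
    obtain ⟨t, ht⟩ := hloc p
    have hD' : ((det3 u v w : ℚ) : ℚ_[p]) ≠ 0 := by exact_mod_cast hD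
    refine ⟨t, ?_⟩
    push_cast
    rw [ht]
    field_simp
  obtain ⟨k, hk⟩ := hint
  obtain ⟨l, hl⟩ := hint'
  have hkl : k * l = 1 := by
    have : (k * l : ℚ) = 1 := by rw [← hk, ← hl]; field_simp
    exact_mod_cast this
  have hk0 : 0 ≤ k := by
    have : (0 : ℚ) ≤ k := by rw [← hk]; positivity
    exact_mod_cast this
  have hk1 : k = 1 := Int.eq_one_of_mul_eq_one_right hk0 hkl
  rw [hk1, div_eq_iff hne] at hk
  simpa using hk

theorem genusProperties (hL : M.IsLattice ℚ)
    (h : ∀ (p : ℕ) [Fact p.Prime], LocallyIsometric p (stdPerp n) M) : GenusProperties n M :=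
  ⟨integral_of_genus h, three_of_genus h, odd_of_genus h, four_of_genus h, basis_of_genus hL h,
    two_vec_of_genus h, seven_vec_of_genus h⟩

end genus_properties

/-! ### Bases and reduction of ternary lattices. -/

/-- `x, y, z` generate `L` and have determinant `D`. -/
def IsTriple (L : Submodule ℤ (Fin 3 → ℚ)) (D : ℚ) (x y z : Fin 3 → ℚ) : Prop :=
  L = Submodule.span ℤ {x, y, z} ∧ det3 x y z = D

section triples

variable {L : Submodule ℤ (Fin 3 → ℚ)} {D : ℚ} {x y z : Fin 3 → ℚ}

theorem IsTriple.rotate (h : IsTriple L D x y z) : IsTriple L D y z x := by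
  obtain ⟨h1, h2⟩ := h
  refine ⟨?_, ?_⟩
  · rw [h1]
    congr 1
    ext v
    simp only [Set.mem_insert_iff, Set.mem_singleton_iff]
    tauto
  · rw [← h2]; simp only [det3]; ring

theorem IsTriple.mem_iff (h : IsTriple L D x y z) {v : Fin 3 → ℚ} :
    v ∈ L ↔ ∃ i j k : ℤ, i • x + j • y + k • z = v := by
  rw [h.1]; exact Submodule.mem_span_triple

theorem IsTriple.unimodular (h : IsTriple L D x y z) {s t c d : ℤ} (hst : s * c + t * d = 1) :
    IsTriple L D (c • x + d • y) (-t • x + s • y) z := by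
  obtain ⟨h1, h2⟩ := h
  have hx : x ∈ L := h1 ▸ Submodule.subset_span (by simp)
  have hy : y ∈ L := h1 ▸ Submodule.subset_span (by simp)
  have hz : z ∈ L := h1 ▸ Submodule.subset_span (by simp)
  refine ⟨le_antisymm ?_ ?_, ?_⟩
  · rw [h1, Submodule.span_le]
    rintro v (rfl | rfl | rfl)
    · refine Submodule.mem_span_triple.2 ⟨s, -d, 0, ?_⟩
      have : v = (s * c + t * d) • v := by rw [hst, one_smul]
      conv_rhs => rw [this]
      module
    · refine Submodule.mem_span_triple.2 ⟨t, c, 0, ?_⟩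
      have : v = (s * c + t * d) • v := by rw [hst, one_smul]
      conv_rhs => rw [this]
      module
    · exact Submodule.subset_span (by simp)
  · rw [Submodule.span_le]
    rintro v (rfl | rfl | rfl)
    · exact add_mem (zsmul_mem hx _) (zsmul_mem hy _)
    · exact add_mem (zsmul_mem hx _) (zsmul_mem hy _)
    · exact hz
  · have hq : (s * c + t * d : ℚ) = 1 := by exact_mod_cast hst
    rw [← h2]
    simp only [det3, Pi.add_apply, Pi.smul_apply]
    simp only [zsmul_eq_mul]
    push_cast
    linear_combination
      (x 0 * (y 1 * z 2 - y 2 * z 1) - x 1 * (y 0 * z 2 - y 2 * z 0)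
        + x 2 * (y 0 * z 1 - y 1 * z 0)) * hq

theorem exists_bezout (a b : ℤ) : ∃ g a' b' s t : ℤ, a = g * a' ∧ b = g * b' ∧
    s * a' + t * b' = 1 := by
  by_cases h : a = 0 ∧ b = 0
  · exact ⟨0, 1, 0, 1, 0, by simp [h.1], by simp [h.2], by simp⟩
  · have hg : (Int.gcd a b : ℤ) ≠ 0 := by
      simpa [Int.gcd_eq_zero_iff] using h
    obtain ⟨a', ha⟩ := Int.gcd_dvd_left a b
    obtain ⟨b', hb⟩ := Int.gcd_dvd_right a b
    refine ⟨Int.gcd a b, a', b', Int.gcdA a b, Int.gcdB a b, ha, hb, ?_⟩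
    apply mul_left_cancel₀ hg
    have := Int.gcd_eq_gcd_ab a b
    linear_combination -Int.gcdA a b * ha - Int.gcdB a b * hb - this

/-- Every element of `L` is a multiple of a member of a basis of `L`. -/
theorem IsTriple.exists_of_mem (h : IsTriple L D x y z) {e : Fin 3 → ℚ} (he : e ∈ L) :
    ∃ (x' y' e' : Fin 3 → ℚ) (g : ℤ), IsTriple L D x' y' e' ∧ e = g • e' := by
  obtain ⟨i, j, k, rfl⟩ := h.mem_iff.1 he
  obtain ⟨g, i', j', s, t, rfl, rfl, hst⟩ := exists_bezout i j
  obtain ⟨g', g'', k', s', t', rfl, rfl, hst'⟩ := exists_bezout g k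
  have h1 := (h.unimodular hst).rotate.rotate
  have h2 := (h1.unimodular (s := t') (t := s') (c := k') (d := g'')
    (by rw [add_comm]; exact hst')).rotate
  refine ⟨_, _, _, g', h2, ?_⟩
  module

theorem exists_abs_le (b : ℤ) {a : ℤ} (ha : 0 < a) : ∃ k : ℤ, |2 * (b + k * a)| ≤ a := by
  -- Minus the integer nearest to b/a.
  refine ⟨-((2 * b + a) / (2 * a)), ?_⟩
  have h1 := Int.emod_nonneg (2 * b + a) (show 2 * a ≠ 0 by omega)
  have h2 := Int.emod_lt_of_pos (2 * b + a) (show 0 < 2 * a by omega)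
  have h3 := Int.emod_add_mul_ediv (2 * b + a) (2 * a)
  set q := (2 * b + a) / (2 * a)
  rw [abs_le]
  constructor <;> nlinarith

/-- Hermite's argument in two stages. With A = ad - b², the first stage gives 3a² ≤ 4A. The binary
form of the 2×2 minors containing a has determinant 6a and is reduced with minimum A, so A² ≤ 8a.
Hence a ≤ 2 and A ≤ 4. The case a = 1 splits off a unit vector, and a = 2 forces even diagonal
entries. -/
theorem reduced_cases {a b c d e f : ℤ} (ha : 0 < a) (hb : |2 * b| ≤ a) (hc : |2 * c| ≤ a)
    (had : a ≤ d) (hle : a * d - b ^ 2 ≤ a * f - c ^ 2)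
    (he : |2 * (a * e - b * c)| ≤ a * d - b ^ 2)
    (hdet : (a * d - b ^ 2) * (a * f - c ^ 2) - (a * e - b * c) ^ 2 = 6 * a) :
    (a = 1 ∧ b = 0 ∧ c = 0 ∧ e = 0 ∧ (d = 1 ∧ f = 6 ∨ d = 2 ∧ f = 3)) ∨
      (Even a ∧ Even d ∧ Even f) := by
  obtain ⟨hb1, hb2⟩ := abs_le.1 hb
  obtain ⟨hc1, hc2⟩ := abs_le.1 hc
  obtain ⟨he1, he2⟩ := abs_le.1 he
  have h1 : 4 * b ^ 2 ≤ a ^ 2 := by nlinarith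
  have h2 : 3 * a ^ 2 ≤ 4 * (a * d - b ^ 2) := by nlinarith
  set A := a * d - b ^ 2 with hA
  set C := a * f - c ^ 2 with hC
  set B := a * e - b * c with hB
  have hA0 : 0 < A := by nlinarith
  have h3 : 4 * B ^ 2 ≤ A ^ 2 := by nlinarith
  have h4 : A ^ 2 ≤ 8 * a := by nlinarith
  have h5 : a ≤ 2 := by
    by_contra hlt
    have h6 : 3 ≤ a := by omega
    have h7 : 9 * a ≤ 4 * A := by nlinarith
    nlinarith
  have hA4 : A ≤ 4 := by nlinarith
  obtain rfl | rfl : a = 1 ∨ a = 2 := by omega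
  · obtain rfl : b = 0 := by omega
    obtain rfl : c = 0 := by omega
    have hA2 : A ≤ 2 := by nlinarith
    left
    simp only [hA, hB, hC] at *
    have : d = 1 ∨ d = 2 := by omega
    rcases this with rfl | rfl
    · have : e = 0 := by omega
      subst this
      simp at hdet ⊢
      omega
    · have : e = -1 ∨ e = 0 ∨ e = 1 := by omega
      rcases this with rfl | rfl | rfl <;> simp at hdet ⊢ <;> omega
  · right
    have hb3 : b ^ 2 = 0 ∨ b ^ 2 = 1 := by
      have : b = -1 ∨ b = 0 ∨ b = 1 := by omega
      rcases this with rfl | rfl | rfl <;> simp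
    have hc3 : c ^ 2 = 0 ∨ c ^ 2 = 1 := by
      have : c = -1 ∨ c = 0 ∨ c = 1 := by omega
      rcases this with rfl | rfl | rfl <;> simp
    have hd2 : d = 2 := by omega
    have hB3 : B ^ 2 = 0 ∨ B ^ 2 = 1 ∨ B ^ 2 = 4 := by
      have : B = -2 ∨ B = -1 ∨ B = 0 ∨ B = 1 ∨ B = 2 := by omega
      rcases this with h | h | h | h | h <;> rw [h] <;> simp
    have hA3 : A = 4 ∨ A = 3 := by omega
    refine ⟨by decide, ⟨1, hd2⟩, ?_⟩
    rw [Int.even_iff]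
    rcases hA3 with h | h <;> rw [h] at hdet h3 hle <;> omega

end triples

theorem diagQ_pos {x : Fin 3 → ℚ} (hx : x ≠ 0) : 0 < diagQ x := by
  by_contra h
  apply hx
  simp only [diagQ] at h
  have h0 := sq_nonneg (x 0)
  have h1 := sq_nonneg (x 1)
  have h2 := sq_nonneg (x 2)
  ext i
  apply pow_eq_zero_iff (two_ne_zero) |>.1
  match i with
  | 0 => change x 0 ^ 2 = 0; linarith
  | 1 => change x 1 ^ 2 = 0; linarith
  | 2 => change x 2 ^ 2 = 0; linarith

theorem eq_zero_of_diagQ_eq_zero {x : Fin 3 → ℚ} (hx : diagQ x = 0) : x = 0 := by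
  by_contra h
  exact (diagQ_pos h).ne' hx

/-- Integral Gram coefficients of a triple. -/
structure HasGram (x y z : Fin 3 → ℚ) (a b c d e f : ℤ) : Prop where
  xx : diagB x x = a
  xy : diagB x y = b
  xz : diagB x z = c
  yy : diagB y y = d
  yz : diagB y z = e
  zz : diagB z z = f

theorem HasGram.det {x y z : Fin 3 → ℚ} {a b c d e f : ℤ} (h : HasGram x y z a b c d e f)
    (hdet : det3 x y z ^ 2 = 1) :
    (a * d - b ^ 2) * (a * f - c ^ 2) - (a * e - b * c) ^ 2 = 6 * a := by
  have h1 := gram3_eq x y z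
  rw [hdet, gram3, h.xx, h.xy, h.xz, h.yy, h.yz, h.zz] at h1
  have h2 : a * (d * f - e ^ 2) - b * (b * f - e * c) + c * (b * e - d * c) = 6 := by
    have : ((a * (d * f - e ^ 2) - b * (b * f - e * c) + c * (b * e - d * c) : ℤ) : ℚ) = 6 := by
      push_cast; linarith
    exact_mod_cast this
  linear_combination a * h2

theorem HasGram.diagB_comb {x y z : Fin 3 → ℚ} {a b c d e f : ℤ} (h : HasGram x y z a b c d e f)
    (i j k i' j' k' : ℤ) : diagB (i • x + j • y + k • z) (i' • x + j' • y + k' • z) =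
      ((i * i' * a + j * j' * d + k * k' * f + (i * j' + j * i') * b + (i * k' + k * i') * c
        + (j * k' + k * j') * e : ℤ) : ℚ) := by
  simp only [diagB_add_left, diagB_add_right, diagB_zsmul_left, diagB_zsmul_right,
    diagB_comm y x, diagB_comm z x, diagB_comm z y, h.xx, h.xy, h.xz, h.yy, h.yz, h.zz]
  push_cast
  ring

section shear

variable {L : Submodule ℤ (Fin 3 → ℚ)} {D : ℚ} {x y z : Fin 3 → ℚ} {a b c d e f : ℤ}

theorem IsTriple.shear_xy (h : IsTriple L D x y z) (k : ℤ) : IsTriple L D x (y + k • x) z := by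
  have h1 := h.unimodular (s := 1) (t := -k) (c := 1) (d := 0) (by simp)
  rw [one_smul, zero_smul, add_zero, neg_neg, one_smul, add_comm] at h1
  exact h1

theorem IsTriple.shear_yz (h : IsTriple L D x y z) (k : ℤ) : IsTriple L D x y (z + k • y) :=
  (h.rotate.shear_xy k).rotate.rotate

theorem IsTriple.shear_xz (h : IsTriple L D x y z) (k : ℤ) : IsTriple L D x y (z + k • x) := by
  have h1 := (h.rotate.rotate.unimodular (s := 1) (t := 0) (c := 1) (d := k) (by simp)).rotate
  rw [one_smul, one_smul, neg_zero, zero_smul, zero_add] at h1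
  exact h1

theorem IsTriple.swap_xy (h : IsTriple L D x y z) : IsTriple L D y (-x) z := by
  have h1 := h.unimodular (s := 0) (t := 1) (c := 0) (d := 1) (by simp)
  rw [one_smul, zero_smul, zero_add, neg_smul, one_smul, zero_smul, add_zero] at h1
  exact h1

theorem IsTriple.swap_yz (h : IsTriple L D x y z) : IsTriple L D x z (-y) :=
  h.rotate.swap_xy.rotate.rotate

theorem HasGram.shear_xy (h : HasGram x y z a b c d e f) (k : ℤ) :
    HasGram x (y + k • x) z a (b + k * a) c (d + 2 * k * b + k ^ 2 * a) (e + k * c) f := by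
  refine ⟨h.xx, ?_, h.xz, ?_, ?_, h.zz⟩ <;>
  simp only [diagB_add_left, diagB_add_right, diagB_zsmul_left, diagB_zsmul_right,
    diagB_comm y x, h.xx, h.xy, h.xz, h.yy, h.yz] <;> push_cast <;> ring

theorem HasGram.shear_yz (h : HasGram x y z a b c d e f) (k : ℤ) :
    HasGram x y (z + k • y) a b (c + k * b) d (e + k * d) (f + 2 * k * e + k ^ 2 * d) := by
  refine ⟨h.xx, h.xy, ?_, h.yy, ?_, ?_⟩ <;>
  simp only [diagB_add_left, diagB_add_right, diagB_zsmul_left, diagB_zsmul_right,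
    diagB_comm z y, h.xy, h.xz, h.yy, h.yz, h.zz] <;> push_cast <;> ring

theorem HasGram.shear_xz (h : HasGram x y z a b c d e f) (k : ℤ) :
    HasGram x y (z + k • x) a b (c + k * a) d (e + k * b) (f + 2 * k * c + k ^ 2 * a) := by
  refine ⟨h.xx, h.xy, ?_, h.yy, ?_, ?_⟩ <;>
  simp only [diagB_add_left, diagB_add_right, diagB_zsmul_left, diagB_zsmul_right,
    diagB_comm z x, diagB_comm y x, h.xx, h.xy, h.xz, h.yz, h.zz] <;> push_cast <;> ring

theorem diagB_neg_left {R : Type*} [CommRing R] (x y : Fin 3 → R) :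
    diagB (-x) y = -diagB x y := by
  simp only [diagB, Pi.neg_apply]; ring

theorem diagB_neg_right {R : Type*} [CommRing R] (x y : Fin 3 → R) :
    diagB x (-y) = -diagB x y := by
  simp only [diagB, Pi.neg_apply]; ring

theorem HasGram.swap_xy (h : HasGram x y z a b c d e f) :
    HasGram y (-x) z d (-b) e a (-c) f := by
  refine ⟨h.yy, ?_, h.yz, ?_, ?_, h.zz⟩ <;>
  simp only [diagB_neg_left, diagB_neg_right, diagB_comm y x, h.xx, h.xy, h.xz] <;>
  push_cast <;> ring

theorem HasGram.swap_yz (h : HasGram x y z a b c d e f) :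
    HasGram x z (-y) a c (-b) f (-e) d := by
  refine ⟨h.xx, h.xz, ?_, h.zz, ?_, ?_⟩ <;>
  simp only [diagB_neg_left, diagB_neg_right, diagB_comm z y, h.xy, h.yy, h.yz] <;>
  push_cast <;> ring

end shear

section reduction

variable {L : Submodule ℤ (Fin 3 → ℚ)}

/-- A unimodular basis of `L` with a prescribed leading Gram minor. -/
def HasMinor (L : Submodule ℤ (Fin 3 → ℚ)) (a A : ℕ) : Prop :=
  ∃ (D : ℚ) (x y z : Fin 3 → ℚ) (b c d e f : ℤ), D ^ 2 = 1 ∧ IsTriple L D x y z ∧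
    HasGram x y z a b c d e f ∧ (a : ℤ) * d - b ^ 2 = A

theorem exists_hasGram (hint : ∀ x ∈ L, ∀ y ∈ L, ∃ k : ℤ, diagB x y = k) {D : ℚ}
    {x y z : Fin 3 → ℚ} (h : IsTriple L D x y z) :
    ∃ a b c d e f : ℤ, HasGram x y z a b c d e f := by
  have hx : x ∈ L := h.1 ▸ Submodule.subset_span (by simp)
  have hy : y ∈ L := h.1 ▸ Submodule.subset_span (by simp)
  have hz : z ∈ L := h.1 ▸ Submodule.subset_span (by simp)
  obtain ⟨a, ha⟩ := hint x hx x hx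
  obtain ⟨b, hb⟩ := hint x hx y hy
  obtain ⟨c, hc⟩ := hint x hx z hz
  obtain ⟨d, hd⟩ := hint y hy y hy
  obtain ⟨e, he⟩ := hint y hy z hz
  obtain ⟨f, hf⟩ := hint z hz z hz
  exact ⟨a, b, c, d, e, f, ha, hb, hc, hd, he, hf⟩

theorem HasGram.a_pos {x y z : Fin 3 → ℚ} {a b c d e f : ℤ} (h : HasGram x y z a b c d e f)
    {D : ℚ} (hD : D ^ 2 = 1) (ht : IsTriple L D x y z) : 0 < a := by
  have hx : x ≠ 0 := by
    rintro rfl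
    have := ht.2
    simp [det3] at this
    rw [← this] at hD
    simp at hD
  have h1 := diagQ_pos hx
  rw [← diagB_self, h.xx] at h1
  exact_mod_cast h1

theorem HasGram.minor_nonneg {x y z : Fin 3 → ℚ} {a b c d e f : ℤ}
    (h : HasGram x y z a b c d e f) : 0 ≤ a * d - b ^ 2 := by
  have h1 : ((a * d - b ^ 2 : ℤ) : ℚ) = (x 0 * y 1 - x 1 * y 0) ^ 2
      + 6 * (x 0 * y 2 - x 2 * y 0) ^ 2 + 6 * (x 1 * y 2 - x 2 * y 1) ^ 2 := by
    push_cast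
    rw [← h.xx, ← h.xy, ← h.yy]
    simp only [diagB]
    ring
  have h2 : (0 : ℚ) ≤ ((a * d - b ^ 2 : ℤ) : ℚ) := by rw [h1]; positivity
  exact_mod_cast h2

theorem HasGram.hasMinor {x y z : Fin 3 → ℚ} {a b c d e f : ℤ} (h : HasGram x y z a b c d e f)
    {D : ℚ} (hD : D ^ 2 = 1) (ht : IsTriple L D x y z) :
    HasMinor L a.toNat (a * d - b ^ 2).toNat := by
  have ha : (a.toNat : ℤ) = a := Int.toNat_of_nonneg (h.a_pos hD ht).le
  exact ⟨D, x, y, z, b, c, d, e, f, hD, ht, by rw [ha]; exact h, by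
    rw [ha, Int.toNat_of_nonneg h.minor_nonneg]⟩

/-- Reduction of an integral ternary lattice of determinant `6` in the space of `diagQ`. -/
theorem exists_reduced (hint : ∀ x ∈ L, ∀ y ∈ L, ∃ k : ℤ, diagB x y = k) {D₀ : ℚ}
    {x₀ y₀ z₀ : Fin 3 → ℚ} (h₀ : IsTriple L D₀ x₀ y₀ z₀) (hD₀ : D₀ ^ 2 = 1) :
    ∃ (D : ℚ) (x y z : Fin 3 → ℚ) (a b c d e f : ℤ), D ^ 2 = 1 ∧ IsTriple L D x y z ∧
      HasGram x y z a b c d e f ∧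
      ((a = 1 ∧ b = 0 ∧ c = 0 ∧ e = 0 ∧ (d = 1 ∧ f = 6 ∨ d = 2 ∧ f = 3)) ∨
      (Even a ∧ Even d ∧ Even f)) := by
  classical
  have hex : ∃ a, ∃ A, HasMinor L a A := by
    obtain ⟨a, b, c, d, e, f, h⟩ := exists_hasGram hint h₀
    exact ⟨_, _, h.hasMinor hD₀ h₀⟩
  have hex' := Nat.find_spec hex
  -- The basis minimizes first the norm a of x, then the minor A of x, y. The shears below change
  -- neither, so comparison with swapped bases gives the inequalities of a reduced form.
  have hmina : ∀ a' A', HasMinor L a' A' → Nat.find hex ≤ a' := fun a' A' h' =>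
    Nat.find_min' hex ⟨A', h'⟩
  have hminA : ∀ A', HasMinor L (Nat.find hex) A' → Nat.find hex' ≤ A' := fun A' h' =>
    Nat.find_min' hex' h'
  obtain ⟨D, x, y, z, b, c, d, e, f, hD, ht, hg, hA⟩ := Nat.find_spec hex'
  generalize Nat.find hex' = A at *
  generalize Nat.find hex = a at *
  have ha0 : 0 < (a : ℤ) := hg.a_pos hD ht
  obtain ⟨k, hk⟩ := exists_abs_le b ha0
  replace ht := ht.shear_xy k
  replace hg := hg.shear_xy k
  replace hA : (a : ℤ) * (d + 2 * k * b + k ^ 2 * a) - (b + k * a) ^ 2 = A := by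
    rw [← hA]; ring
  generalize y + k • x = y at *
  generalize b + k * (a : ℤ) = b at *
  generalize d + 2 * k * _ + k ^ 2 * (a : ℤ) = d at *
  generalize e + k * c = e at *
  have had : (a : ℤ) ≤ d := by
    have h1 := hmina _ _ (hg.swap_xy.hasMinor hD ht.swap_xy)
    have h2 := hg.swap_xy.a_pos hD ht.swap_xy
    omega
  have hA0 : 0 < (A : ℤ) := by
    rw [← hA]
    obtain ⟨h1, h2⟩ := abs_le.1 hk
    nlinarith
  obtain ⟨l, hl⟩ := exists_abs_le ((a : ℤ) * e - b * c) hA0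
  replace ht := ht.shear_yz l
  replace hg := hg.shear_yz l
  replace hl : |2 * ((a : ℤ) * (e + l * d) - b * (c + l * b))| ≤ A := by
    rw [← hA] at hl ⊢
    convert hl using 3
    ring
  generalize z + l • y = z at *
  generalize c + l * b = c at *
  generalize f + 2 * l * e + l ^ 2 * d = f at *
  generalize e + l * d = e at *
  obtain ⟨m, hm⟩ := exists_abs_le c ha0
  replace ht := ht.shear_xz m
  replace hg := hg.shear_xz m
  replace hl : |2 * ((a : ℤ) * (e + m * b) - b * (c + m * a))| ≤ A := by
    convert hl using 3
    ring
  generalize z + m • x = z at *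
  generalize f + 2 * m * c + m ^ 2 * (a : ℤ) = f at *
  generalize c + m * (a : ℤ) = c at *
  generalize e + m * b = e at *
  have hle : (A : ℤ) ≤ a * f - c ^ 2 := by
    have h1 := hg.swap_yz.hasMinor hD ht.swap_yz
    rw [Int.toNat_natCast] at h1
    have h2 := hminA _ h1
    have h3 := hg.swap_yz.minor_nonneg
    omega
  refine ⟨D, x, y, z, a, b, c, d, e, f, hD, ht, hg, ?_⟩
  rw [← hA] at hle hl
  have h6 := hg.det (by rw [ht.2, hD])
  rcases reduced_cases ha0 hk hm had hle hl h6 with h | h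
  · left; exact_mod_cast h
  · right; exact h

end reduction

/-! ### The integral overlattice of determinant 6. -/

section overlattice

variable {n : ℕ} {M : Submodule ℤ (Fin 3 → ℚ)}

theorem four_mul_pow (n : ℕ) {R : Type*} [CommRing R] : (4 : R) * 49 ^ n = (2 * 7 ^ n) ^ 2 := by
  rw [mul_pow, ← pow_mul, mul_comm n, pow_mul]; norm_num

theorem isCoprime_pow_of_mod {g : ℤ} (n : ℕ) (h2 : g % 2 ≠ 0) (h7 : g % 7 ≠ 0) :
    IsCoprime (2 * 49 ^ n) g := by
  have h1 : IsCoprime (2 : ℤ) g := by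
    refine (Int.prime_two.coprime_iff_not_dvd).2 ?_
    omega
  have h3 : IsCoprime (7 : ℤ) g := by
    have : Prime (7 : ℤ) := by norm_num
    refine (this.coprime_iff_not_dvd).2 ?_
    omega
  refine h1.mul_left (IsCoprime.pow_left ?_)
  rw [show (49 : ℤ) = 7 * 7 by norm_num]
  exact h3.mul_left h3

/-- The index `2·7ⁿ` overlattice of determinant `6`. -/
theorem exists_overlattice (hn : 1 ≤ n) (h : GenusProperties n M) :
    ∃ (D : ℚ) (x y w : Fin 3 → ℚ), D ^ 2 = 1 ∧ det3 x y w = D ∧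
      M = Submodule.span ℤ {x, y, (2 * 7 ^ n : ℤ) • w} ∧
      (∀ m ∈ M, ∃ k : ℤ, diagB w m = 7 ^ n * k) ∧
      ∃ r : ℤ, diagQ w = r ∧ (r % 7 = 3 ∨ r % 7 = 5 ∨ r % 7 = 6) := by
  obtain ⟨x₀, y₀, z₀, hspan, hdet⟩ := h.basis
  obtain ⟨e₂, he₂, hB₂, ⟨k₂, hk₂⟩, hp₂⟩ := h.two_vec
  obtain ⟨e₇, he₇, hB₇, ⟨k₇, hk₇⟩, hp₇⟩ := h.seven_vec
  have ht : IsTriple M (det3 x₀ y₀ z₀) x₀ y₀ z₀ := ⟨hspan, rfl⟩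
  obtain ⟨s, hs⟩ : ∃ s : ℤ, (49 : ℤ) ^ n = 2 * s + 1 := Odd.pow (by decide)
  obtain ⟨t, hst⟩ : (7 : ℤ) ∣ 49 ^ n := dvd_pow (by norm_num) (by omega)
  -- Chinese remainder: the coefficients make the sum behave like e₂ at 2 and, since 7 ∣ 49ⁿ, like a
  -- unit multiple of e₇ at 7. It pairs with M into 2·49ⁿℤ and is divisible by neither 2 nor 7, so
  -- its primitive part e inherits these pairings.
  have he : (49 ^ n : ℤ) • e₂ + (4 : ℤ) • e₇ ∈ M := add_mem (zsmul_mem he₂ _) (zsmul_mem he₇ _)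
  obtain ⟨x, y, e, g, ht', hge⟩ := ht.exists_of_mem he
  have heM : e ∈ M := ht'.1 ▸ Submodule.subset_span (by simp)
  have hg2 : g % 2 ≠ 0 := by
    intro h0
    obtain ⟨g', rfl⟩ : (2 : ℤ) ∣ g := by omega
    refine hp₂ (g' • e - (2 : ℤ) • e₇ - s • e₂)
      (sub_mem (sub_mem (zsmul_mem heM _) (zsmul_mem he₇ _)) (zsmul_mem he₂ _)) ?_
    rw [hs] at hge
    linear_combination (exp := 1) hge
  have hg7 : g % 7 ≠ 0 := by
    intro h0
    obtain ⟨g', rfl⟩ : (7 : ℤ) ∣ g := by omega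
    refine hp₇ ((2 * g') • e - (2 * t) • e₂ - e₇)
      (sub_mem (sub_mem (zsmul_mem heM _) (zsmul_mem he₂ _)) he₇) ?_
    rw [hst] at hge
    linear_combination (exp := 1) (2 : ℤ) • hge
  have hcop := isCoprime_pow_of_mod n hg2 hg7
  have hBe : ∀ m ∈ M, ∃ k : ℤ, diagB e m = 2 * 49 ^ n * k := by
    intro m hm
    obtain ⟨k, hk⟩ := h.integral e heM m hm
    obtain ⟨i, hi⟩ := hB₂ m hm
    obtain ⟨j, hj⟩ := hB₇ m hm
    have h1 : g * k = 2 * 49 ^ n * (i + 2 * j) := by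
      have h2 := congrArg (fun v => diagB v m) hge
      simp only [diagB_add_left, diagB_zsmul_left, hi, hj, hk] at h2
      have : ((g * k : ℤ) : ℚ) = ((2 * 49 ^ n * (i + 2 * j) : ℤ) : ℚ) := by
        push_cast at h2 ⊢; linarith
      exact_mod_cast this
    obtain ⟨l, hl⟩ := hcop.dvd_of_dvd_mul_left ⟨_, h1⟩
    exact ⟨l, by rw [hk, hl]; push_cast; ring⟩
  obtain ⟨r, hr⟩ := hBe e heM
  obtain ⟨j, hj⟩ := hB₇ e₂ he₂
  have hr2 : 2 * (49 ^ n * (49 ^ n * k₂ + 2 * 49 ^ n * j + 4 * (24 + 7 * k₇))) =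
      49 ^ n * g ^ 2 * r := by
    have h2 := congrArg diagQ hge
    rw [diagQ_add, diagQ_zsmul, diagQ_zsmul, diagQ_zsmul, diagB_zsmul_left, diagB_zsmul_right,
      diagB_comm e₂ e₇, hk₂, hk₇, hj, ← diagB_self e, hr] at h2
    have : ((2 * (49 ^ n * (49 ^ n * k₂ + 2 * 49 ^ n * j + 4 * (24 + 7 * k₇))) : ℤ) : ℚ) =
        ((49 ^ n * g ^ 2 * r : ℤ) : ℚ) := by
      push_cast at h2 ⊢; linarith
    exact_mod_cast this
  have h49 : (49 ^ n : ℤ) ≠ 0 := by positivity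
  have hr3 : 2 * (49 ^ n * k₂ + 2 * 49 ^ n * j + 4 * (24 + 7 * k₇)) = g ^ 2 * r :=
    mul_left_cancel₀ h49 (by linear_combination hr2)
  have hr_even : ∃ r' : ℤ, r = 2 * r' := by
    have h1 : (2 : ℤ) ∣ g ^ 2 * r := ⟨_, hr3.symm⟩
    have h2 : IsCoprime (2 : ℤ) (g ^ 2) := IsCoprime.pow_right hcop.of_mul_left_left
    exact h2.dvd_of_dvd_mul_left h1
  obtain ⟨r', rfl⟩ := hr_even
  -- The residue 5 comes from 4·24 = 96 = 7·13 + 5. It is a nonresidue, hence so is r', the norm of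
  -- w.
  have hr4 : g ^ 2 * r' = 7 * (t * k₂ + 2 * t * j + 4 * k₇ + 13) + 5 := by
    rw [hst] at hr3
    linarith
  have h7n : (2 * 7 ^ n : ℚ) ≠ 0 := by positivity
  set w : Fin 3 → ℚ := (2 * 7 ^ n : ℚ)⁻¹ • e with hw
  have hwe : (2 * 7 ^ n : ℤ) • w = e := by
    rw [hw, ← Int.cast_smul_eq_zsmul ℚ, smul_smul]
    push_cast
    rw [mul_inv_cancel₀ h7n, one_smul]
  have h49q : (49 : ℚ) ^ n = 7 ^ n * 7 ^ n := by rw [← mul_pow]; norm_num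
  refine ⟨(2 * 7 ^ n)⁻¹ * det3 x₀ y₀ z₀, x, y, w, ?_, ?_, by rw [hwe]; exact ht'.1, ?_, r', ?_, ?_⟩
  · rw [mul_pow, hdet, four_mul_pow, inv_pow, inv_mul_cancel₀ (pow_ne_zero 2 h7n)]
  · rw [← ht'.2, hw]
    simp only [det3, Pi.smul_apply, smul_eq_mul]
    ring
  · intro m hm
    obtain ⟨k, hk⟩ := hBe m hm
    refine ⟨k, ?_⟩
    rw [hw, diagB_smul_left, hk, h49q]
    field_simp
  · rw [hw, diagQ_smul, ← diagB_self e, hr, h49q]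
    push_cast
    field_simp
  · have h1 : (g ^ 2 * r') % 7 = 5 := by rw [hr4]; omega
    have h2 : g % 7 = 1 ∨ g % 7 = 2 ∨ g % 7 = 3 ∨ g % 7 = 4 ∨ g % 7 = 5 ∨ g % 7 = 6 := by omega
    have h3 : r' % 7 = 0 ∨ r' % 7 = 1 ∨ r' % 7 = 2 ∨ r' % 7 = 3 ∨ r' % 7 = 4 ∨ r' % 7 = 5 ∨
      r' % 7 = 6 := by omega
    rw [Int.mul_emod, pow_two, Int.mul_emod g g] at h1
    rcases h2 with h2 | h2 | h2 | h2 | h2 | h2 <;>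
      rcases h3 with h3 | h3 | h3 | h3 | h3 | h3 | h3 <;> rw [h2, h3] at h1 <;> omega

end overlattice

/-! ### Every lattice of the genus is a congruence sublattice of E. -/

section frame

/-- The linear map that sends the standard basis to `x, y, z`. -/
def frameMap (x y z : Fin 3 → ℚ) : (Fin 3 → ℚ) →ₗ[ℚ] (Fin 3 → ℚ) where
  toFun v := v 0 • x + v 1 • y + v 2 • z
  map_add' u v := by simp only [Pi.add_apply]; module
  map_smul' c v := by simp only [Pi.smul_apply, smul_eq_mul, RingHom.id_apply]; module

theorem frameMap_apply (x y z v : Fin 3 → ℚ) :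
    frameMap x y z v = v 0 • x + v 1 • y + v 2 • z := rfl

theorem frameMap_intVec (x y z : Fin 3 → ℚ) (a : Fin 3 → ℤ) :
    frameMap x y z (intVec a) = a 0 • x + a 1 • y + a 2 • z := by
  rw [frameMap_apply]
  simp only [intVec, Int.cast_smul_eq_zsmul]

theorem exists_orthogonal_of_frame {x y z : Fin 3 → ℚ} (h : HasGram x y z 1 0 0 1 0 6) :
    ∃ τ ∈ orthogonalGroup (diagForm ℚ), ∀ a : Fin 3 → ℤ,
      τ (intVec a) = a 0 • x + a 1 • y + a 2 • z := by
  have hQ : ∀ v, diagQ (frameMap x y z v) = diagQ v := by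
    intro v
    rw [← diagB_self, frameMap_apply]
    simp only [diagB_add_left, diagB_add_right, diagB_smul_left, diagB_smul_right,
      diagB_comm y x, diagB_comm z x, diagB_comm z y, h.xx, h.xy, h.xz, h.yy, h.yz, h.zz, diagQ]
    push_cast
    ring
  have hinj : Function.Injective (frameMap x y z) := by
    rw [injective_iff_map_eq_zero]
    intro v hv
    apply eq_zero_of_diagQ_eq_zero
    rw [← hQ, hv]
    simp [diagQ]
  refine ⟨LinearEquiv.ofInjectiveEndo _ hinj, fun v => ?_, fun a => ?_⟩
  · rw [diagForm_apply, diagForm_apply]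
    exact hQ v
  · exact frameMap_intVec x y z a

end frame

theorem diagQ_mod_four {a : Fin 3 → ℤ} (h : Odd (a 0 + a 1)) (h2 : Even (a 2)) :
    ∃ k, diagQ a = 4 * k + 1 := by
  obtain ⟨t, ht⟩ := h2
  rcases Int.even_or_odd (a 0) with ⟨s, hs⟩ | ⟨s, hs⟩
  · obtain ⟨u, hu⟩ : Odd (a 1) := by
      rw [Int.odd_add] at h
      exact Int.not_even_iff_odd.1 fun h1 => Int.not_even_iff_odd.2 (h.2 h1) ⟨s, hs⟩
    exact ⟨s * s + u * u + u + 6 * t * t, by simp only [diagQ, hs, hu, ht]; ring⟩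
  · obtain ⟨u, hu⟩ : Even (a 1) := (Int.odd_add.1 h).1 ⟨s, hs⟩
    exact ⟨s * s + s + u * u + 6 * t * t, by simp only [diagQ, hs, hu, ht]; ring⟩

/-- Every lattice in the genus is isometric to one of the lattices `perpLattice n w`. -/
theorem exists_isometric_perpLattice {n : ℕ} {M : Submodule ℤ (Fin 3 → ℚ)} (hn : 1 ≤ n)
    (h : GenusProperties n M) : ∃ w : Fin 3 → ℤ,
      (diagQ w % 7 = 3 ∨ diagQ w % 7 = 5 ∨ diagQ w % 7 = 6) ∧
      Isometric (diagForm ℚ) (perpLattice n (modVec (7 ^ n) w)) M := by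
  obtain ⟨D, x, y, w, hD, hdet, hM, hBw, r, hr, hr7⟩ := exists_overlattice hn h
  set L := Submodule.span ℤ {x, y, w}
  have ht : IsTriple L D x y w := ⟨rfl, hdet⟩
  have hML : ∀ {m}, m ∈ M → m ∈ L := by
    intro m hm
    rw [hM] at hm
    obtain ⟨i, j, k, rfl⟩ := Submodule.mem_span_triple.1 hm
    exact ht.mem_iff.2 ⟨i, j, k * (2 * 7 ^ n), by module⟩
  have hqw : (2 * 7 ^ n : ℤ) • w ∈ M := hM ▸ Submodule.subset_span (by simp)
  have hdecomp : ∀ {v}, v ∈ L → ∃ m ∈ M, ∃ k : ℤ, v = m + k • w := by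
    intro v hv
    obtain ⟨i, j, k, rfl⟩ := ht.mem_iff.1 hv
    refine ⟨i • x + j • y, ?_, k, rfl⟩
    have hx : x ∈ M := hM ▸ Submodule.subset_span (by simp)
    have hy : y ∈ M := hM ▸ Submodule.subset_span (by simp)
    exact add_mem (zsmul_mem hx _) (zsmul_mem hy _)
  have hint : ∀ u ∈ L, ∀ v ∈ L, ∃ k : ℤ, diagB u v = k := by
    intro u hu v hv
    obtain ⟨m, hm, k, rfl⟩ := hdecomp hu
    obtain ⟨m', hm', k', rfl⟩ := hdecomp hv
    obtain ⟨i, hi⟩ := h.integral m hm m' hm'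
    obtain ⟨j, hj⟩ := hBw m hm
    obtain ⟨j', hj'⟩ := hBw m' hm'
    refine ⟨i + k' * (7 ^ n * j) + k * (7 ^ n * j') + k * k' * r, ?_⟩
    rw [diagB_add_left, diagB_add_right, diagB_add_right, diagB_zsmul_left, diagB_zsmul_left,
      diagB_zsmul_right, diagB_zsmul_right, diagB_comm m w, hi, hj, hj', diagB_self, hr]
    push_cast
    ring
  have hmulM : ∀ {v}, v ∈ L → (2 * 7 ^ n : ℤ) • v ∈ M := by
    intro v hv
    obtain ⟨m, hm, k, rfl⟩ := hdecomp hv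
    rw [smul_add, smul_comm]
    exact add_mem (zsmul_mem hm _) (zsmul_mem hqw _)
  obtain ⟨D', f₁, f₂, f₃, a, b, c, d, e, f, hD', ht', hg, hcase⟩ := exists_reduced hint ht hD
  have hgram : HasGram f₁ f₂ f₃ 1 0 0 1 0 6 := by
    rcases hcase with ⟨rfl, rfl, rfl, rfl, ⟨rfl, rfl⟩ | ⟨rfl, rfl⟩⟩ | ⟨⟨a, rfl⟩, ⟨d, rfl⟩, ⟨f, rfl⟩⟩
    · exact hg
    -- The form diag(1,2,3) has a vector of norm 3 with pairing 1. Scaling by 2·7ⁿ, prime to 3,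
    -- moves it into M against property `three`.
    · exfalso
      have h1 : f₁ ∈ L := ht'.mem_iff.2 ⟨1, 0, 0, by module⟩
      have h2 : f₁ + f₂ ∈ L := ht'.mem_iff.2 ⟨1, 1, 0, by module⟩
      have h3 : diagQ (f₁ + f₂) = 3 := by
        rw [diagQ_add, ← diagB_self, ← diagB_self, hg.xx, hg.xy, hg.yy]; norm_num
      have h4 : diagB (f₁ + f₂) f₁ = 1 := by
        rw [diagB_add_left, diagB_comm f₂, hg.xx, hg.xy]; norm_num
      obtain ⟨l, hl⟩ := h.three _ (hmulM h2) ((2 * 7 ^ n) ^ 2) (by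
        rw [diagQ_zsmul, h3]; push_cast; ring) _ (hmulM h1)
      rw [diagB_zsmul_left, diagB_zsmul_right, h4] at hl
      have h5 : (2 * 7 ^ n : ℤ) ^ 2 = 3 * l := by
        have : (((2 * 7 ^ n : ℤ) ^ 2 : ℤ) : ℚ) = ((3 * l : ℤ) : ℚ) := by
          push_cast at hl ⊢; linarith
        exact_mod_cast this
      have h6 : Prime (3 : ℤ) := Int.prime_three
      have h7 := h6.dvd_of_dvd_pow ⟨l, h5⟩
      rcases h6.dvd_or_dvd h7 with h8 | h8
      · omega
      · have := h6.dvd_of_dvd_pow h8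
        omega
    · exfalso
      obtain ⟨v, hv, k, hk⟩ := h.odd
      obtain ⟨i, j, l, rfl⟩ := ht'.mem_iff.1 (hML hv)
      rw [← diagB_self, hg.diagB_comb] at hk
      have : i * i * (a + a) + j * j * (d + d) + l * l * (f + f) + (i * j + j * i) * b +
          (i * l + l * i) * c + (j * l + l * j) * e = 2 * k + 1 := by exact_mod_cast hk
      have h2 : 2 * (i * i * a + j * j * d + l * l * f + i * j * b + i * l * c + j * l * e) =
          2 * k + 1 := by linarith
      omega
  obtain ⟨τ, hτ, hτa⟩ := exists_orthogonal_of_frame hgram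
  have hτB : ∀ u v, diagB (τ u) (τ v) = diagB u v := by
    apply diagB_map_of_diagQ
    intro v
    simpa only [diagForm_apply] using hτ v
  have hcoord : ∀ {v}, v ∈ L → ∃ a, τ (intVec a) = v := by
    intro v hv
    obtain ⟨i, j, k, rfl⟩ := ht'.mem_iff.1 hv
    exact ⟨![i, j, k], by rw [hτa]; rfl⟩
  have hmemL : ∀ a, τ (intVec a) ∈ L := fun a => by rw [hτa]; exact ht'.mem_iff.2 ⟨_, _, _, rfl⟩
  have hwL : w ∈ L := Submodule.subset_span (by simp)
  obtain ⟨w₀, rfl⟩ := hcoord hwL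
  have hQτ : ∀ a, diagQ (τ (intVec a)) = (diagQ a : ℤ) := fun a => by
    rw [← diagB_self, hτB, diagB_self, diagQ_intVec]
  have hr' : diagQ w₀ = r := by
    rw [hQτ] at hr
    exact_mod_cast hr
  -- Otherwise the norm would be 1 modulo 4, against property `four`.
  have hnot : ∀ a : Fin 3 → ℤ, τ (intVec a) ∈ M → Odd (a 0 + a 1) → Odd (a 2) := by
    intro a ha hodd
    by_contra heven
    obtain ⟨k, hk⟩ := diagQ_mod_four hodd (Int.not_odd_iff_even.1 heven)
    exact h.four _ ha k (by rw [hQτ, hk]; push_cast; rfl)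
  -- A vector b of odd norm in M has b₀ + b₁ and b₂ odd. If a vector a of M had odd coordinate sum,
  -- then a₀ + a₁ would be even and a₂ odd, and a + b would violate `hnot`.
  have heven : ∀ a : Fin 3 → ℤ, τ (intVec a) ∈ M → Even (a 0 + a 1 + a 2) := by
    intro a ha
    obtain ⟨v, hv, k, hk⟩ := h.odd
    obtain ⟨b, rfl⟩ := hcoord (hML hv)
    have hb : Odd (b 0 + b 1) := by
      have h1 : diagQ b = 2 * k + 1 := by
        rw [hQτ] at hk; exact_mod_cast hk
      have h2 : Odd ((b 0 + b 1) ^ 2) := ⟨k - 3 * b 2 ^ 2 + b 0 * b 1, by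
        simp only [diagQ] at h1; linear_combination h1⟩
      exact (Int.odd_pow' two_ne_zero).1 h2
    have hb2 := hnot b hv hb
    by_contra hne
    rw [Int.not_even_iff_odd] at hne
    have ha0 : Even (a 0 + a 1) := by
      by_contra h1
      rw [Int.not_even_iff_odd] at h1
      exact Int.not_even_iff_odd.2 hne (h1.add_odd (hnot a ha h1))
    have ha2 : Odd (a 2) := by
      rw [add_comm] at hne
      exact (Int.odd_add.1 hne).2 ha0
    have hab : τ (intVec (a + b)) ∈ M := by
      rw [intVec_add, map_add]; exact add_mem ha hv
    have h1 := hnot _ hab (by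
      have := ha0.add_odd hb
      simpa only [Pi.add_apply, add_add_add_comm] using this)
    exact Int.not_even_iff_odd.2 h1 (ha2.add_odd hb2)
  refine ⟨w₀, by rw [hr']; exact hr7, τ, hτ, ?_⟩
  ext v
  constructor
  · intro hv
    obtain ⟨v, ⟨a, ha, ha', rfl⟩, rfl⟩ := mem_image.1 hv
    obtain ⟨m, hm, k, hk⟩ := hdecomp (hmemL a)
    obtain ⟨c, rfl⟩ := hcoord (hML hm)
    have hack : a = c + k • w₀ := by
      apply intVec_injective
      apply τ.injective
      rw [hk, intVec_add, intVec_smul, map_add, map_zsmul]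
    -- Pairing a = c + k·w₀ with w₀ kills the other terms modulo 7ⁿ, leaving k·r with r prime to 7.
    have hk7 : (7 : ℤ) ^ n ∣ k := by
      rw [diagB_modVec, ZMod.intCast_zmod_eq_zero_iff_dvd] at ha'
      obtain ⟨j, hj⟩ := hBw _ hm
      rw [hτB, diagB_comm, diagB_intVec] at hj
      have hj' : diagB c w₀ = 7 ^ n * j := by exact_mod_cast hj
      rw [hack, diagB_add_left, diagB_zsmul_left, diagB_self, hr', hj'] at ha'
      have h1 : (7 : ℤ) ^ n ∣ k * r := by
        push_cast at ha'
        simpa using (dvd_add_right (Dvd.intro _ rfl)).1 ha'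
      have h2 : IsCoprime (7 : ℤ) r := by
        have h7 : Prime (7 : ℤ) := by norm_num
        exact (h7.coprime_iff_not_dvd).2 (by omega)
      exact (h2.pow_left).dvd_of_dvd_mul_right h1
    obtain ⟨k', rfl⟩ := hk7
    rw [hk]
    refine add_mem hm ?_
    rcases Int.even_or_odd k' with ⟨l, rfl⟩ | hodd
    · have h1 : ((7 : ℤ) ^ n * (l + l)) • τ (intVec w₀) = l • (2 * 7 ^ n : ℤ) • τ (intVec w₀) := by
        module
      rw [h1]
      exact zsmul_mem hqw _
    -- If k/7ⁿ were odd, w₀ would have even coordinate sum. Then so would all of M + ℤw, yet this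
    -- overlattice contains the image of (1,0,0).
    · exfalso
      have hkodd : Odd ((7 : ℤ) ^ n * k') := Odd.mul (Odd.pow (by decide)) hodd
      have hsum : ∀ (c : Fin 3 → ℤ) (l : ℤ), (c + l • w₀) 0 + (c + l • w₀) 1 + (c + l • w₀) 2 =
          (c 0 + c 1 + c 2) + l * (w₀ 0 + w₀ 1 + w₀ 2) := fun c l => by
        simp only [Pi.add_apply, Pi.smul_apply, smul_eq_mul]; ring
      have hw0 : Even (w₀ 0 + w₀ 1 + w₀ 2) := by
        rw [hack, hsum, Int.even_add] at ha
        have h1 := ha.1 (heven c hm)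
        rw [Int.even_mul] at h1
        exact h1.resolve_left (Int.not_even_iff_odd.2 hkodd)
      obtain ⟨m', hm', l, hl⟩ := hdecomp (hmemL ![1, 0, 0])
      obtain ⟨c', rfl⟩ := hcoord (hML hm')
      have hack' : ![1, 0, 0] = c' + l • w₀ := by
        apply intVec_injective
        apply τ.injective
        rw [hl, intVec_add, intVec_smul, map_add, map_zsmul]
      have h2 := hsum c' l
      rw [← hack'] at h2
      have h3 : Even ((c' 0 + c' 1 + c' 2) + l * (w₀ 0 + w₀ 1 + w₀ 2)) :=
        (heven c' hm').add (hw0.mul_left l)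
      rw [← h2] at h3
      simp at h3
  · intro hv
    obtain ⟨a, rfl⟩ := hcoord (hML hv)
    refine apply_mem_image (intVec_mem_perpLattice.2 ⟨heven a hv, ?_⟩)
    obtain ⟨k, hk⟩ := hBw _ hv
    rw [hτB, diagB_comm, diagB_intVec] at hk
    have hk' : diagB a w₀ = 7 ^ n * k := by exact_mod_cast hk
    rw [diagB_modVec, hk', ZMod.intCast_zmod_eq_zero_iff_dvd]
    push_cast
    exact Dvd.intro _ rfl

/-! ### The congruence sublattices lie in the genus. -/

theorem perpLattice_fg (n : ℕ) (w : Fin 3 → ZMod (7 ^ n)) : (perpLattice n w).FG := by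
  have h : perpLattice n w ≤ stdLattice := by
    rintro _ ⟨a, -, -, rfl⟩
    exact mem_stdLattice.2 ⟨a, rfl⟩
  exact stdLattice_isLattice.fg.of_le h

theorem smul_mem_perpLattice {n : ℕ} (w : Fin 3 → ZMod (7 ^ n)) {a : Fin 3 → ℤ}
    (ha : Even (a 0 + a 1 + a 2)) : (7 ^ n : ℤ) • intVec a ∈ perpLattice n w := by
  rw [← intVec_smul, intVec_mem_perpLattice]
  refine ⟨?_, ?_⟩
  · simpa only [Pi.smul_apply, smul_eq_mul, mul_add] using ha.mul_left (7 ^ n)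
  · rw [modVec_smul, diagB_zsmul_left]
    have : ((7 ^ n : ℤ) : ZMod (7 ^ n)) = 0 := by
      rw [ZMod.intCast_zmod_eq_zero_iff_dvd]; push_cast; rfl
    rw [this, zero_mul]

theorem perpLattice_isLattice (n : ℕ) (w : Fin 3 → ZMod (7 ^ n)) :
    (perpLattice n w).IsLattice ℚ := by
  have h7 : (7 ^ n * 2 : ℚ) ≠ 0 := by positivity
  have h1 := isLattice_image (LinearEquiv.smulOfNeZero ℚ (Fin 3 → ℚ) (7 ^ n * 2) h7)
    stdLattice_isLattice
  refine Submodule.IsLattice.of_le_of_isLattice_of_fg ℚ (M := image (LinearEquiv.smulOfNeZero ℚ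
    (Fin 3 → ℚ) (7 ^ n * 2) h7) stdLattice) ?_ (perpLattice_fg n w)
  intro x hx
  obtain ⟨y, hy, rfl⟩ := mem_image.1 hx
  obtain ⟨a, rfl⟩ := mem_stdLattice.1 hy
  have h2 := smul_mem_perpLattice w (a := (2 : ℤ) • a)
    ⟨a 0 + a 1 + a 2, by simp only [Pi.smul_apply, smul_eq_mul]; ring⟩
  rw [intVec_smul, smul_smul, ← Int.cast_smul_eq_zsmul ℚ] at h2
  push_cast at h2
  exact h2

/-- The index divides a power of 7ⁿ, which is a unit in ℤ_p for p ≠ 7. -/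
theorem localLattice_eq_of_le {p n : ℕ} [Fact p.Prime] (hp : p ≠ 7)
    {A B : Submodule ℤ (Fin 3 → ℚ)} (hAB : A ≤ B) (hBA : ∀ x ∈ B, (7 ^ n : ℤ) • x ∈ A) :
    localLattice p A = localLattice p B := by
  apply le_antisymm
  · exact Submodule.span_mono (Set.image_mono hAB)
  · rw [localLattice, Submodule.span_le]
    rintro _ ⟨x, hx, rfl⟩
    have h1 : castVec p ((7 ^ n : ℤ) • x) ∈ localLattice p A := castVec_mem_localLattice (hBA x hx)
    rw [castVec_zsmul] at h1
    have hu : IsUnit (((7 ^ n : ℤ) : ℤ_[p])) := by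
      rw [PadicInt.isUnit_iff, PadicInt.norm_intCast_eq_one_iff]
      have h7 : Nat.Coprime 7 p :=
        (Nat.coprime_primes (by norm_num) Fact.out).2 hp.symm
      exact_mod_cast Nat.isCoprime_iff_coprime.2 (Nat.Coprime.pow_left n h7)
    obtain ⟨u, hu⟩ := hu
    rw [← hu] at h1
    have h2 := Submodule.smul_mem _ ((u⁻¹ : ℤ_[p]ˣ) : ℤ_[p]) h1
    rwa [smul_smul, Units.inv_mul, one_smul] at h2

theorem locallyIsometric_of_ne_seven {p n : ℕ} [Fact p.Prime] (hp : p ≠ 7)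
    (w : Fin 3 → ZMod (7 ^ n)) : LocallyIsometric p (stdPerp n) (perpLattice n w) := by
  have h : ∀ w, localLattice p (perpLattice n w) = localLattice p evenLattice := fun w =>
    localLattice_eq_of_le hp (perpLattice_le n w) (by
      rintro _ ⟨a, ha, rfl⟩
      exact smul_mem_perpLattice w ha)
  refine ⟨LinearEquiv.refl _ _, fun x => rfl, ?_⟩
  rw [stdPerp, h, h]
  exact image_one _

section seven

variable {n : ℕ}

/-- The integral vector `w` as a `7`-adic vector. -/
def padicVec (w : Fin 3 → ℤ) : Fin 3 → ℤ_[7] := fun i => (w i : ℤ_[7])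

theorem diagB_padicVec (a b : Fin 3 → ℤ) :
    diagB (padicVec a) (padicVec b) = (diagB a b : ℤ) := by
  simp [diagB, padicVec]

theorem isUnit_intCast_seven {k : ℤ} (hk : k % 7 ≠ 0) : IsUnit (k : ℤ_[7]) := by
  rw [PadicInt.isUnit_iff, PadicInt.norm_intCast_eq_one_iff]
  have h7 : Prime (7 : ℤ) := by norm_num
  exact ((h7.coprime_iff_not_dvd).2 (by omega)).symm

/-- The parity condition disappears at 7: 2c satisfies it and 2 is a unit of ℤ₇. -/
theorem castVec_mem_localLattice_perp {w c : Fin 3 → ℤ} (hc : (7 : ℤ) ^ n ∣ diagB c w) :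
    coeVec (padicVec c) ∈ localLattice 7 (perpLattice n (modVec (7 ^ n) w)) := by
  have h1 : intVec ((2 : ℤ) • c) ∈ perpLattice n (modVec (7 ^ n) w) := by
    rw [intVec_mem_perpLattice]
    refine ⟨⟨c 0 + c 1 + c 2, by simp only [Pi.smul_apply, smul_eq_mul]; ring⟩, ?_⟩
    rw [diagB_modVec, ZMod.intCast_zmod_eq_zero_iff_dvd, diagB_zsmul_left]
    push_cast
    exact Dvd.dvd.mul_left hc 2
  have h2 := castVec_mem_localLattice (p := 7) h1
  rw [intVec_smul, castVec_zsmul, castVec_intVec] at h2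
  obtain ⟨u, hu⟩ := isUnit_intCast_seven (k := 2) (by norm_num)
  rw [← hu] at h2
  have h3 := Submodule.smul_mem _ ((u⁻¹ : ℤ_[7]ˣ) : ℤ_[7]) h2
  rwa [smul_smul, Units.inv_mul, one_smul] at h3

theorem coeVec_mem_localLattice_perp {w : Fin 3 → ℤ} {a : Fin 3 → ℤ_[7]}
    (ha : (7 : ℤ_[7]) ^ n ∣ diagB a (padicVec w)) :
    coeVec a ∈ localLattice 7 (perpLattice n (modVec (7 ^ n) w)) := by
  have h1 : ∀ i, ∃ (c : ℤ) (d : ℤ_[7]), a i = c + 7 ^ n * d := by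
    intro i
    obtain ⟨d, hd⟩ := Ideal.mem_span_singleton'.1 (PadicInt.appr_spec n (a i))
    refine ⟨(a i).appr n, d, ?_⟩
    push_cast at hd ⊢
    linear_combination -hd
  choose c d hcd using h1
  have hc : (7 : ℤ) ^ n ∣ diagB c w := by
    have h2 : ((7 : ℕ) : ℤ_[7]) ^ n ∣ (diagB c w : ℤ) := by
      rw [← diagB_padicVec]
      have h3 : diagB (padicVec c) (padicVec w) =
          diagB a (padicVec w) - 7 ^ n * diagB d (padicVec w) := by
        simp only [diagB, hcd, padicVec]; ring
      rw [h3]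
      push_cast
      exact dvd_sub ha (Dvd.intro _ rfl)
    exact_mod_cast dvd_of_padicInt_dvd h2
  have hE : ∀ e : Fin 3 → ℤ, coeVec (padicVec ((7 ^ n : ℤ) • e)) ∈
      localLattice 7 (perpLattice n (modVec (7 ^ n) w)) := fun e =>
    castVec_mem_localLattice_perp (by rw [diagB_zsmul_left]; exact Dvd.intro _ rfl)
  have h4 : a = padicVec c + (d 0 • padicVec ((7 ^ n : ℤ) • ![1, 0, 0]) +
      d 1 • padicVec ((7 ^ n : ℤ) • ![0, 1, 0]) + d 2 • padicVec ((7 ^ n : ℤ) • ![0, 0, 1])) := by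
    ext i
    fin_cases i <;> simp [hcd, padicVec] <;> ring
  rw [h4]
  simp only [coeVec_add, coeVec_smul]
  exact add_mem (castVec_mem_localLattice_perp hc) (add_mem (add_mem
    (Submodule.smul_mem _ _ (hE _)) (Submodule.smul_mem _ _ (hE _)))
    (Submodule.smul_mem _ _ (hE _)))

theorem mem_localLattice_perp {w : Fin 3 → ℤ} {x : Fin 3 → ℚ_[7]} :
    x ∈ localLattice 7 (perpLattice n (modVec (7 ^ n) w)) ↔
      ∃ a, (7 : ℤ_[7]) ^ n ∣ diagB a (padicVec w) ∧ coeVec a = x := by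
  constructor
  · intro hx
    induction hx using Submodule.span_induction with
    | mem y h =>
      obtain ⟨x, ⟨a, -, ha, rfl⟩, rfl⟩ := h
      refine ⟨padicVec a, ?_, (castVec_intVec a).symm⟩
      rw [diagB_padicVec]
      rw [diagB_modVec, ZMod.intCast_zmod_eq_zero_iff_dvd] at ha
      obtain ⟨k, hk⟩ := ha
      exact ⟨k, by rw [hk]; push_cast; rfl⟩
    | zero => exact ⟨0, by simp [diagB], by ext; simp [coeVec]⟩
    | add y z _ _ hy hz =>
      obtain ⟨a, h1, rfl⟩ := hy
      obtain ⟨b, h3, rfl⟩ := hz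
      exact ⟨a + b, by rw [diagB_add_left]; exact dvd_add h1 h3, coeVec_add a b⟩
    | smul c y _ hy =>
      obtain ⟨a, h1, rfl⟩ := hy
      exact ⟨c • a, by rw [diagB_smul_left]; exact h1.mul_left c, coeVec_smul c a⟩
  · rintro ⟨a, ha, rfl⟩
    exact coeVec_mem_localLattice_perp ha

/-- Both r and 6 are nonresidues, so 6r is a square modulo 7 and lifts to a 7-adic square; dividing
its root by r gives l. This normalizes w to norm 6 without changing its line. -/
theorem exists_padic_sqrt {r : ℤ} (hr : r % 7 = 3 ∨ r % 7 = 5 ∨ r % 7 = 6) :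
    ∃ l : ℤ_[7], l ^ 2 * r = 6 ∧ IsUnit l := by
  obtain ⟨a, ha, ha7⟩ : ∃ a : ℤ, (7 : ℤ) ∣ a ^ 2 - 6 * r ∧ a % 7 ≠ 0 := by
    rcases hr with h | h | h
    · exact ⟨2, by omega, by norm_num⟩
    · exact ⟨3, by omega, by norm_num⟩
    · exact ⟨1, by omega, by norm_num⟩
  have hru : IsUnit (r : ℤ_[7]) := isUnit_intCast_seven (by omega)
  obtain ⟨u, hu⟩ := hru
  have h2a : ‖((2 * a : ℤ) : ℤ_[7])‖ = 1 :=
    PadicInt.isUnit_iff.1 (isUnit_intCast_seven (by omega))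
  set F : Polynomial ℤ_[7] := Polynomial.X ^ 2 - Polynomial.C (6 * (r : ℤ_[7])) with hF
  have hder : F.derivative.aeval (a : ℤ_[7]) = ((2 * a : ℤ) : ℤ_[7]) := by
    simp [hF, one_add_one_eq_two]
  have hval : F.aeval (a : ℤ_[7]) = ((a ^ 2 - 6 * r : ℤ) : ℤ_[7]) := by
    simp [hF]
  obtain ⟨y, hy, -⟩ := hensels_lemma (F := F) (a := (a : ℤ_[7])) (by
    rw [hder, hval, h2a, one_pow, PadicInt.norm_int_lt_one_iff_dvd]
    exact_mod_cast ha)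
  have hy2 : y ^ 2 = 6 * r := by
    simpa [hF, sub_eq_zero] using hy
  have h6 : IsUnit (6 : ℤ_[7]) := by
    have := isUnit_intCast_seven (k := 6) (by norm_num)
    simpa using this
  have hl : (y * (u⁻¹ : ℤ_[7]ˣ)) ^ 2 * r = 6 := by
    rw [mul_pow, hy2, ← hu]
    have := u.inv_mul
    linear_combination (6 * ((u⁻¹ : ℤ_[7]ˣ) : ℤ_[7]) * u + 6) * this
  refine ⟨_, hl, ?_⟩
  rw [← hl] at h6
  exact (isUnit_pow_iff two_ne_zero).1 (isUnit_of_mul_isUnit_left h6)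

end seven

section reflection

variable {R : Type*} [CommRing R]

/-- The reflection in the vector `v` of norm `u⁻¹`. -/
def reflect (u : R) (v x : Fin 3 → R) : Fin 3 → R := x - (2 * u * diagB x v) • v

theorem diagB_reflect {u : R} {v : Fin 3 → R} (h : u * diagQ v = 1) (x y : Fin 3 → R) :
    diagB (reflect u v x) (reflect u v y) = diagB x y := by
  simp only [reflect, diagB_sub_left, diagB_sub_right, diagB_smul_left, diagB_smul_right,
    diagB_comm v y, diagB_self]
  linear_combination (4 * u * diagB x v * diagB y v) * h

theorem reflect_reflect {u : R} {v : Fin 3 → R} (h : u * diagQ v = 1) (x : Fin 3 → R) :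
    reflect u v (reflect u v x) = x := by
  have h1 : diagB (reflect u v x) v = -diagB x v := by
    simp only [reflect, diagB_sub_left, diagB_smul_left, diagB_self]
    linear_combination (-2 * diagB x v) * h
  rw [reflect, h1, reflect]
  module

theorem reflect_eq {u : R} {x y : Fin 3 → R} (hxy : diagQ x = diagQ y)
    (h : u * diagQ (y - x) = 1) : reflect u (y - x) x = y := by
  have h1 : diagQ (y - x) = -2 * diagB x (y - x) := by
    simp only [diagQ, diagB, Pi.sub_apply] at hxy ⊢
    linear_combination -hxy
  have h2 : 2 * u * diagB x (y - x) = -1 := by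
    rw [h1] at h; linear_combination -h
  rw [reflect, h2]
  module

theorem coeVec_reflect {p : ℕ} [Fact p.Prime] (u : ℤ_[p]) (v x : Fin 3 → ℤ_[p]) :
    coeVec (reflect u v x) = reflect (u : ℚ_[p]) (coeVec v) (coeVec x) := by
  rw [reflect, reflect, diagB_coeVec]
  ext i
  simp [coeVec]
  left; left; left; rfl

/-- The reflection as a linear automorphism. -/
def reflectEquiv {S : Type*} [Field S] (u : S) (v : Fin 3 → S) (h : u * diagQ v = 1) :
    (Fin 3 → S) ≃ₗ[S] (Fin 3 → S) :=
  LinearEquiv.ofInvolutive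
    { toFun := reflect u v
      map_add' := fun x y => by simp only [reflect, diagB_add_left]; module
      map_smul' := fun c x => by
        simp only [reflect, diagB_smul_left, RingHom.id_apply]; module }
    (reflect_reflect h)

end reflection

/-- After rescaling, w₁ and e = (0,0,1) both have norm 6. The reflection in w₁ - εe with ε = ±1 maps
εe to w₁; when this vector has unit norm the reflection preserves ℤ₇³ and matches the two
congruences. -/
theorem locallyIsometric_seven {n : ℕ} {w : Fin 3 → ℤ}
    (hw : diagQ w % 7 = 3 ∨ diagQ w % 7 = 5 ∨ diagQ w % 7 = 6) :
    LocallyIsometric 7 (stdPerp n) (perpLattice n (modVec (7 ^ n) w)) := by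
  obtain ⟨l, hl, hlu⟩ := exists_padic_sqrt hw
  set e : Fin 3 → ℤ_[7] := padicVec ![0, 0, 1]
  set w₁ : Fin 3 → ℤ_[7] := l • padicVec w
  have hstd : stdPerp n = perpLattice n (modVec (7 ^ n) ![0, 0, 1]) := by
    rw [stdPerp]
    congr 1
    ext i; fin_cases i <;> simp [modVec]
  have hQe : diagQ e = 6 := by simp [diagQ, e, padicVec]
  have hQw : diagQ w₁ = 6 := by
    rw [diagQ_smul, ← hl, ← diagB_self, diagB_padicVec, diagB_self]
  obtain ⟨ε, u, hε, hu⟩ : ∃ ε u : ℤ_[7], ε * ε = 1 ∧ u * diagQ (w₁ - ε • e) = 1 := by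
    -- By the parallelogram law this sum is 24, a unit, so one of the two norms is a unit.
    have h1 : IsUnit (diagQ (w₁ - (1 : ℤ_[7]) • e) + diagQ (w₁ - (-1 : ℤ_[7]) • e)) := by
      have h2 : diagQ (w₁ - (1 : ℤ_[7]) • e) + diagQ (w₁ - (-1 : ℤ_[7]) • e) = ((24 : ℤ) : ℤ_[7]) := by
        have h3 : diagQ (w₁ - (1 : ℤ_[7]) • e) + diagQ (w₁ - (-1 : ℤ_[7]) • e) =
            2 * diagQ w₁ + 2 * diagQ e := by
          simp only [diagQ, Pi.sub_apply, Pi.smul_apply, smul_eq_mul]; ring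
        rw [h3, hQe, hQw]; push_cast; norm_num
      rw [h2]
      exact isUnit_intCast_seven (by norm_num)
    rcases IsLocalRing.isUnit_or_isUnit_of_isUnit_add h1 with ⟨u, hu⟩ | ⟨u, hu⟩
    · exact ⟨1, (u⁻¹ : ℤ_[7]ˣ), by ring, by rw [← hu, Units.inv_mul]⟩
    · exact ⟨-1, (u⁻¹ : ℤ_[7]ˣ), by ring, by rw [← hu, Units.inv_mul]⟩
  have hεu : IsUnit ε := IsUnit.of_mul_eq_one _ hε
  have hrefl : reflect u (w₁ - ε • e) (ε • e) = w₁ :=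
    reflect_eq (by rw [diagQ_smul, hQe, hQw, pow_two, hε, one_mul]) hu
  have hu' : (u : ℚ_[7]) * diagQ (coeVec (w₁ - ε • e)) = 1 := by
    rw [diagQ_coeVec, ← PadicInt.coe_mul, hu]; rfl
  have hkey : ∀ a, 7 ^ n ∣ diagB a (padicVec w) ↔
      7 ^ n ∣ diagB (reflect u (w₁ - ε • e) a) e := by
    intro a
    have h1 := diagB_reflect hu (reflect u (w₁ - ε • e) a) (ε • e)
    rw [reflect_reflect hu, hrefl, diagB_smul_right, diagB_smul_right] at h1
    rw [← hlu.dvd_mul_left, h1, hεu.dvd_mul_left]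
  refine ⟨reflectEquiv _ _ hu', fun x => ?_, ?_⟩
  · have := diagB_reflect hu' x x
    rwa [diagB_self, diagB_self] at this
  · rw [hstd]
    ext x
    rw [mem_localLattice_perp, mem_image]
    constructor
    · rintro ⟨y, hy, rfl⟩
      obtain ⟨a, ha, rfl⟩ := mem_localLattice_perp.1 hy
      refine ⟨reflect u (w₁ - ε • e) a, ?_, coeVec_reflect _ _ _⟩
      rw [hkey, reflect_reflect hu]
      exact ha
    · rintro ⟨a, ha, rfl⟩
      refine ⟨coeVec (reflect u (w₁ - ε • e) a), mem_localLattice_perp.2 ⟨_, (hkey a).1 ha, rfl⟩, ?_⟩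
      have := (coeVec_reflect u (w₁ - ε • e) (reflect u (w₁ - ε • e) a)).symm
      rwa [reflect_reflect hu] at this

theorem locallyIsometric_perpLattice {n : ℕ} {w : Fin 3 → ℤ}
    (hw : diagQ w % 7 = 3 ∨ diagQ w % 7 = 5 ∨ diagQ w % 7 = 6) (p : ℕ) [Fact p.Prime] :
    LocallyIsometric p (stdPerp n) (perpLattice n (modVec (7 ^ n) w)) := by
  by_cases hp : p = 7
  · subst hp
    exact locallyIsometric_seven hw
  · exact locallyIsometric_of_ne_seven hp _

/-! ### Admissible vectors modulo 7ⁿ and their lines. -/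

/-- Reduction of a vector modulo `7`. -/
def redVec {n : ℕ} (w : Fin 3 → ZMod (7 ^ n)) : Fin 3 → ZMod 7 := fun i => (w i).cast

/-- The norm of `w` is a quadratic nonresidue modulo `7`. -/
def Admissible {n : ℕ} (w : Fin 3 → ZMod (7 ^ n)) : Prop :=
  diagQ (redVec w) = 3 ∨ diagQ (redVec w) = 5 ∨ diagQ (redVec w) = 6

section residues

variable {n : ℕ}

theorem intCast_eq_zero_iff {k : ℤ} : (k : ZMod (7 ^ n)) = 0 ↔ (7 : ℤ) ^ n ∣ k := by
  rw [ZMod.intCast_zmod_eq_zero_iff_dvd]; push_cast; rfl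

theorem exists_modVec (w : Fin 3 → ZMod (7 ^ n)) : ∃ a : Fin 3 → ℤ, modVec (7 ^ n) a = w := by
  choose a ha using fun i => ZMod.intCast_surjective (w i)
  exact ⟨a, funext ha⟩

theorem exists_even_modVec (w : Fin 3 → ZMod (7 ^ n)) :
    ∃ a : Fin 3 → ℤ, Even (a 0 + a 1 + a 2) ∧ modVec (7 ^ n) a = w := by
  obtain ⟨a, rfl⟩ := exists_modVec w
  rcases Int.even_or_odd (a 0 + a 1 + a 2) with h | h
  · exact ⟨a, h, rfl⟩
  · refine ⟨a + (7 ^ n : ℤ) • (![1, 0, 0] : Fin 3 → ℤ), ?_, ?_⟩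
    · have h7 : Odd ((7 : ℤ) ^ n) := Odd.pow (by decide)
      have h1 : (a + (7 ^ n : ℤ) • (![1, 0, 0] : Fin 3 → ℤ)) 0
          + (a + (7 ^ n : ℤ) • (![1, 0, 0] : Fin 3 → ℤ)) 1
          + (a + (7 ^ n : ℤ) • (![1, 0, 0] : Fin 3 → ℤ)) 2 = (a 0 + a 1 + a 2) + 7 ^ n := by
        simp; ring
      rw [h1]
      exact h.add_odd h7
    · rw [modVec_add, modVec_smul]
      have : ((7 ^ n : ℤ) : ZMod (7 ^ n)) = 0 := intCast_eq_zero_iff.2 dvd_rfl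
      rw [← Int.cast_smul_eq_zsmul (ZMod (7 ^ n)), this, zero_smul, add_zero]

theorem dvd_pow_of_one_le (hn : 1 ≤ n) : 7 ∣ 7 ^ n := dvd_pow_self 7 (by omega)

theorem redVec_modVec (hn : 1 ≤ n) (a : Fin 3 → ℤ) : redVec (modVec (7 ^ n) a) = modVec 7 a := by
  ext i
  simp only [redVec, modVec]
  exact ZMod.cast_intCast (dvd_pow_of_one_le hn) _

theorem diagQ_modVec (m : ℕ) (a : Fin 3 → ℤ) : diagQ (modVec m a) = ((diagQ a : ℤ) : ZMod m) := by
  rw [← diagB_self, diagB_modVec, diagB_self]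

theorem admissible_modVec (hn : 1 ≤ n) {a : Fin 3 → ℤ} : Admissible (modVec (7 ^ n) a) ↔
    (diagQ a % 7 = 3 ∨ diagQ a % 7 = 5 ∨ diagQ a % 7 = 6) := by
  have h : ∀ k : ℤ, ((diagQ a : ℤ) : ZMod 7) = (k : ZMod 7) ↔ diagQ a % 7 = k % 7 := fun k =>
    ZMod.intCast_eq_intCast_iff _ _ _
  rw [Admissible, redVec_modVec hn, diagQ_modVec]
  have h3 := h 3
  have h5 := h 5
  have h6 := h 6
  norm_num at h3 h5 h6
  rw [h3, h5, h6]

theorem isUnit_intCast_iff (hn : 1 ≤ n) {k : ℤ} : IsUnit (k : ZMod (7 ^ n)) ↔ ¬(7 : ℤ) ∣ k := by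
  have h7 : Prime (7 : ℤ) := by norm_num
  rw [← h7.coprime_iff_not_dvd, ZMod.coe_int_isUnit_iff_isCoprime]
  push_cast
  exact IsCoprime.pow_left_iff (by omega)

theorem isUnit_iff_cast (hn : 1 ≤ n) {x : ZMod (7 ^ n)} : IsUnit x ↔ (x.cast : ZMod 7) ≠ 0 := by
  obtain ⟨k, rfl⟩ := ZMod.intCast_surjective x
  rw [isUnit_intCast_iff hn, ZMod.cast_intCast (dvd_pow_of_one_le hn), Ne,
    ZMod.intCast_zmod_eq_zero_iff_dvd]
  rfl

theorem redVec_smul (hn : 1 ≤ n) (c : ZMod (7 ^ n)) (w : Fin 3 → ZMod (7 ^ n)) :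
    redVec (c • w) = (c.cast : ZMod 7) • redVec w := by
  ext i
  simp only [redVec, Pi.smul_apply, smul_eq_mul]
  exact ZMod.cast_mul (dvd_pow_of_one_le hn) _ _

theorem Admissible.ne_zero {w : Fin 3 → ZMod (7 ^ n)} (hw : Admissible w) : redVec w ≠ 0 := by
  intro h
  rw [Admissible, h] at hw
  revert hw
  simp [diagQ]
  decide

theorem Admissible.exists_isUnit (hn : 1 ≤ n) {w : Fin 3 → ZMod (7 ^ n)} (hw : Admissible w) :
    ∃ i, IsUnit (w i) := by
  by_contra h
  push Not at h
  apply hw.ne_zero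
  ext i
  have := h i
  rw [isUnit_iff_cast hn, not_not] at this
  exact this

theorem Admissible.isUnit_diagQ (hn : 1 ≤ n) {w : Fin 3 → ZMod (7 ^ n)} (hw : Admissible w) :
    IsUnit (diagQ w) := by
  obtain ⟨a, rfl⟩ := exists_modVec w
  rw [admissible_modVec hn] at hw
  rw [diagQ_modVec, isUnit_intCast_iff hn]
  omega

theorem Admissible.smul (hn : 1 ≤ n) {w : Fin 3 → ZMod (7 ^ n)} (hw : Admissible w)
    {c : ZMod (7 ^ n)} (hc : IsUnit c) : Admissible (c • w) := by
  rw [isUnit_iff_cast hn] at hc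
  rw [Admissible, redVec_smul hn, diagQ_smul]
  have key : ∀ c q : ZMod 7, c ≠ 0 → (q = 3 ∨ q = 5 ∨ q = 6) →
      (c ^ 2 * q = 3 ∨ c ^ 2 * q = 5 ∨ c ^ 2 * q = 6) := by decide
  exact key _ _ hc hw

/-- Two lattices `perpLattice n w` agree exactly when the vectors are proportional. -/
theorem perpLattice_eq_iff (hn : 1 ≤ n) {w w' : Fin 3 → ZMod (7 ^ n)} (hw : Admissible w)
    (hw' : Admissible w') :
    perpLattice n w = perpLattice n w' ↔ ∃ c : ZMod (7 ^ n), IsUnit c ∧ w' = c • w := by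
  constructor
  · intro h
    have horth : ∀ x, diagB x w = 0 → diagB x w' = 0 := by
      intro x hx
      obtain ⟨a, ha, rfl⟩ := exists_even_modVec x
      have h1 := intVec_mem_perpLattice.2 ⟨ha, hx⟩
      rw [h] at h1
      exact (intVec_mem_perpLattice.1 h1).2
    have h6 := isUnit_six n
    -- Testing on three vectors orthogonal to w shows that all 2×2 minors of (w, w') vanish; a unit
    -- coordinate of w then makes w' a multiple of w.
    have h01 : w 1 * w' 0 = w 0 * w' 1 := by
      have := horth ![w 1, -w 0, 0] (by simp [diagB]; ring)
      simp [diagB] at this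
      linear_combination this
    have h02 : w 2 * w' 0 = w 0 * w' 2 := by
      have := horth ![6 * w 2, 0, -w 0] (by simp [diagB]; ring)
      simp [diagB] at this
      exact h6.mul_left_cancel (by linear_combination this)
    have h12 : w 2 * w' 1 = w 1 * w' 2 := by
      have := horth ![0, 6 * w 2, -w 1] (by simp [diagB]; ring)
      simp [diagB] at this
      exact h6.mul_left_cancel (by linear_combination this)
    have hall : ∀ i j, w i * w' j = w j * w' i := by
      intro i j
      fin_cases i <;> fin_cases j <;> simp [h01, h02, h12]
    obtain ⟨i, ⟨u, hu⟩⟩ := hw.exists_isUnit hn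
    have hwc : w' = (((u⁻¹ : (ZMod (7 ^ n))ˣ) : ZMod (7 ^ n)) * w' i) • w := by
      ext j
      have h1 := hall i j
      rw [← hu] at h1
      simp only [Pi.smul_apply, smul_eq_mul]
      calc w' j = (u⁻¹ : (ZMod (7 ^ n))ˣ) * (u * w' j) := by rw [← mul_assoc, Units.inv_mul, one_mul]
        _ = _ := by rw [h1]; ring
    refine ⟨_, ?_, hwc⟩
    rw [isUnit_iff_cast hn]
    intro h0
    apply hw'.ne_zero
    rw [hwc, redVec_smul hn, h0, zero_smul]
  · rintro ⟨c, hc, rfl⟩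
    ext x
    simp only [mem_perpLattice, diagB_smul_right, hc.mul_right_eq_zero]

end residues

/-! ### Recovering E from a congruence sublattice. -/

section canonical

variable {n : ℕ}

theorem diagB_orthogonal {σ : (Fin 3 → ℚ) ≃ₗ[ℚ] (Fin 3 → ℚ)}
    (hσ : σ ∈ orthogonalGroup (diagForm ℚ)) (x y : Fin 3 → ℚ) :
    diagB (σ x) (σ y) = diagB x y := by
  apply diagB_map_of_diagQ
  intro v
  simpa only [diagForm_apply] using hσ v

/-- Orthogonal projection along w modulo 7ⁿ is available because the norm of w is a unit; the lift a
has even sum, so parity is kept. -/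
theorem exists_decomp (hn : 1 ≤ n) {a : Fin 3 → ℤ} (ha : Even (a 0 + a 1 + a 2))
    (hw : Admissible (modVec (7 ^ n) a)) {x : Fin 3 → ℚ} (hx : x ∈ evenLattice) :
    ∃ m ∈ perpLattice n (modVec (7 ^ n) a), ∃ k : ℤ, x = m + k • intVec a := by
  obtain ⟨b, hb, rfl⟩ := hx
  obtain ⟨u, hu⟩ := hw.isUnit_diagQ hn
  obtain ⟨k, hk⟩ := ZMod.intCast_surjective
    (((u⁻¹ : (ZMod (7 ^ n))ˣ) : ZMod (7 ^ n)) * diagB (modVec (7 ^ n) b) (modVec (7 ^ n) a))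
  refine ⟨intVec (b + (-k) • a), ?_, k, ?_⟩
  · rw [intVec_mem_perpLattice]
    refine ⟨?_, ?_⟩
    · obtain ⟨s, hs⟩ := ha
      obtain ⟨t, ht⟩ := hb
      refine ⟨t - k * s, ?_⟩
      simp only [Pi.add_apply, Pi.smul_apply, smul_eq_mul]
      linear_combination ht - k * hs
    · rw [modVec_add, modVec_smul, diagB_add_left, diagB_zsmul_left, diagB_self, ← hu]
      push_cast
      rw [hk]
      linear_combination (-diagB (modVec (7 ^ n) b) (modVec (7 ^ n) a)) * u.inv_mul
  · rw [intVec_add, intVec_smul]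
    module

theorem diagB_of_mem_perpLattice {a : Fin 3 → ℤ} {x : Fin 3 → ℚ}
    (hx : x ∈ perpLattice n (modVec (7 ^ n) a)) : ∃ k : ℤ, diagB x (intVec a) = 7 ^ n * k := by
  obtain ⟨b, -, hb, rfl⟩ := hx
  rw [diagB_modVec, intCast_eq_zero_iff] at hb
  obtain ⟨k, hk⟩ := hb
  exact ⟨k, by rw [diagB_intVec, hk]; push_cast; rfl⟩

/-- Pairing with three vectors of E shows that 12x is integral. Since 7ⁿx is integral too and 7 is
prime to 12, x is integral; its parity follows since 7ⁿ is odd. -/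
theorem mem_evenLattice_of_integral {x : Fin 3 → ℚ} (hx : (7 ^ n : ℤ) • x ∈ evenLattice)
    (h : ∀ y ∈ evenLattice, ∃ k : ℤ, diagB x y = k) : x ∈ evenLattice := by
  obtain ⟨c, hc, hcx⟩ := hx
  have h7 : Odd ((7 : ℤ) ^ n) := Odd.pow (by decide)
  have h7q : (7 ^ n : ℚ) ≠ 0 := by positivity
  have hci : ∀ i, (c i : ℚ) = 7 ^ n * x i := by
    intro i
    have := congrFun hcx i
    simp only [Pi.smul_apply] at this
    rw [zsmul_eq_mul] at this
    push_cast at this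
    exact this
  obtain ⟨k₀, hk₀⟩ := h (intVec ![1, 1, 0]) (intVec_mem_evenLattice.2 (by decide))
  obtain ⟨k₁, hk₁⟩ := h (intVec ![1, -1, 0]) (intVec_mem_evenLattice.2 (by decide))
  obtain ⟨k₂, hk₂⟩ := h (intVec ![0, 1, 1]) (intVec_mem_evenLattice.2 (by decide))
  simp [diagB, intVec] at hk₀ hk₁ hk₂
  have hcop : IsCoprime ((7 : ℤ) ^ n) 12 := IsCoprime.pow_left (by
    rw [Int.isCoprime_iff_gcd_eq_one]; rfl)
  have h0 : (7 : ℤ) ^ n ∣ c 0 := by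
    apply hcop.dvd_of_dvd_mul_left
    refine ⟨6 * (k₀ + k₁), ?_⟩
    have : ((12 * c 0 : ℤ) : ℚ) = ((7 ^ n * (6 * (k₀ + k₁)) : ℤ) : ℚ) := by
      push_cast; rw [hci, ← hk₀, ← hk₁]; ring
    exact_mod_cast this
  have h1 : (7 : ℤ) ^ n ∣ c 1 := by
    apply hcop.dvd_of_dvd_mul_left
    refine ⟨6 * (k₀ - k₁), ?_⟩
    have : ((12 * c 1 : ℤ) : ℚ) = ((7 ^ n * (6 * (k₀ - k₁)) : ℤ) : ℚ) := by
      push_cast; rw [hci, ← hk₀, ← hk₁]; ring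
    exact_mod_cast this
  have h2 : (7 : ℤ) ^ n ∣ c 2 := by
    apply hcop.dvd_of_dvd_mul_left
    refine ⟨2 * k₂ - (k₀ - k₁), ?_⟩
    have : ((12 * c 2 : ℤ) : ℚ) = ((7 ^ n * (2 * k₂ - (k₀ - k₁)) : ℤ) : ℚ) := by
      push_cast; rw [hci, ← hk₀, ← hk₁, ← hk₂]; ring
    exact_mod_cast this
  obtain ⟨d₀, hd₀⟩ := h0
  obtain ⟨d₁, hd₁⟩ := h1
  obtain ⟨d₂, hd₂⟩ := h2
  refine ⟨![d₀, d₁, d₂], ?_, ?_⟩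
  · rw [hd₀, hd₁, hd₂, ← mul_add, ← mul_add, Int.even_mul] at hc
    simpa using hc.resolve_left (Int.not_even_iff_odd.2 h7)
  · ext i
    apply mul_left_cancel₀ h7q
    rw [← hci]
    fin_cases i
    · simp [intVec, hd₀]
    · simp [intVec, hd₁]
    · simp [intVec, hd₂]

/-- E is the sublattice plus ℤa for an even lift a of w, so it suffices that σ(a) lies in E. It
pairs integrally with the target sublattice because a does so with the source, and with a' because
7ⁿσ(a) lies in the target; together these span E. -/
theorem image_evenLattice_le (hn : 1 ≤ n) {w w' : Fin 3 → ZMod (7 ^ n)} (hw : Admissible w)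
    (hw' : Admissible w') {σ : (Fin 3 → ℚ) ≃ₗ[ℚ] (Fin 3 → ℚ)}
    (hσ : σ ∈ orthogonalGroup (diagForm ℚ)) (h : image σ (perpLattice n w) = perpLattice n w') :
    image σ evenLattice ≤ evenLattice := by
  obtain ⟨a, ha, rfl⟩ := exists_even_modVec w
  obtain ⟨a', ha', rfl⟩ := exists_even_modVec w'
  have hy : (7 ^ n : ℤ) • σ (intVec a) ∈ perpLattice n (modVec (7 ^ n) a') := by
    rw [← h, ← map_zsmul]
    exact apply_mem_image (smul_mem_perpLattice _ ha)
  have hσa : σ (intVec a) ∈ evenLattice := by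
    refine mem_evenLattice_of_integral (n := n) (perpLattice_le _ _ hy) fun x hx => ?_
    obtain ⟨m, hm, k, rfl⟩ := exists_decomp hn ha' hw' hx
    rw [← h] at hm
    obtain ⟨m', hm', rfl⟩ := mem_image.1 hm
    obtain ⟨i, hi⟩ := diagB_of_mem_perpLattice hm'
    obtain ⟨j, hj⟩ := diagB_of_mem_perpLattice hy
    rw [diagB_zsmul_left] at hj
    push_cast at hj
    have hj' : diagB (σ (intVec a)) (intVec a') = j := mul_left_cancel₀ (by positivity) hj
    refine ⟨7 ^ n * i + k * j, ?_⟩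
    rw [diagB_add_right, diagB_zsmul_right, diagB_orthogonal hσ, diagB_comm, hi, hj']
    push_cast; rfl
  intro _ hσx
  obtain ⟨x, hx, rfl⟩ := mem_image.1 hσx
  obtain ⟨m, hm, k, rfl⟩ := exists_decomp hn ha hw hx
  rw [map_add, map_zsmul]
  exact add_mem (perpLattice_le _ _ (h ▸ apply_mem_image hm)) (zsmul_mem hσa k)

/-- The isometries between the lattices `perpLattice n w` preserve `evenLattice`. -/
theorem mem_isometryGroup_evenLattice (hn : 1 ≤ n) {w w' : Fin 3 → ZMod (7 ^ n)}
    (hw : Admissible w) (hw' : Admissible w') {σ : (Fin 3 → ℚ) ≃ₗ[ℚ] (Fin 3 → ℚ)}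
    (hσ : σ ∈ orthogonalGroup (diagForm ℚ)) (h : image σ (perpLattice n w) = perpLattice n w') :
    σ ∈ isometryGroup (diagForm ℚ) evenLattice := by
  refine mem_isometryGroup.2 ⟨hσ, le_antisymm (image_evenLattice_le hn hw hw' hσ h) ?_⟩
  have h' : image σ⁻¹ (perpLattice n w') = perpLattice n w := by
    rw [← h, image_image, inv_mul_cancel, image_one]
  have h1 := image_evenLattice_le hn hw' hw (inv_mem hσ) h'
  intro x hx
  rw [mem_image_iff]
  exact h1 (apply_mem_image hx)

end canonical

/-! ### Signed permutations and the isometry group of E. -/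

/-- Parameters for the signed permutation matrices that preserve `diagQ`: whether the first two
coordinates are exchanged, and the three signs. -/
abbrev SignedPerm : Type := Bool × ℤˣ × ℤˣ × ℤˣ

/-- The action of a signed permutation on vectors. -/
def signAct {R : Type*} [CommRing R] (g : SignedPerm) (x : Fin 3 → R) : Fin 3 → R :=
  ![((g.2.1 : ℤ) : R) * (if g.1 then x 1 else x 0),
    ((g.2.2.1 : ℤ) : R) * (if g.1 then x 0 else x 1), ((g.2.2.2 : ℤ) : R) * x 2]

/-- The inverse signed permutation. -/
def signInv (g : SignedPerm) : SignedPerm := if g.1 then (true, g.2.2.1, g.2.1, g.2.2.2) else g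

section signAct

variable {R : Type*} [CommRing R]

theorem intUnits_cast_mul_self (e : ℤˣ) : ((e : ℤ) : R) * ((e : ℤ) : R) = 1 := by
  rcases Int.units_eq_one_or e with rfl | rfl <;> simp

theorem signInv_signAct (g : SignedPerm) (x : Fin 3 → R) : signAct (signInv g) (signAct g x) = x := by
  obtain ⟨s, e₀, e₁, e₂⟩ := g
  have h := fun e => intUnits_cast_mul_self (R := R) e
  ext i
  cases s <;> fin_cases i <;> simp [signAct, signInv, ← mul_assoc, h]

theorem signAct_signInv (g : SignedPerm) (x : Fin 3 → R) : signAct g (signAct (signInv g) x) = x := by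
  obtain ⟨s, e₀, e₁, e₂⟩ := g
  have h := fun e => intUnits_cast_mul_self (R := R) e
  ext i
  cases s <;> fin_cases i <;> simp [signAct, signInv, ← mul_assoc, h]

theorem diagB_signAct (g : SignedPerm) (x y : Fin 3 → R) :
    diagB (signAct g x) (signAct g y) = diagB x y := by
  obtain ⟨s, e₀, e₁, e₂⟩ := g
  have h0 := intUnits_cast_mul_self (R := R) e₀
  have h1 := intUnits_cast_mul_self (R := R) e₁
  have h2 := intUnits_cast_mul_self (R := R) e₂
  cases s
  · simp [signAct, diagB]
    linear_combination x 0 * y 0 * h0 + x 1 * y 1 * h1 + 6 * x 2 * y 2 * h2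
  · simp [signAct, diagB]
    linear_combination x 1 * y 1 * h0 + x 0 * y 0 * h1 + 6 * x 2 * y 2 * h2

theorem intVec_signAct (g : SignedPerm) (a : Fin 3 → ℤ) :
    intVec (signAct g a) = signAct g (intVec a) := by
  ext i
  fin_cases i <;> simp [signAct, intVec]

theorem modVec_signAct (m : ℕ) (g : SignedPerm) (a : Fin 3 → ℤ) :
    modVec m (signAct g a) = signAct g (modVec m a) := by
  ext i
  fin_cases i <;> simp [signAct, modVec]

theorem even_signAct (g : SignedPerm) {a : Fin 3 → ℤ} (h : Even (a 0 + a 1 + a 2)) :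
    Even (signAct g a 0 + signAct g a 1 + signAct g a 2) := by
  obtain ⟨s, e₀, e₁, e₂⟩ := g
  rcases Int.units_eq_one_or e₀ with rfl | rfl <;> rcases Int.units_eq_one_or e₁ with rfl | rfl <;>
    rcases Int.units_eq_one_or e₂ with rfl | rfl <;> cases s <;>
    simp [signAct, Int.even_iff] at h ⊢ <;> omega

end signAct

/-- A signed permutation as a linear automorphism of `ℚ³`. -/
def signEquiv (g : SignedPerm) : (Fin 3 → ℚ) ≃ₗ[ℚ] (Fin 3 → ℚ) where
  toFun := signAct g
  invFun := signAct (signInv g)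
  map_add' x y := by
    ext i
    fin_cases i <;> simp [signAct] <;> (try split_ifs) <;> ring
  map_smul' c x := by
    ext i
    fin_cases i <;> simp [signAct] <;> (try split_ifs) <;> ring
  left_inv := signInv_signAct g
  right_inv := signAct_signInv g

theorem signEquiv_apply (g : SignedPerm) (x : Fin 3 → ℚ) : signEquiv g x = signAct g x := rfl

theorem signEquiv_mem_orthogonalGroup (g : SignedPerm) :
    signEquiv g ∈ orthogonalGroup (diagForm ℚ) := fun x => by
  rw [diagForm_apply, diagForm_apply, ← diagB_self, ← diagB_self, signEquiv_apply, diagB_signAct]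

theorem signEquiv_injective : Function.Injective signEquiv := by
  intro g g' h
  have h1 := fun x => congrArg (fun σ => σ x) h
  -- Nonzero coordinates with the first two distinct in absolute value, so only the identity fixes
  -- this vector.
  have h2 := h1 (intVec ![1, 2, 1])
  simp only [signEquiv_apply, ← intVec_signAct] at h2
  have h3 := intVec_injective h2
  revert g g'
  have key : ∀ g g' : SignedPerm, signAct g ![(1 : ℤ), 2, 1] = signAct g' ![(1 : ℤ), 2, 1] →
      g = g' := by decide
  intro g g' _ _ _ h
  exact key g g' h

theorem image_signEquiv_perpLattice {n : ℕ} (g : SignedPerm) (w : Fin 3 → ZMod (7 ^ n)) :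
    image (signEquiv g) (perpLattice n w) = perpLattice n (signAct g w) := by
  have hle : ∀ (g : SignedPerm) (w : Fin 3 → ZMod (7 ^ n)) (x : Fin 3 → ℚ),
      x ∈ perpLattice n w → signAct g x ∈ perpLattice n (signAct g w) := by
    rintro g w _ ⟨a, ha, ha', rfl⟩
    rw [← intVec_signAct, intVec_mem_perpLattice, modVec_signAct, diagB_signAct]
    exact ⟨even_signAct g ha, ha'⟩
  ext x
  constructor
  · intro hx
    obtain ⟨y, hy, rfl⟩ := mem_image.1 hx
    exact hle g w y hy
  · intro hx
    refine mem_image.2 ⟨signAct (signInv g) x, ?_, signAct_signInv g x⟩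
    simpa only [signInv_signAct] using hle (signInv g) _ x hx

/-- The norm 2 vectors of E are exactly (±1,±1,0). An isometry permutes them, hence preserves the
orthogonal z-axis, and is determined by the images of (1,1,0), (1,-1,0) and (0,0,1). -/
theorem exists_signEquiv {σ : (Fin 3 → ℚ) ≃ₗ[ℚ] (Fin 3 → ℚ)}
    (hσ : σ ∈ isometryGroup (diagForm ℚ) evenLattice) : ∃ g, σ = signEquiv g := by
  obtain ⟨hO, hL⟩ := mem_isometryGroup.1 hσ
  have hB := diagB_orthogonal hO
  have hshort : ∀ a : Fin 3 → ℤ, Even (a 0 + a 1 + a 2) → diagQ a = 2 →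
      ∃ (e e' : ℤˣ), σ (intVec a) = ![((e : ℤ) : ℚ), ((e' : ℤ) : ℚ), 0] := by
    intro a ha ha2
    have h1 : σ (intVec a) ∈ evenLattice := by
      rw [← hL]; exact apply_mem_image ⟨a, ha, rfl⟩
    obtain ⟨b, -, hb⟩ := h1
    have h2 : diagQ b = 2 := by
      have h3 := hB (intVec a) (intVec a)
      rw [← hb, diagB_intVec, diagB_intVec, diagB_self, diagB_self, ha2] at h3
      exact_mod_cast h3
    simp only [diagQ] at h2
    have hb2 : b 2 = 0 := by
      by_contra h0
      have : 1 ≤ b 2 ^ 2 := by have := sq_pos_of_ne_zero h0; omega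
      nlinarith [sq_nonneg (b 0), sq_nonneg (b 1)]
    rw [hb2] at h2
    have hb0 : b 0 ≠ 0 := by
      intro h0
      rw [h0] at h2
      have h4 : b 1 ≤ 1 := by nlinarith
      have h5 : -1 ≤ b 1 := by nlinarith
      have : b 1 = -1 ∨ b 1 = 0 ∨ b 1 = 1 := by omega
      rcases this with h | h | h <;> rw [h] at h2 <;> simp at h2
    have hb1 : b 1 ≠ 0 := by
      intro h0
      rw [h0] at h2
      have h4 : b 0 ≤ 1 := by nlinarith
      have h5 : -1 ≤ b 0 := by nlinarith
      have : b 0 = -1 ∨ b 0 = 0 ∨ b 0 = 1 := by omega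
      rcases this with h | h | h <;> rw [h] at h2 <;> simp at h2
    have h01 : 1 ≤ b 0 ^ 2 := by have := sq_pos_of_ne_zero hb0; omega
    have h11 : 1 ≤ b 1 ^ 2 := by have := sq_pos_of_ne_zero hb1; omega
    have hu : ∀ k : ℤ, k ^ 2 = 1 → ∃ e : ℤˣ, (e : ℤ) = k := by
      intro k hk
      rcases mul_self_eq_one_iff.1 ((pow_two k).symm.trans hk) with rfl | rfl
      · exact ⟨1, rfl⟩
      · exact ⟨-1, rfl⟩
    obtain ⟨e, he⟩ := hu (b 0) (by omega)
    obtain ⟨e', he'⟩ := hu (b 1) (by omega)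
    refine ⟨e, e', ?_⟩
    rw [← hb, he, he']
    ext i
    fin_cases i <;> simp [intVec, hb2]
  obtain ⟨e₀, e₁, h₁⟩ := hshort ![1, 1, 0] (by decide) (by decide)
  obtain ⟨e₂, e₃, h₂⟩ := hshort ![1, -1, 0] (by decide) (by decide)
  have h12 : (e₀ : ℚ) * e₂ + e₁ * e₃ = 0 := by
    have := hB (intVec ![1, 1, 0]) (intVec ![1, -1, 0])
    rw [h₁, h₂, diagB_intVec] at this
    simpa [diagB] using this
  obtain ⟨e₄, h₃⟩ : ∃ e₄ : ℤˣ, σ (intVec ![0, 0, 1]) = ![0, 0, ((e₄ : ℤ) : ℚ)] := by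
    have hb1 := hB (intVec ![1, 1, 0]) (intVec ![0, 0, 1])
    have hb2 := hB (intVec ![1, -1, 0]) (intVec ![0, 0, 1])
    have hb3 := hB (intVec ![0, 0, 1]) (intVec ![0, 0, 1])
    rw [h₁, diagB_intVec] at hb1
    rw [h₂, diagB_intVec] at hb2
    rw [diagB_intVec] at hb3
    set c := σ (intVec ![0, 0, 1])
    simp [diagB] at hb1 hb2 hb3
    have hc : c 0 = 0 ∧ c 1 = 0 := by
      rcases Int.units_eq_one_or e₀ with rfl | rfl <;>
        rcases Int.units_eq_one_or e₁ with rfl | rfl <;>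
        rcases Int.units_eq_one_or e₂ with rfl | rfl <;>
        rcases Int.units_eq_one_or e₃ with rfl | rfl <;>
        first
        | (exfalso; norm_num at h12; done)
        | (norm_num at hb1 hb2 ⊢; constructor <;> linarith)
    rw [hc.1, hc.2] at hb3
    have h2 : c 2 * c 2 = 1 := by linarith
    rcases mul_self_eq_one_iff.1 h2 with h | h
    · exact ⟨1, by ext i; fin_cases i <;> simp [hc, h]⟩
    · exact ⟨-1, by ext i; fin_cases i <;> simp [hc, h]⟩
  -- The image of (1,0,0) is half the sum of the images of (1,±1,0); its first coordinate vanishes,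
  -- meaning a swap, exactly when e₂ ≠ e₀.
  refine ⟨(decide (e₂ ≠ e₀), e₀, e₁, e₄), ?_⟩
  ext x i
  have hx : x = ((x 0 + x 1) / 2) • intVec ![1, 1, 0] + ((x 0 - x 1) / 2) • intVec ![1, -1, 0]
      + x 2 • intVec ![0, 0, 1] := by
    ext i
    fin_cases i <;> simp [intVec] <;> ring
  rw [signEquiv_apply]
  conv_lhs => rw [hx]
  rw [map_add, map_add, map_smul, map_smul, map_smul, h₁, h₂, h₃]
  rcases Int.units_eq_one_or e₀ with rfl | rfl <;>
    rcases Int.units_eq_one_or e₁ with rfl | rfl <;>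
    rcases Int.units_eq_one_or e₂ with rfl | rfl <;>
    rcases Int.units_eq_one_or e₃ with rfl | rfl <;>
    first
    | (exfalso; norm_num at h12; done)
    | (fin_cases i <;> simp [signAct] <;> ring)

theorem signEquiv_mem_isometryGroup (g : SignedPerm) :
    signEquiv g ∈ isometryGroup (diagForm ℚ) evenLattice := by
  have hle : ∀ (g : SignedPerm) (x : Fin 3 → ℚ), x ∈ evenLattice → signAct g x ∈ evenLattice := by
    rintro g _ ⟨a, ha, rfl⟩
    rw [← intVec_signAct, intVec_mem_evenLattice]
    exact even_signAct g ha
  refine mem_isometryGroup.2 ⟨signEquiv_mem_orthogonalGroup g, ?_⟩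
  ext x
  constructor
  · intro hx
    obtain ⟨y, hy, rfl⟩ := mem_image.1 hx
    exact hle g y hy
  · intro hx
    exact mem_image.2 ⟨signAct (signInv g) x, hle _ _ hx, signAct_signInv g x⟩

/-- The isometry group of `evenLattice` consists of the signed permutations. -/
def signEquivEquiv : SignedPerm ≃ isometryGroup (diagForm ℚ) evenLattice :=
  Equiv.ofBijective (fun g => ⟨signEquiv g, signEquiv_mem_isometryGroup g⟩)
    ⟨fun _ _ h => signEquiv_injective (congrArg Subtype.val h), fun σ => by
      obtain ⟨g, hg⟩ := exists_signEquiv σ.2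
      exact ⟨g, Subtype.ext hg.symm⟩⟩

theorem card_isometryGroup_evenLattice :
    Nat.card (isometryGroup (diagForm ℚ) evenLattice) = 16 := by
  rw [← Nat.card_congr signEquivEquiv, Nat.card_eq_fintype_card]
  rfl

theorem admissible_signAct {n : ℕ} (hn : 1 ≤ n) (g : SignedPerm) {w : Fin 3 → ZMod (7 ^ n)}
    (hw : Admissible w) : Admissible (signAct g w) := by
  obtain ⟨a, rfl⟩ := exists_modVec w
  rw [← modVec_signAct, admissible_modVec hn]
  rw [admissible_modVec hn] at hw
  rwa [← diagB_self, diagB_signAct, diagB_self]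

theorem card_isometryGroup_perpLattice {n : ℕ} (hn : 1 ≤ n) {w : Fin 3 → ZMod (7 ^ n)}
    (hw : Admissible w) : Nat.card (isometryGroup (diagForm ℚ) (perpLattice n w)) =
      Nat.card {g : SignedPerm // ∃ c : ZMod (7 ^ n), IsUnit c ∧ signAct g w = c • w} := by
  have hmem : ∀ g : {g : SignedPerm // ∃ c : ZMod (7 ^ n), IsUnit c ∧ signAct g w = c • w},
      signEquiv g.1 ∈ isometryGroup (diagForm ℚ) (perpLattice n w) := by
    intro g
    refine mem_isometryGroup.2 ⟨signEquiv_mem_orthogonalGroup _, ?_⟩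
    rw [image_signEquiv_perpLattice, eq_comm,
      perpLattice_eq_iff hn hw (admissible_signAct hn _ hw)]
    exact g.2
  let f (g : {g : SignedPerm // ∃ c : ZMod (7 ^ n), IsUnit c ∧ signAct g w = c • w}) :
    isometryGroup (diagForm ℚ) (perpLattice n w) := ⟨signEquiv g.1, hmem g⟩
  have hinj : Function.Injective f := fun g g' h =>
    Subtype.ext (signEquiv_injective (congrArg Subtype.val h))
  have hsurj : Function.Surjective f := by
    intro σ
    obtain ⟨hO, hL⟩ := mem_isometryGroup.1 σ.2
    obtain ⟨g, hg⟩ := exists_signEquiv (mem_isometryGroup_evenLattice hn hw hw hO hL)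
    have hc : ∃ c : ZMod (7 ^ n), IsUnit c ∧ signAct g w = c • w := by
      rw [← perpLattice_eq_iff hn hw (admissible_signAct hn _ hw), ← image_signEquiv_perpLattice,
        ← hg]
      exact hL.symm
    exact ⟨⟨g, hc⟩, Subtype.ext hg.symm⟩
  exact (Nat.card_eq_of_bijective f ⟨hinj, hsurj⟩).symm

/-! ### Stabilizers of admissible lines. -/

section stabilizer

variable {n : ℕ}

theorem isUnit_two (n : ℕ) : IsUnit (2 : ZMod (7 ^ n)) := by
  have : IsUnit ((2 : ℕ) : ZMod (7 ^ n)) := by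
    rw [ZMod.isUnit_iff_coprime]
    exact Nat.Coprime.pow_right n (by norm_num)
  simpa using this

theorem eq_zero_of_eq_neg {x : ZMod (7 ^ n)} (h : x = -x) : x = 0 := by
  have h1 : 2 * x = 0 := by linear_combination h
  exact (isUnit_two n).mul_right_eq_zero.1 h1

theorem cast_mul_seven (hn : 1 ≤ n) (x y : ZMod (7 ^ n)) :
    ((x * y).cast : ZMod 7) = x.cast * y.cast := ZMod.cast_mul (dvd_pow_of_one_le hn) x y

theorem cast_intCast_seven (hn : 1 ≤ n) (k : ℤ) :
    ((k : ZMod (7 ^ n)).cast : ZMod 7) = k := ZMod.cast_intCast (dvd_pow_of_one_le hn) k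

theorem cast_add_seven (hn : 1 ≤ n) (x y : ZMod (7 ^ n)) :
    ((x + y).cast : ZMod 7) = x.cast + y.cast := ZMod.cast_add (dvd_pow_of_one_le hn) x y

/-- The factors c + 1 and c - 1 differ by 2, so 7 cannot divide both and one of them is a unit. -/
theorem sq_eq_one_zmod (hn : 1 ≤ n) {c : ZMod (7 ^ n)} (h : c * c = 1) : c = 1 ∨ c = -1 := by
  have h1 : (c + (1 : ℤ)) * (c + (-1 : ℤ)) = 0 := by push_cast; linear_combination h
  by_cases hu : IsUnit (c + ((1 : ℤ) : ZMod (7 ^ n)))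
  · left
    have := hu.mul_right_eq_zero.1 h1
    push_cast at this
    linear_combination this
  · right
    have hu' : IsUnit (c + ((-1 : ℤ) : ZMod (7 ^ n))) := by
      rw [isUnit_iff_cast hn, cast_add_seven hn, cast_intCast_seven hn] at hu ⊢
      rw [not_not] at hu
      intro h0
      have h2 : ((1 : ℤ) : ZMod 7) = ((-1 : ℤ) : ZMod 7) := by
        linear_combination hu - h0
      revert h2
      decide
    have := hu'.mul_left_eq_zero.1 h1
    push_cast at this
    linear_combination this

theorem sq_ne_neg_one_zmod (hn : 1 ≤ n) {c : ZMod (7 ^ n)} : c * c ≠ ((-1 : ℤ) : ZMod (7 ^ n)) := by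
  intro h
  have h1 := congrArg (fun x : ZMod (7 ^ n) => (x.cast : ZMod 7)) h
  simp only [cast_mul_seven hn, cast_intCast_seven hn] at h1
  have key : ∀ x : ZMod 7, x * x ≠ ((-1 : ℤ) : ZMod 7) := by decide
  exact key _ h1

/-- A signed permutation that maps `w` to a multiple maps it to `±w`. -/
theorem signAct_eq_smul_iff (hn : 1 ≤ n) {w : Fin 3 → ZMod (7 ^ n)} (hw : Admissible w)
    (g : SignedPerm) : (∃ c : ZMod (7 ^ n), IsUnit c ∧ signAct g w = c • w) ↔
      ∃ l : ℤˣ, signAct g w = ((l : ℤ) : ZMod (7 ^ n)) • w := by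
  constructor
  · rintro ⟨c, -, hc⟩
    have hc2 : c = 1 ∨ c = -1 := by
      have e0 := congrFun hc 0
      have e1 := congrFun hc 1
      have e2 := congrFun hc 2
      obtain ⟨i, hi⟩ := hw.exists_isUnit hn
      obtain ⟨s, e₀, e₁, e₂⟩ := g
      have hsign : ∀ (e : ℤˣ) {x : ZMod (7 ^ n)}, IsUnit x → ((e : ℤ) : ZMod (7 ^ n)) * x = c * x →
          c = 1 ∨ c = -1 := by
        intro e x hx h
        rw [← hx.mul_right_cancel h]
        rcases Int.units_eq_one_or e with rfl | rfl <;> simp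
      -- For a swap, applying the relation twice gives c² = ±1; the value -1 is impossible since -1
      -- is not a square modulo 7.
      have hsq : ∀ (e : ℤˣ) {x : ZMod (7 ^ n)}, IsUnit x → ((e : ℤ) : ZMod (7 ^ n)) * x = c * c * x →
          c = 1 ∨ c = -1 := by
        intro e x hx h
        have h1 := hx.mul_right_cancel h
        rcases Int.units_eq_one_or e with rfl | rfl
        · exact sq_eq_one_zmod hn (by simpa using h1.symm)
        · exact absurd h1.symm (sq_ne_neg_one_zmod hn)
      cases s
      · simp [signAct] at e0 e1 e2
        match i, hi with
        | 0, hi => exact hsign e₀ hi e0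
        | 1, hi => exact hsign e₁ hi e1
        | 2, hi => exact hsign e₂ hi e2
      · simp [signAct] at e0 e1 e2
        have h0 := intUnits_cast_mul_self (R := ZMod (7 ^ n)) e₀
        have h1 := intUnits_cast_mul_self (R := ZMod (7 ^ n)) e₁
        match i, hi with
        | 0, hi =>
          refine hsq (e₀ * e₁) hi ?_
          push_cast
          linear_combination (e₀ : ZMod (7 ^ n)) * e1 + c * e0
        | 1, hi =>
          refine hsq (e₀ * e₁) hi ?_
          push_cast
          linear_combination (e₁ : ZMod (7 ^ n)) * e0 + c * e1
        | 2, hi => exact hsign e₂ hi e2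
    rcases hc2 with rfl | rfl
    · exact ⟨1, by simpa using hc⟩
    · exact ⟨-1, by simpa using hc⟩
  · rintro ⟨l, hl⟩
    exact ⟨_, IsUnit.of_mul_eq_one _ (intUnits_cast_mul_self l), hl⟩

theorem unit_mul_eq_unit_mul_iff (e l : ℤˣ) (x y : ZMod (7 ^ n)) :
    ((e : ℤ) : ZMod (7 ^ n)) * x = ((l : ℤ) : ZMod (7 ^ n)) * y ↔
      (e = l ∧ x = y) ∨ (e = -l ∧ x = -y) := by
  rcases Int.units_eq_one_or e with rfl | rfl <;> rcases Int.units_eq_one_or l with rfl | rfl <;>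
    first | (simp; done) | simp [neg_eq_iff_eq_neg]

/-- The stabilizer of the line through `w` in the group of signed permutations. -/
theorem stabilizer_iff (w : Fin 3 → ZMod (7 ^ n)) (g : SignedPerm) :
    (∃ l : ℤˣ, signAct g w = ((l : ℤ) : ZMod (7 ^ n)) • w) ↔
      ∃ l : ℤˣ, ((g.1 = false ∧ (g.2.1 = l ∨ w 0 = 0) ∧ (g.2.2.1 = l ∨ w 1 = 0)) ∨
        (g.1 = true ∧ ((g.2.1 = l ∧ w 0 = w 1) ∨ (g.2.1 = -l ∧ w 0 = -w 1)) ∧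
          ((g.2.2.1 = l ∧ w 0 = w 1) ∨ (g.2.2.1 = -l ∧ w 0 = -w 1)))) ∧
        (g.2.2.2 = l ∨ w 2 = 0) := by
  have hsame : ∀ (e l : ℤˣ) (x : ZMod (7 ^ n)), ((e : ℤ) : ZMod (7 ^ n)) * x =
      ((l : ℤ) : ZMod (7 ^ n)) * x ↔ (e = l ∨ x = 0) := by
    intro e l x
    rw [unit_mul_eq_unit_mul_iff]
    constructor
    · rintro (h | h)
      · exact Or.inl h.1
      · exact Or.inr (eq_zero_of_eq_neg h.2)
    · rintro (h | h)
      · exact Or.inl ⟨h, rfl⟩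
      · rcases Int.units_eq_one_or e with rfl | rfl <;>
          rcases Int.units_eq_one_or l with rfl | rfl <;> simp [h]
  refine exists_congr fun l => ?_
  obtain ⟨s, e₀, e₁, e₂⟩ := g
  rw [funext_iff, Fin.forall_fin_succ, Fin.forall_fin_succ, Fin.forall_fin_succ]
  cases s
  · simp [signAct, hsame, and_assoc]
  · simp [signAct, hsame, unit_mul_eq_unit_mul_iff, and_assoc, eq_comm (a := w 1),
      neg_eq_iff_eq_neg]

end stabilizer

/-- The vectors whose lattice has an isometry group of order at least `16`. -/
def OnAxis {n : ℕ} (w : Fin 3 → ZMod (7 ^ n)) : Prop := w 0 = 0 ∧ w 1 = 0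

/-- The vectors on a symmetry plane. -/
def OnPlane {n : ℕ} (w : Fin 3 → ZMod (7 ^ n)) : Prop :=
  w 2 = 0 ∨ w 0 = 0 ∨ w 1 = 0 ∨ w 0 = w 1 ∨ w 0 = -w 1

section order

variable {n : ℕ}

theorem cast_zero_seven (n : ℕ) : ((0 : ZMod (7 ^ n)).cast : ZMod 7) = 0 := ZMod.cast_zero

theorem cast_neg_seven (hn : 1 ≤ n) (x : ZMod (7 ^ n)) :
    ((-x).cast : ZMod 7) = -x.cast := ZMod.cast_neg (dvd_pow_of_one_le hn) x

/-- On these lines the norm is x² or 2x², and 2 = 3² modulo 7, so it is never a nonresidue. This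
rules out stabilizers of order 8. -/
theorem not_admissible_of_square (hn : 1 ≤ n) {w : Fin 3 → ZMod (7 ^ n)} (h2 : w 2 = 0)
    (h : w 0 = 0 ∨ w 1 = 0 ∨ w 0 = w 1 ∨ w 0 = -w 1) : ¬Admissible w := by
  have key : ∀ x y : ZMod 7, (x = 0 ∨ y = 0 ∨ x = y ∨ x = -y) →
      ¬(x ^ 2 + y ^ 2 + 6 * 0 ^ 2 = 3 ∨ x ^ 2 + y ^ 2 + 6 * 0 ^ 2 = 5 ∨
        x ^ 2 + y ^ 2 + 6 * 0 ^ 2 = 6) := by decide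
  have h' : (redVec w 0 = 0 ∨ redVec w 1 = 0 ∨ redVec w 0 = redVec w 1 ∨
      redVec w 0 = -redVec w 1) := by
    simp only [redVec]
    rcases h with h | h | h | h
    · left; rw [h, cast_zero_seven]
    · right; left; rw [h, cast_zero_seven]
    · right; right; left; rw [h]
    · right; right; right; rw [h, cast_neg_seven hn]
  have h2' : redVec w 2 = 0 := by simp only [redVec, h2, cast_zero_seven]
  rw [Admissible]
  simp only [diagQ, h2']
  exact key _ _ h'

theorem card_stabilizer_axis {n : ℕ} {w : Fin 3 → ZMod (7 ^ n)} (h : OnAxis w) :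
    Nat.card {g : SignedPerm // ∃ l : ℤˣ, signAct g w = ((l : ℤ) : ZMod (7 ^ n)) • w} = 16 := by
  obtain ⟨h0, h1⟩ := h
  have : ∀ g : SignedPerm, ∃ l : ℤˣ, signAct g w = ((l : ℤ) : ZMod (7 ^ n)) • w := by
    intro g
    refine ⟨g.2.2.2, ?_⟩
    ext i
    fin_cases i <;> simp [signAct, h0, h1]
  rw [Nat.card_congr (Equiv.subtypeUnivEquiv this), Nat.card_eq_fintype_card]
  rfl

/-- An admissible vector off the axis lies on at most one symmetry plane, so its line is fixed only
by ±1 and plus or minus the reflection in that plane. -/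
theorem card_stabilizer_plane (hn : 1 ≤ n) {w : Fin 3 → ZMod (7 ^ n)} (hw : Admissible w)
    (h : ¬OnAxis w) (h' : OnPlane w) :
    Nat.card {g : SignedPerm // ∃ l : ℤˣ, signAct g w = ((l : ℤ) : ZMod (7 ^ n)) • w} = 4 := by
  have hsq := fun h2 h3 => not_admissible_of_square hn (w := w) h2 h3 hw
  have hne : w 0 = w 1 → w 0 = -w 1 → False := fun h1 h2 => by
    have h3 := eq_zero_of_eq_neg (h1.symm.trans h2)
    exact h ⟨h1.trans h3, h3⟩
  have hax : w 0 = 0 → w 1 = 0 → False := fun h1 h2 => h ⟨h1, h2⟩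
  simp only [stabilizer_iff]
  by_cases h2 : w 2 = 0
  · have h0 : w 0 ≠ 0 := fun h0 => hsq h2 (by tauto)
    have h1 : w 1 ≠ 0 := fun h0 => hsq h2 (by tauto)
    have he : w 0 ≠ w 1 := fun h0 => hsq h2 (by tauto)
    have hf : w 0 ≠ -w 1 := fun h0 => hsq h2 (by tauto)
    simp only [h2, h0, h1, he, hf, or_false, and_false, or_true, and_true]
    rw [Nat.card_eq_fintype_card]
    decide
  · by_cases h0 : w 0 = 0
    · have h1 : w 1 ≠ 0 := fun h1 => hax h0 h1
      have he : (0 : ZMod (7 ^ n)) ≠ w 1 := fun h => h1 h.symm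
      have hf : (0 : ZMod (7 ^ n)) ≠ -w 1 := fun h => h1 (neg_eq_zero.1 h.symm)
      simp only [h2, h0, h1, he, hf, or_false, and_false, or_true]
      rw [Nat.card_eq_fintype_card]
      decide
    · by_cases h1 : w 1 = 0
      · simp only [h2, h0, h1, neg_zero, or_false, and_false, or_true, and_true]
        rw [Nat.card_eq_fintype_card]
        decide
      · by_cases he : w 0 = w 1
        · have hf : ¬w 0 = -w 1 := fun hf => hne he hf
          simp only [h2, h0, h1, hf, or_false, and_false]
          simp only [he, and_true]
          rw [Nat.card_eq_fintype_card]
          decide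
        · have hf : w 0 = -w 1 := by
            rcases h' with h | h | h | h | h <;> tauto
          simp only [h2, h0, h1, he, or_false, and_false, false_or]
          simp only [hf, and_true]
          rw [Nat.card_eq_fintype_card]
          decide

theorem card_stabilizer_generic {w : Fin 3 → ZMod (7 ^ n)} (h : ¬OnPlane w) :
    Nat.card {g : SignedPerm // ∃ l : ℤˣ, signAct g w = ((l : ℤ) : ZMod (7 ^ n)) • w} = 2 := by
  simp only [OnPlane, not_or] at h
  obtain ⟨h2, h0, h1, he, hf⟩ := h
  simp only [stabilizer_iff, h2, h0, h1, he, hf, or_false, and_false]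
  rw [Nat.card_eq_fintype_card]
  decide

/-- The order of the isometry group of `perpLattice n w`. -/
def symOrder (w : Fin 3 → ZMod (7 ^ n)) : ℕ :=
  open Classical in if OnAxis w then 16 else if OnPlane w then 4 else 2

theorem card_isometryGroup_eq_symOrder (hn : 1 ≤ n) {w : Fin 3 → ZMod (7 ^ n)}
    (hw : Admissible w) :
    Nat.card (isometryGroup (diagForm ℚ) (perpLattice n w)) = symOrder w := by
  rw [card_isometryGroup_perpLattice hn hw]
  simp only [signAct_eq_smul_iff hn hw]
  rw [symOrder]
  split_ifs with h h'
  · exact card_stabilizer_axis h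
  · exact card_stabilizer_plane hn hw h h'
  · exact card_stabilizer_generic h'

end order

/-! ### From vectors to lattices to classes by orbit counting. -/

/-- Orbit-stabilizer when the fibres of f on S are orbits with constant stabilizer order. It is used
for units acting on vectors and for O(E) acting on lattices. -/
theorem ncard_mul_card_stabilizer {G X Y : Type*} [Group G] [Finite G] [MulAction G X] {S : Set X}
    (hS : S.Finite) (f : X → Y) {m : ℕ}
    (hf : ∀ x ∈ S, ∀ y, y ∈ S ∧ f y = f x ↔ y ∈ MulAction.orbit G x)
    (hm : ∀ x ∈ S, Nat.card (MulAction.stabilizer G x) = m) :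
    S.ncard * m = Nat.card G * (f '' S).ncard := by
  classical
  have key : ∀ z ∈ hS.toFinset.image f,
      (hS.toFinset.filter (f · = z)).card * m = Nat.card G := by
    intro z hz
    obtain ⟨x, hx, rfl⟩ := Finset.mem_image.1 hz
    rw [Set.Finite.mem_toFinset] at hx
    have h1 : ((hS.toFinset.filter (f · = f x) : Finset X) : Set X) = MulAction.orbit G x := by
      ext y
      simpa using hf x hx y
    rw [← Set.ncard_coe_finset, h1, ← hm x hx, ← MulAction.index_stabilizer,
      Subgroup.index_mul_card]
  rw [Set.ncard_eq_toFinset_card S hS, Finset.card_eq_sum_card_image f, Finset.sum_mul,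
    Finset.sum_congr rfl key, Finset.sum_const, smul_eq_mul, mul_comm, ← Set.ncard_coe_finset]
  simp

section action

variable {F V R : Type*} [Field F] [AddCommGroup V] [Module F V] [CommRing R] [Algebra R F]
  [Module R V] [IsScalarTower R F V]

/-- The action of linear automorphisms on submodules. -/
abbrev imageAction : MulAction (V ≃ₗ[F] V) (Submodule R V) where
  smul := image
  one_smul := image_one
  mul_smul σ τ L := (image_image σ τ L).symm

theorem Isometric.card_isometryGroup_eq {Q : QuadraticForm F V} {L M : Submodule R V}
    (h : Isometric Q L M) : Nat.card (isometryGroup Q L) = Nat.card (isometryGroup Q M) := by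
  obtain ⟨τ, hτ, rfl⟩ := h
  refine Nat.card_congr (Equiv.subtypeEquiv (MulAut.conj τ).toEquiv fun σ => ?_)
  simp only [mem_isometryGroup, MulEquiv.toEquiv_eq_coe, EquivLike.coe_coe, MulAut.conj_apply]
  rw [image_image, inv_mul_cancel_right, ← image_image, (image_injective τ).eq_iff,
    Subgroup.mul_mem_cancel_right _ (inv_mem hτ), Subgroup.mul_mem_cancel_left _ hτ]

end action

section fibres

variable {n : ℕ}

/-- The admissible vectors whose lattice has an isometry group of order `m`. -/
def admissibleOfOrder (n m : ℕ) : Set (Fin 3 → ZMod (7 ^ n)) := {w | Admissible w ∧ symOrder w = m}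

/-- The units modulo 7ⁿ, φ(7ⁿ) = 6·7ⁿ⁻¹ in number, act freely on admissible vectors because some
coordinate is a unit. -/
theorem ncard_admissibleOfOrder (hn : 1 ≤ n) (m : ℕ) :
    (admissibleOfOrder n m).ncard =
      6 * 7 ^ (n - 1) * (perpLattice n '' admissibleOfOrder n m).ncard := by
  have hG : Nat.card (ZMod (7 ^ n))ˣ = 6 * 7 ^ (n - 1) := by
    rw [Nat.card_eq_fintype_card, ZMod.card_units_eq_totient,
      Nat.totient_prime_pow (by norm_num) (by omega), mul_comm]
  rw [← hG, ← mul_one (admissibleOfOrder n m).ncard]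
  refine ncard_mul_card_stabilizer (Set.toFinite _) _ ?_ ?_
  · rintro w ⟨hw, hm⟩ v
    constructor
    · rintro ⟨⟨hv, -⟩, h⟩
      obtain ⟨c, hc, rfl⟩ := (perpLattice_eq_iff hn hw hv).1 h.symm
      exact ⟨hc.unit, rfl⟩
    · rintro ⟨c, rfl⟩
      have hv := Admissible.smul hn hw c.isUnit
      have h : perpLattice n w = perpLattice n (c • w) :=
        (perpLattice_eq_iff hn hw hv).2 ⟨c, c.isUnit, rfl⟩
      refine ⟨⟨hv, ?_⟩, h.symm⟩
      change symOrder ((c : ZMod (7 ^ n)) • w) = m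
      rw [← card_isometryGroup_eq_symOrder hn hv, ← hm, ← card_isometryGroup_eq_symOrder hn hw]
      exact congrArg (fun L => Nat.card (isometryGroup (diagForm ℚ) L)) h.symm
  · rintro w ⟨hw, -⟩
    obtain ⟨i, hi⟩ := hw.exists_isUnit hn
    rw [Subgroup.card_eq_one, eq_bot_iff]
    intro c hc
    have h : (c : ZMod (7 ^ n)) * w i = w i := congrFun hc i
    rw [Subgroup.mem_bot, Units.ext_iff]
    exact hi.mul_right_cancel (by rw [h, Units.val_one, one_mul])

/-- The class in the space of `KForm n` of a lattice given in diagonal coordinates. -/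
def diagClass (n : ℕ) (M : Submodule ℤ (Fin 3 → ℚ)) : Set (Submodule ℤ (Fin 3 → ℚ)) :=
  isometryClass (KForm n) (image (coords n)⁻¹ M)

theorem image_coords_inv (n : ℕ) (M : Submodule ℤ (Fin 3 → ℚ)) :
    image (coords n) (image (coords n)⁻¹ M) = M := by
  rw [image_image, mul_inv_cancel, image_one]

theorem image_inv_coords (n : ℕ) (M : Submodule ℤ (Fin 3 → ℚ)) :
    image (coords n)⁻¹ (image (coords n) M) = M := by
  rw [image_image, inv_mul_cancel, image_one]

theorem isometryClass_eq_iff {V : Type*} [AddCommGroup V] [Module ℚ V] {Q : QuadraticForm ℚ V}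
    {L M : Submodule ℤ V} : isometryClass Q L = isometryClass Q M ↔ Isometric Q L M := by
  constructor
  · intro h
    have : M ∈ isometryClass Q L := h ▸ Isometric.refl Q M
    exact this
  · intro h
    ext N
    exact ⟨fun h' => h.symm.trans h', fun h' => h.trans h'⟩

theorem diagClass_eq_iff {L M : Submodule ℤ (Fin 3 → ℚ)} :
    diagClass n L = diagClass n M ↔ Isometric (diagForm ℚ) L M := by
  rw [diagClass, diagClass, isometryClass_eq_iff, isometric_KForm_iff, image_coords_inv,
    image_coords_inv]

/-- By rigidity, isometry between these lattices is equivalence under O(E), of order 16, and the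
stabilizer of a lattice there is its full isometry group, of order m. -/
theorem ncard_perpLattice_mul (hn : 1 ≤ n) (m : ℕ) :
    (perpLattice n '' admissibleOfOrder n m).ncard * m =
      16 * (diagClass n '' (perpLattice n '' admissibleOfOrder n m)).ncard := by
  let : MulAction ((Fin 3 → ℚ) ≃ₗ[ℚ] (Fin 3 → ℚ)) (Submodule ℤ (Fin 3 → ℚ)) := imageAction
  rw [← card_isometryGroup_evenLattice]
  have : Finite (isometryGroup (diagForm ℚ) evenLattice) :=
    Nat.finite_of_card_ne_zero (by rw [card_isometryGroup_evenLattice]; norm_num)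
  refine ncard_mul_card_stabilizer ((Set.toFinite _).image _) _ ?_ ?_
  · rintro _ ⟨w, ⟨hw, hm⟩, rfl⟩ M
    constructor
    · rintro ⟨⟨v, ⟨hv, -⟩, rfl⟩, h⟩
      obtain ⟨σ, hσ, h⟩ := diagClass_eq_iff.1 h.symm
      exact ⟨⟨σ, mem_isometryGroup_evenLattice hn hw hv hσ h⟩, h⟩
    · rintro ⟨⟨σ, hσ⟩, rfl⟩
      have hI : Isometric (diagForm ℚ) (perpLattice n w) (image σ (perpLattice n w)) :=
        ⟨σ, (mem_isometryGroup.1 hσ).1, rfl⟩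
      obtain ⟨g, rfl⟩ := exists_signEquiv hσ
      refine ⟨⟨signAct g w, ⟨admissible_signAct hn g hw, ?_⟩,
        (image_signEquiv_perpLattice g w).symm⟩, (diagClass_eq_iff.2 hI).symm⟩
      rw [← card_isometryGroup_eq_symOrder hn (admissible_signAct hn g hw), ← hm,
        ← card_isometryGroup_eq_symOrder hn hw, hI.card_isometryGroup_eq,
        image_signEquiv_perpLattice]
  · rintro _ ⟨w, ⟨hw, hm⟩, rfl⟩
    have hle : isometryGroup (diagForm ℚ) (perpLattice n w) ≤
        isometryGroup (diagForm ℚ) evenLattice := fun σ hσ =>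
      mem_isometryGroup_evenLattice hn hw hw (mem_isometryGroup.1 hσ).1 (mem_isometryGroup.1 hσ).2
    rw [← hm, ← card_isometryGroup_eq_symOrder hn hw,
      ← Nat.card_congr (Subgroup.subgroupOfEquivOfLe hle).toEquiv]
    refine Nat.card_congr (Equiv.subtypeEquivRight fun σ => ?_)
    rw [Subgroup.mem_subgroupOf, mem_isometryGroup]
    exact ⟨fun h => ⟨(mem_isometryGroup.1 σ.2).1, h⟩, fun h => h.2⟩

theorem genusClassesOfOrder_eq (hn : 1 ≤ n) (m : ℕ) :
    genusClassesOfOrder (KForm n) stdLattice m =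
      diagClass n '' (perpLattice n '' admissibleOfOrder n m) := by
  ext C
  constructor
  · rintro ⟨M, ⟨hM, hm⟩, rfl⟩
    rw [mem_genus_iff, image_coords_stdLattice] at hM
    obtain ⟨a, ha, hI⟩ := exists_isometric_perpLattice hn (genusProperties hM.1 hM.2)
    have hw := (admissible_modVec hn).2 ha
    refine ⟨_, ⟨modVec (7 ^ n) a, ⟨hw, ?_⟩, rfl⟩, ?_⟩
    · rw [← card_isometryGroup_eq_symOrder hn hw, hI.card_isometryGroup_eq,
        ← card_isometryGroup_KForm, hm]
    · rw [diagClass_eq_iff.2 hI, diagClass, image_inv_coords]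
  · rintro ⟨_, ⟨w, ⟨hw, hm⟩, rfl⟩, rfl⟩
    obtain ⟨a, rfl⟩ := exists_modVec w
    refine ⟨_, ⟨?_, ?_⟩, rfl⟩
    · rw [mem_genus_iff, image_coords_inv, image_coords_stdLattice]
      exact ⟨perpLattice_isLattice n _, fun p _ =>
        locallyIsometric_perpLattice ((admissible_modVec hn).1 hw) p⟩
    · rw [card_isometryGroup_KForm, image_coords_inv, card_isometryGroup_eq_symOrder hn hw, hm]

theorem ncard_genusClassesOfOrder (hn : 1 ≤ n) (m : ℕ) :
    (admissibleOfOrder n m).ncard * m =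
      96 * 7 ^ (n - 1) * (genusClassesOfOrder (KForm n) stdLattice m).ncard := by
  rw [genusClassesOfOrder_eq hn, ncard_admissibleOfOrder hn, mul_assoc, ncard_perpLattice_mul hn]
  ring

theorem finite_genusClassesOfOrder (hn : 1 ≤ n) (m : ℕ) :
    (genusClassesOfOrder (KForm n) stdLattice m).Finite := by
  rw [genusClassesOfOrder_eq hn]
  exact ((Set.toFinite _).image _).image _

theorem symOrder_eq (w : Fin 3 → ZMod (7 ^ n)) :
    symOrder w = 16 ∨ symOrder w = 4 ∨ symOrder w = 2 := by
  unfold symOrder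
  split_ifs <;> simp

theorem genusClasses_eq (hn : 1 ≤ n) : genusClasses (KForm n) stdLattice =
    genusClassesOfOrder (KForm n) stdLattice 16 ∪ (genusClassesOfOrder (KForm n) stdLattice 4 ∪
      genusClassesOfOrder (KForm n) stdLattice 2) := by
  ext C
  constructor
  · rintro ⟨M, hM, rfl⟩
    have h : isometryClass (KForm n) M ∈
        genusClassesOfOrder (KForm n) stdLattice (Nat.card (isometryGroup (KForm n) M)) :=
      ⟨M, ⟨hM, rfl⟩, rfl⟩
    have h' := h
    rw [genusClassesOfOrder_eq hn] at h'
    obtain ⟨_, ⟨w, ⟨-, hw⟩, -⟩, -⟩ := h'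
    rw [← hw] at h
    rcases symOrder_eq w with h1 | h1 | h1 <;> rw [h1] at h
    · exact Or.inl h
    · exact Or.inr (Or.inl h)
    · exact Or.inr (Or.inr h)
  · rintro (⟨M, ⟨hM, -⟩, rfl⟩ | ⟨M, ⟨hM, -⟩, rfl⟩ | ⟨M, ⟨hM, -⟩, rfl⟩) <;> exact ⟨M, hM, rfl⟩

theorem disjoint_genusClassesOfOrder {V : Type*} [AddCommGroup V] [Module ℚ V]
    (Q : QuadraticForm ℚ V) (L : Submodule ℤ V) {m m' : ℕ} (h : m ≠ m') :
    Disjoint (genusClassesOfOrder Q L m) (genusClassesOfOrder Q L m') := by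
  rw [Set.disjoint_left]
  rintro _ ⟨M, ⟨-, hM⟩, rfl⟩ ⟨M', ⟨-, hM'⟩, h'⟩
  exact h (by rw [← hM, ← hM', (isometryClass_eq_iff.1 h').card_isometryGroup_eq])

end fibres

/-! ### Point counts modulo 7 and the final formulas. -/

section counting

variable {n : ℕ}

theorem exists_equiv_prod_fin (hn : 1 ≤ n) :
    ∃ e : ZMod (7 ^ n) ≃ ZMod 7 × Fin (7 ^ (n - 1)), ∀ x, (e x).1 = x.cast := by
  have hpow : 7 ^ n = 7 * 7 ^ (n - 1) := by rw [← pow_succ', Nat.sub_add_cancel hn]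
  let f : ZMod (7 ^ n) → ZMod 7 × Fin (7 ^ (n - 1)) := fun x =>
    -- Remainder and quotient by 7: every residue modulo 7 has 7ⁿ⁻¹ lifts, so conditions modulo 7
    -- are counted by a finite check.
    (x.cast, ⟨x.val / 7, Nat.div_lt_of_lt_mul (hpow ▸ x.val_lt)⟩)
  have hf : Function.Injective f := by
    intro x y h
    have h1 : (x.cast : ZMod 7) = y.cast := congrArg Prod.fst h
    have h2 : x.val / 7 = y.val / 7 := congrArg (fun z => z.2.1) h
    rw [ZMod.cast_eq_val, ZMod.cast_eq_val, ZMod.natCast_eq_natCast_iff'] at h1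
    apply ZMod.val_injective
    omega
  refine ⟨Equiv.ofBijective f ((Fintype.bijective_iff_injective_and_card f).2 ⟨hf, ?_⟩),
    fun x => rfl⟩
  simp [ZMod.card, hpow]

theorem ncard_setOf_cast (hn : 1 ≤ n) {ι : Type*} [Fintype ι] (P : (ι → ZMod 7) → Prop) :
    {v : ι → ZMod (7 ^ n) | P fun i => (v i).cast}.ncard =
      Nat.card {v // P v} * (7 ^ (n - 1)) ^ Fintype.card ι := by
  obtain ⟨e, he⟩ := exists_equiv_prod_fin hn
  let e' : (ι → ZMod (7 ^ n)) ≃ (ι → ZMod 7) × (ι → Fin (7 ^ (n - 1))) :=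
    (Equiv.piCongrRight fun _ => e).trans (Equiv.arrowProdEquivProdArrow _ _ _)
  have h1 : {v : ι → ZMod (7 ^ n) // P fun i => (v i).cast} ≃
      {v : (ι → ZMod 7) × (ι → Fin (7 ^ (n - 1))) // P v.1} :=
    Equiv.subtypeEquiv e' fun v => by
      have : (e' v).1 = fun i => (v i).cast := funext fun i => he (v i)
      rw [this]
  rw [← Nat.card_coe_set_eq, Set.coe_ofPred, Nat.card_congr h1,
    Nat.card_congr (Equiv.prodSubtypeFstEquivSubtypeProd (p := P)), Nat.card_prod,
    Nat.card_fun, Nat.card_eq_fintype_card (α := ι), Nat.card_eq_fintype_card (α := Fin _),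
    Fintype.card_fin]

/-- Equalities such as w₀ = 0 hold modulo 7ⁿ, not just modulo 7; parametrizing the subspace by j
leaves a condition on free coordinates modulo 7 only. -/
theorem ncard_admissible_range (hn : 1 ≤ n) {ι : Type*} [Fintype ι]
    {j : (ι → ZMod (7 ^ n)) → Fin 3 → ZMod (7 ^ n)} (hj : Function.Injective j)
    {P : (ι → ZMod 7) → Prop} (hP : ∀ v, Admissible (j v) ↔ P fun i => (v i).cast)
    {S : Set (Fin 3 → ZMod (7 ^ n))} (hS : ∀ w, w ∈ S ↔ Admissible w ∧ w ∈ Set.range j) :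
    S.ncard = Nat.card {v // P v} * (7 ^ (n - 1)) ^ Fintype.card ι := by
  rw [← ncard_setOf_cast hn, ← Set.ncard_image_of_injective _ hj]
  congr 1
  ext w
  rw [hS]
  constructor
  · rintro ⟨hw, v, rfl⟩
    exact ⟨v, (hP v).1 hw, rfl⟩
  · rintro ⟨v, hv, rfl⟩
    exact ⟨(hP v).2 hv, v, rfl⟩

/-- Whether a residue modulo `7` is `3`, `5` or `6`. -/
abbrev IsNonresidue (x : ZMod 7) : Prop := x = 3 ∨ x = 5 ∨ x = 6

theorem ncard_admissible (hn : 1 ≤ n) :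
    {w : Fin 3 → ZMod (7 ^ n) | Admissible w}.ncard = 126 * (7 ^ (n - 1)) ^ 3 := by
  have h := ncard_setOf_cast hn (fun v : Fin 3 → ZMod 7 => IsNonresidue (diagQ v))
  have hc : Nat.card {v : Fin 3 → ZMod 7 // IsNonresidue (diagQ v)} = 126 := by
    rw [Nat.card_eq_fintype_card]
    simp only [diagQ]
    decide +kernel
  rw [hc, Fintype.card_fin] at h
  exact h

theorem ncard_admissible_two (hn : 1 ≤ n) :
    {w : Fin 3 → ZMod (7 ^ n) | Admissible w ∧ w 2 = 0}.ncard = 24 * (7 ^ (n - 1)) ^ 2 := by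
  have hc : Nat.card {v : Fin 2 → ZMod 7 // IsNonresidue (v 0 ^ 2 + v 1 ^ 2)} = 24 := by
    rw [Nat.card_eq_fintype_card]
    decide +kernel
  rw [ncard_admissible_range hn (ι := Fin 2) (j := fun v => ![v 0, v 1, 0]) (P := fun v =>
    IsNonresidue (v 0 ^ 2 + v 1 ^ 2)) ?_ ?_ ?_, hc, Fintype.card_fin]
  · intro v v' h
    have h0 := congrFun h 0
    have h1 := congrFun h 1
    ext i
    fin_cases i
    · exact h0
    · exact h1
  · intro v
    simp [Admissible, redVec, diagQ]
  · intro w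
    refine and_congr_right fun _ => ⟨fun h => ⟨![w 0, w 1], ?_⟩, ?_⟩
    · ext i
      fin_cases i <;> simp [h]
    · rintro ⟨v, rfl⟩
      rfl

theorem ncard_admissible_zero (hn : 1 ≤ n) :
    {w : Fin 3 → ZMod (7 ^ n) | Admissible w ∧ w 0 = 0}.ncard = 18 * (7 ^ (n - 1)) ^ 2 := by
  have hc : Nat.card {v : Fin 2 → ZMod 7 // IsNonresidue (v 0 ^ 2 + 6 * v 1 ^ 2)} = 18 := by
    rw [Nat.card_eq_fintype_card]
    decide +kernel
  rw [ncard_admissible_range hn (ι := Fin 2) (j := fun v => ![0, v 0, v 1]) (P := fun v =>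
    IsNonresidue (v 0 ^ 2 + 6 * v 1 ^ 2)) ?_ ?_ ?_, hc, Fintype.card_fin]
  · intro v v' h
    have h0 := congrFun h 1
    have h1 := congrFun h 2
    ext i
    fin_cases i
    · exact h0
    · exact h1
  · intro v
    simp [Admissible, redVec, diagQ]
  · intro w
    refine and_congr_right fun _ => ⟨fun h => ⟨![w 1, w 2], ?_⟩, ?_⟩
    · ext i
      fin_cases i <;> simp [h]
    · rintro ⟨v, rfl⟩
      rfl

theorem ncard_admissible_one (hn : 1 ≤ n) :
    {w : Fin 3 → ZMod (7 ^ n) | Admissible w ∧ w 1 = 0}.ncard = 18 * (7 ^ (n - 1)) ^ 2 := by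
  have hc : Nat.card {v : Fin 2 → ZMod 7 // IsNonresidue (v 0 ^ 2 + 6 * v 1 ^ 2)} = 18 := by
    rw [Nat.card_eq_fintype_card]
    decide +kernel
  rw [ncard_admissible_range hn (ι := Fin 2) (j := fun v => ![v 0, 0, v 1]) (P := fun v =>
    IsNonresidue (v 0 ^ 2 + 6 * v 1 ^ 2)) ?_ ?_ ?_, hc, Fintype.card_fin]
  · intro v v' h
    have h0 := congrFun h 0
    have h1 := congrFun h 2
    ext i
    fin_cases i
    · exact h0
    · exact h1
  · intro v
    simp [Admissible, redVec, diagQ]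
  · intro w
    refine and_congr_right fun _ => ⟨fun h => ⟨![w 0, w 2], ?_⟩, ?_⟩
    · ext i
      fin_cases i <;> simp [h]
    · rintro ⟨v, rfl⟩
      rfl

theorem ncard_admissible_eq (hn : 1 ≤ n) (e : ℤˣ) :
    {w : Fin 3 → ZMod (7 ^ n) | Admissible w ∧ w 0 = ((e : ℤ) : ZMod (7 ^ n)) * w 1}.ncard =
      18 * (7 ^ (n - 1)) ^ 2 := by
  have hc : Nat.card {v : Fin 2 → ZMod 7 // IsNonresidue (v 0 ^ 2 + v 0 ^ 2 + 6 * v 1 ^ 2)} =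
      18 := by
    rw [Nat.card_eq_fintype_card]
    decide +kernel
  rw [ncard_admissible_range hn (ι := Fin 2)
    (j := fun v => ![((e : ℤ) : ZMod (7 ^ n)) * v 0, v 0, v 1]) (P := fun v =>
    IsNonresidue (v 0 ^ 2 + v 0 ^ 2 + 6 * v 1 ^ 2)) ?_ ?_ ?_, hc, Fintype.card_fin]
  · intro v v' h
    have h0 := congrFun h 1
    have h1 := congrFun h 2
    ext i
    fin_cases i
    · exact h0
    · exact h1
  · intro v
    rcases Int.units_eq_one_or e with rfl | rfl <;>
      simp [Admissible, redVec, diagQ, cast_neg_seven hn]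
  · intro w
    refine and_congr_right fun _ => ⟨fun h => ⟨![w 1, w 2], ?_⟩, ?_⟩
    · ext i
      fin_cases i <;> simp [h]
    · rintro ⟨v, rfl⟩
      rfl

theorem ncard_admissible_axis (hn : 1 ≤ n) :
    {w : Fin 3 → ZMod (7 ^ n) | Admissible w ∧ OnAxis w}.ncard = 6 * 7 ^ (n - 1) := by
  have hc : Nat.card {v : Fin 1 → ZMod 7 // IsNonresidue (6 * v 0 ^ 2)} = 6 := by
    rw [Nat.card_eq_fintype_card]
    decide +kernel
  rw [ncard_admissible_range hn (ι := Fin 1) (j := fun v => ![0, 0, v 0]) (P := fun v =>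
    IsNonresidue (6 * v 0 ^ 2)) ?_ ?_ ?_, hc, Fintype.card_fin, pow_one]
  · intro v v' h
    have h0 := congrFun h 2
    ext i
    fin_cases i
    exact h0
  · intro v
    simp [Admissible, redVec, diagQ]
  · intro w
    refine and_congr_right fun _ => ⟨fun h => ⟨![w 2], ?_⟩, ?_⟩
    · ext i
      fin_cases i <;> simp [h.1, h.2]
    · rintro ⟨v, rfl⟩
      exact ⟨rfl, rfl⟩

theorem admissibleOfOrder_sixteen :
    admissibleOfOrder n 16 = {w : Fin 3 → ZMod (7 ^ n) | Admissible w ∧ OnAxis w} := by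
  ext w
  refine and_congr_right fun _ => ?_
  unfold symOrder
  split_ifs <;> simp [*]

theorem admissibleOfOrder_four : admissibleOfOrder n 4 =
    {w : Fin 3 → ZMod (7 ^ n) | Admissible w ∧ OnPlane w ∧ ¬OnAxis w} := by
  ext w
  refine and_congr_right fun _ => ?_
  unfold symOrder
  split_ifs <;> simp [*]

theorem ncard_admissibleOfOrder_sixteen (hn : 1 ≤ n) :
    (admissibleOfOrder n 16).ncard = 6 * 7 ^ (n - 1) := by
  rw [admissibleOfOrder_sixteen, ncard_admissible_axis hn]

theorem ncard_plane_add_axis (hn : 1 ≤ n) {p : (Fin 3 → ZMod (7 ^ n)) → Prop}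
    (hp : ∀ w, OnAxis w → p w) {k : ℕ}
    (h : {w : Fin 3 → ZMod (7 ^ n) | Admissible w ∧ p w}.ncard = k) :
    {w : Fin 3 → ZMod (7 ^ n) | Admissible w ∧ p w ∧ ¬OnAxis w}.ncard + 6 * 7 ^ (n - 1) = k := by
  rw [← h, ← ncard_admissible_axis hn, ← Set.ncard_union_eq]
  · congr 1
    ext w
    simp only [Set.mem_union, Set.mem_ofPred_eq]
    have := hp w
    tauto
  · rw [Set.disjoint_left]
    rintro w ⟨-, -, h1⟩ ⟨-, h2⟩
    exact h1 h2

/-- The plane w₂ = 0 has 24q² admissible vectors, q = 7ⁿ⁻¹, and meets the other four planes in none.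
Those have 18q² each and meet pairwise exactly in the 6q axis vectors, whence 24q² + 4(18q² - 6q).
-/
theorem ncard_admissibleOfOrder_four (hn : 1 ≤ n) :
    (admissibleOfOrder n 4).ncard + 24 * 7 ^ (n - 1) = 96 * (7 ^ (n - 1)) ^ 2 := by
  have hA := ncard_plane_add_axis hn (fun w h => h.1) (ncard_admissible_zero hn)
  have hB := ncard_plane_add_axis hn (fun w h => h.2) (ncard_admissible_one hn)
  have hC := ncard_plane_add_axis hn (fun w h => by rw [h.1, h.2, mul_zero])
    (ncard_admissible_eq hn 1)
  have hD := ncard_plane_add_axis hn (fun w h => by rw [h.1, h.2, mul_zero])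
    (ncard_admissible_eq hn (-1))
  have hZ := ncard_admissible_two hn
  simp only [Units.val_one, Units.val_neg, Int.cast_one, Int.cast_neg, one_mul, neg_mul]
    at hA hB hC hD
  have hU : admissibleOfOrder n 4 =
      {w : Fin 3 → ZMod (7 ^ n) | Admissible w ∧ w 2 = 0} ∪
      ({w : Fin 3 → ZMod (7 ^ n) | Admissible w ∧ w 0 = 0 ∧ ¬OnAxis w} ∪
      ({w : Fin 3 → ZMod (7 ^ n) | Admissible w ∧ w 1 = 0 ∧ ¬OnAxis w} ∪
      ({w : Fin 3 → ZMod (7 ^ n) | Admissible w ∧ w 0 = w 1 ∧ ¬OnAxis w} ∪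
      {w : Fin 3 → ZMod (7 ^ n) | Admissible w ∧ w 0 = -w 1 ∧ ¬OnAxis w}))) := by
    rw [admissibleOfOrder_four]
    ext w
    have hsq := fun h2 h3 hw => not_admissible_of_square hn (w := w) h2 h3 hw
    simp only [Set.mem_union, Set.mem_ofPred_eq, OnPlane, OnAxis] at hsq ⊢
    tauto
  rw [hU, Set.ncard_union_eq, Set.ncard_union_eq, Set.ncard_union_eq, Set.ncard_union_eq]
  · omega
  · rw [Set.disjoint_left]
    rintro w ⟨-, h, hx⟩ ⟨-, h', -⟩
    have h0 := eq_zero_of_eq_neg (h.symm.trans h')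
    exact hx ⟨h.trans h0, h0⟩
  · rw [Set.disjoint_left]
    rintro w ⟨-, h, hx⟩ (⟨-, h', -⟩ | ⟨-, h', -⟩)
    · exact hx ⟨h'.trans h, h⟩
    · exact hx ⟨by rw [h', h, neg_zero], h⟩
  · rw [Set.disjoint_left]
    rintro w ⟨-, h, hx⟩ (⟨-, h', -⟩ | ⟨-, h', -⟩ | ⟨-, h', -⟩)
    · exact hx ⟨h, h'⟩
    · exact hx ⟨h, h'.symm.trans h⟩
    · exact hx ⟨h, neg_eq_zero.1 (h'.symm.trans h)⟩
  · rw [Set.disjoint_left]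
    rintro w ⟨hw, h⟩ h'
    refine not_admissible_of_square hn h ?_ hw
    rcases h' with ⟨-, h', -⟩ | ⟨-, h', -⟩ | ⟨-, h', -⟩ | ⟨-, h', -⟩ <;> simp [h']

theorem ncard_admissibleOfOrder_add (hn : 1 ≤ n) :
    (admissibleOfOrder n 16).ncard + ((admissibleOfOrder n 4).ncard +
      (admissibleOfOrder n 2).ncard) = 126 * (7 ^ (n - 1)) ^ 3 := by
  have hd : ∀ m m', m ≠ m' → Disjoint (admissibleOfOrder n m) (admissibleOfOrder n m') := by
    intro m m' h
    rw [Set.disjoint_left]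
    rintro w ⟨-, h1⟩ ⟨-, h2⟩
    exact h (h1.symm.trans h2)
  rw [← ncard_admissible hn, ← Set.ncard_union_eq (hd 4 2 (by norm_num)), ← Set.ncard_union_eq]
  · congr 1
    ext w
    simp only [admissibleOfOrder, Set.mem_union, Set.mem_ofPred_eq, ← and_or_left, symOrder_eq,
      and_true]
  · rw [Set.disjoint_union_right]
    exact ⟨hd _ _ (by norm_num), hd _ _ (by norm_num)⟩

theorem ncard_genusClassesOfOrder_sixteen (hn : 1 ≤ n) :
    (genusClassesOfOrder (KForm n) stdLattice 16).ncard = 1 := by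
  have h := ncard_genusClassesOfOrder hn 16
  rw [ncard_admissibleOfOrder_sixteen hn] at h
  have hk : 0 < 96 * 7 ^ (n - 1) := by positivity
  refine Nat.eq_of_mul_eq_mul_left hk ?_
  linarith

theorem genusClassesOfOrder_sixteen (hn : 1 ≤ n) :
    genusClassesOfOrder (KForm n) stdLattice 16 = {isometryClass (KForm n) stdLattice} := by
  obtain ⟨C, hC⟩ := Set.ncard_eq_one.1 (ncard_genusClassesOfOrder_sixteen hn)
  have hm : isometryClass (KForm n) stdLattice ∈
      genusClassesOfOrder (KForm n) stdLattice 16 := by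
    rw [genusClassesOfOrder_eq hn, admissibleOfOrder_sixteen]
    refine ⟨stdPerp n, ⟨![0, 0, 1], ⟨?_, rfl, rfl⟩, rfl⟩, ?_⟩
    · right; right
      have h1 : ((1 : ZMod (7 ^ n)).cast : ZMod 7) = 1 := ZMod.cast_one (dvd_pow_of_one_le hn)
      simp [redVec, diagQ, h1]
    · rw [diagClass, ← image_coords_stdLattice, image_inv_coords]
  rw [hC] at hm ⊢
  rw [Set.mem_singleton_iff.1 hm]

theorem genusClassesOfOrder_eight (hn : 1 ≤ n) :
    genusClassesOfOrder (KForm n) stdLattice 8 = ∅ := by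
  have h : admissibleOfOrder n 8 = ∅ := by
    ext w
    have := symOrder_eq w
    simp only [admissibleOfOrder, Set.mem_ofPred_eq, Set.mem_empty_iff_false, iff_false]
    omega
  rw [genusClassesOfOrder_eq hn, h, Set.image_empty, Set.image_empty]

theorem ncard_genusClassesOfOrder_four (hn : 1 ≤ n) :
    ((genusClassesOfOrder (KForm n) stdLattice 4).ncard : ℚ) = 4 * 7 ^ (n - 1) - 1 := by
  have h := ncard_genusClassesOfOrder hn 4
  have h4 := ncard_admissibleOfOrder_four hn
  have hk : (7 ^ (n - 1) : ℚ) ≠ 0 := by positivity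
  qify at h h4
  refine mul_left_cancel₀ hk ?_
  linear_combination -h / 96 + h4 / 24

theorem ncard_genusClassesOfOrder_two (hn : 1 ≤ n) :
    ((genusClassesOfOrder (KForm n) stdLattice 2).ncard : ℚ) =
      3 * 7 ^ (2 * (n - 1)) - 2 * 7 ^ (n - 1) - 3 / 8 * (7 ^ (2 * (n - 1)) - 1) := by
  have h := ncard_genusClassesOfOrder hn 2
  have h4 := ncard_admissibleOfOrder_four hn
  have h16 := ncard_admissibleOfOrder_sixteen hn
  have ha := ncard_admissibleOfOrder_add hn
  have hk : (7 ^ (n - 1) : ℚ) ≠ 0 := by positivity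
  qify at h h4 h16 ha
  rw [mul_comm 2 (n - 1), pow_mul]
  refine mul_left_cancel₀ hk ?_
  -- With q = 7ⁿ⁻¹, the order 2 vectors number 126q³ - 96q² + 18q; division by 48q gives the count
  -- of classes.
  linear_combination -h / 96 + (ha - h4 - h16) / 48

end counting

end QuadLattice
end

theorem mainTheorem8 (n : ℕ) (hn : 1 ≤ n) :
    (QuadLattice.genusClasses (QuadLattice.KForm n) QuadLattice.stdLattice).Finite ∧
    QuadLattice.genusClassesOfOrder (QuadLattice.KForm n) QuadLattice.stdLattice 16 =
      {QuadLattice.isometryClass (QuadLattice.KForm n) QuadLattice.stdLattice} ∧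
    QuadLattice.genusClassesOfOrder (QuadLattice.KForm n) QuadLattice.stdLattice 8 = ∅ ∧
    ((QuadLattice.genusClassesOfOrder (QuadLattice.KForm n) QuadLattice.stdLattice 4).ncard : ℚ) =
      4 * 7 ^ (n - 1) - 1 ∧
    ((QuadLattice.genusClassesOfOrder (QuadLattice.KForm n) QuadLattice.stdLattice 2).ncard : ℚ) =
      3 * 7 ^ (2 * (n - 1)) - 2 * 7 ^ (n - 1) - 3 / 8 * (7 ^ (2 * (n - 1)) - 1) ∧
    (QuadLattice.classNumber (QuadLattice.KForm n) QuadLattice.stdLattice : ℚ) =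
      3 * 7 ^ (2 * (n - 1)) + 2 * 7 ^ (n - 1) - 3 / 8 * (7 ^ (2 * (n - 1)) - 1) := by
  have hf := QuadLattice.finite_genusClassesOfOrder hn
  have hd := fun m m' h => QuadLattice.disjoint_genusClassesOfOrder (QuadLattice.KForm n)
    QuadLattice.stdLattice (m := m) (m' := m') h
  have h4 := QuadLattice.ncard_genusClassesOfOrder_four hn
  have h2 := QuadLattice.ncard_genusClassesOfOrder_two hn
  refine ⟨?_, QuadLattice.genusClassesOfOrder_sixteen hn,
    QuadLattice.genusClassesOfOrder_eight hn, h4, h2, ?_⟩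
  · rw [QuadLattice.genusClasses_eq hn]
    exact (hf 16).union ((hf 4).union (hf 2))
  · rw [QuadLattice.classNumber, QuadLattice.genusClasses_eq hn,
      Set.ncard_union_eq (Set.disjoint_union_right.2
        ⟨hd _ _ (by norm_num), hd _ _ (by norm_num)⟩) (hf 16) ((hf 4).union (hf 2)),
      Set.ncard_union_eq (hd _ _ (by norm_num)) (hf 4) (hf 2),
      QuadLattice.ncard_genusClassesOfOrder_sixteen hn]
    push_cast
    rw [h4, h2]
    ring
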